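/- Let $n\ge 2$, let $M\subset\mathbb R^n$ be the closed unit ball and let $g$ be a $C^{1,1}$ Riemannian metric on $M$ (components differentiable on $M$ with Lipschitz derivatives). Let $\Gamma^l_{\ jk}$ be its Christoffel symbols, $SM=\{(x,v): x\in M,\ |v|_{g(x)}=1\}$ its unit sphere bundle with volume $d\Sigma_g=dS_x\,dV_g$, $\partial(SM)$ the part of $SM$ over $\partial M$, and $N$ the bundle over $SM$ with fibres $N_{(x,v)}=\{v\}^\perp\subset T_xM$. With $r(x,v)=(x,v/|v|_{g(x)})$, put on $SM$ $$\partial_k u=\partial_{v^k}(u\circ r),\quad \delta_j u=\partial_{x^j}(u\circ r)-\Gamma^l_{\ jk}v^k\,\partial_{v^l}(u\circ r),\quad Xu=v^j\delta_ju,$$ $$\overset{v}{\nabla}u=(g^{jk}\partial_ku)\partial_{x^j},\quad \overset{h}{\nabla}u=(g^{jk}\delta_ku-(Xu)v^j)\partial_{x^j},$$ and for sections $V$ of $N$ $$XV=(XV^l+\Gamma^l_{\ jk}v^jV^k)\partial_{x^l},\quad \overset{v}{\mathrm{div}}V=\partial_jV^j,\quad \overset{h}{\mathrm{div}}V=(\delta_j+\Gamma^i_{\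 ji})V^j,\quad RV=R(V,v)v,$$ where $R$ is the curvature tensor, defined almost everywhere and bounded. The spaces $L^2(SM)$ and $L^2(N)$ are taken with respect to $d\Sigma_g$ and $g$. $H^1(SM)$ is the completion of $C^1(SM)$ in the norm given by $\|u\|^2+\|Xu\|^2+\|\overset{v}{\nabla}u\|^2+\|\overset{h}{\nabla}u\|^2$; $H^1(N,X)$ is the completion of $C^1(N)$ in the norm given by $\|V\|^2+\|XV\|^2$; $H^1_0(N)$ is the completion of the sections in $C^1(N)$ that vanish on $\partial(SM)$ in the norm given by $\|V\|^2+\|XV\|^2+\|\overset{v}{\mathrm{div}}V\|^2+\|\overset{h}{\mathrm{div}}V\|^2$. The operators extend continuously to these spaces. Put $$Q(W)=\|XW\|^2_{L^2(N)}-(RW,W)_{L^2(N)}.$$ Suppose that $(M,g)$ is a simple $C^{1,1}$ manifold, that is: 1. there is $\varepsilon>0$ with $Q(W)\ge\varepsilon\|W\|^2_{L^2(N)}$ for all $W\in H^1_0(N)$; 2. any two points of $M$ are joined by a unique geodesic whose interior lies in the interior of $M$, and its length depends continuously on the end points; 3. the time $\tau(z)$ at which the maximal geodesic in $M$ with initial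 data $z\in SM$ ends is finite for every $z$, and $\tau^2$ is Lipschitz on $SM$. Let $u$ be a Lipschitz function on $SM$ that vanishes on $\partial(SM)$ and satisfies $Xu\in H^1(SM)$ and $\overset{v}{\nabla}u\in H^1(N,X)$. Then $$\big\|\overset{v}{\nabla}Xu\big\|^2_{L^2(N)}=Q\big(\overset{v}{\nabla}u\big)+(n-1)\|Xu\|^2_{L^2(SM)}.$$ -/

import Mathlib

open Set Filter Topology MeasureTheory
open scoped NNReal ENNReal

namespace SimpleC11

noncomputable section

/-- Points of `ℝⁿ`, and also tangent vectors (the manifold has global coordinates). -/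
abbrev Pt (n : ℕ) := EuclideanSpace ℝ (Fin n)

/-- A field of `n × n` matrices on `ℝⁿ`: the components `g_{ij}(x)` of a metric in Cartesian
coordinates. Only the values on the closed unit ball are ever used. -/
abbrev MetricField (n : ℕ) := Pt n → Matrix (Fin n) (Fin n) ℝ

/-- The manifold `M`: the closed unit ball of `ℝⁿ`. -/
def M (n : ℕ) : Set (Pt n) := Metric.closedBall 0 1

/-- The `j`-th coordinate vector. -/
def e {n : ℕ} (j : Fin n) : Pt n := EuclideanSpace.single j 1

/-- `g` is a `C^{1,1}` Riemannian metric on `M`: symmetric positive definite, with components that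
are differentiable on the closed ball and have Lipschitz derivatives there. -/
structure IsC11Metric {n : ℕ} (g : MetricField n) : Prop where
  posDef : ∀ x ∈ M n, (g x).PosDef
  diff : ∀ i j, DifferentiableOn ℝ (fun x => g x i j) (M n)
  lip : ∀ i j, ∃ K : ℝ≥0, LipschitzOnWith K (fderivWithin ℝ (fun x => g x i j) (M n)) (M n)

/-! ### Metric quantities in coordinates -/

/-- The inner product `g_{ij}(x) a^i b^j`. -/
def gInner {n : ℕ} (g : MetricField n) (x a b : Pt n) : ℝ := ∑ i, ∑ j, g x i j * a i * b j

/-- The length `|a|_{g(x)}`. -/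
def gNorm {n : ℕ} (g : MetricField n) (x a : Pt n) : ℝ := Real.sqrt (gInner g x a a)

/-- `∂_k f` on the closed ball `M`. -/
def partialX {n : ℕ} (f : Pt n → ℝ) (k : Fin n) (x : Pt n) : ℝ := fderivWithin ℝ f (M n) x (e k)

/-- Christoffel symbols
`Γ^l_{jk} = ½ g^{lm} (∂_j g_{mk} + ∂_k g_{jm} - ∂_m g_{jk})`. -/
def christoffel {n : ℕ} (g : MetricField n) (l j k : Fin n) (x : Pt n) : ℝ :=
  (1 / 2) * ∑ m, (g x)⁻¹ l m *
    (partialX (fun y => g y m k) j x + partialX (fun y => g y j m) k x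
      - partialX (fun y => g y j k) m x)

/-- Curvature components: `R(∂_i, ∂_j) ∂_k = ∑_l (riemann g l i j k) ∂_l`, that is
`R^l_{ijk} = ∂_i Γ^l_{jk} - ∂_j Γ^l_{ik} + Γ^m_{jk} Γ^l_{im} - Γ^m_{ik} Γ^l_{jm}`.
For a `C^{1,1}` metric the Christoffel symbols are Lipschitz, so that by Rademacher's theorem this
is meaningful almost everywhere (and bounded). -/
def riemann {n : ℕ} (g : MetricField n) (l i j k : Fin n) (x : Pt n) : ℝ :=
  partialX (christoffel g l j k) i x - partialX (christoffel g l i k) j x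
    + ∑ m, (christoffel g m j k x * christoffel g l i m x
      - christoffel g m i k x * christoffel g l j m x)

/-! ### The unit sphere bundle -/

/-- The unit sphere bundle `SM ⊆ TM = M × ℝⁿ`. -/
def SM {n : ℕ} (g : MetricField n) : Set (Pt n × Pt n) :=
  {z | z.1 ∈ M n ∧ gInner g z.1 z.2 z.2 = 1}

/-- The slit tangent bundle `TM ∖ 0`. -/
def slitTM (n : ℕ) : Set (Pt n × Pt n) := {z | z.1 ∈ M n ∧ z.2 ≠ 0}

/-- The boundary `∂(SM)`: unit vectors over the unit sphere `∂M`. -/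
def boundarySM {n : ℕ} (g : MetricField n) : Set (Pt n × Pt n) := {z ∈ SM g | ‖z.1‖ = 1}

/-- The radial map `r : TM ∖ 0 → SM`, `r(x, v) = (x, v / |v|_{g(x)})`. -/
def radial {n : ℕ} (g : MetricField n) (z : Pt n × Pt n) : Pt n × Pt n :=
  (z.1, (gNorm g z.1 z.2)⁻¹ • z.2)

/-- The measure `dΣ_g = dS_x dV_g` on `SM`. Here `dV_g = √(det g) dx`, and `dS_x` is the Riemannian
volume of the unit sphere of `(T_xM, g(x))`; by polar coordinates (which is also how
`MeasureTheory.Measure.toSphere` is defined), it is `n` times the image under `w ↦ w / |w|` of the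
volume `√(det g(x)) dw` of the open unit ball of `(T_xM, g(x))` without its centre. The two factors
`√(det g)` give the density `det g`. -/
def sigma {n : ℕ} (g : MetricField n) : Measure (Pt n × Pt n) :=
  (n : ℝ≥0∞) • Measure.map (radial g)
    (((volume : Measure (Pt n × Pt n)).restrict {z | z ∈ slitTM n ∧ gNorm g z.1 z.2 < 1}).withDensity
      (fun z => ENNReal.ofReal (g z.1).det))

/-! ### Differential operators

Functions on `SM` and sections of `π^*TM` over `SM` are represented by maps on `Pt n × Pt n` of which
only the values on `SM` matter: every operator differentiates `f ∘ r` on `TM ∖ 0`. -/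

section Operators

variable {n : ℕ} {F : Type*} [NormedAddCommGroup F] [NormedSpace ℝ F]

/-- The differential at `z` of the radial extension `f ∘ r` of `f`. For `f` of class `C^1` this is
classical; for Lipschitz `f` it exists at almost every `z ∈ SM` by Rademacher's theorem. -/
def dRadial (g : MetricField n) (f : Pt n × Pt n → F) (z : Pt n × Pt n) : Pt n × Pt n →L[ℝ] F :=
  fderivWithin ℝ (f ∘ radial g) (slitTM n) z

/-- `∂_k f = ∂_{v^k} (f ∘ r)` on `SM`. -/
def partialV (g : MetricField n) (k : Fin n) (f : Pt n × Pt n → F) (z : Pt n × Pt n) : F :=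
  dRadial g f z (0, e k)

/-- `δ_j f = ∂_{x^j} (f ∘ r) - Γ^l_{jk} v^k ∂_{v^l} (f ∘ r)` on `SM`. -/
def delta (g : MetricField n) (j : Fin n) (f : Pt n × Pt n → F) (z : Pt n × Pt n) : F :=
  dRadial g f z (e j, 0) - ∑ l, ∑ k, (christoffel g l j k z.1 * z.2 k) • partialV g l f z

/-- The componentwise geodesic derivative `v^j δ_j f`; for scalar `f` this is `Xf`. -/
def geoX (g : MetricField n) (f : Pt n × Pt n → F) (z : Pt n × Pt n) : F :=
  ∑ j, z.2 j • delta g j f z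

/-- `XV = (XV^l) ∂_l + Γ^l_{jk} v^j V^k ∂_l` for sections `V`. -/
def geoXN (g : MetricField n) (V : Pt n × Pt n → Pt n) (z : Pt n × Pt n) : Pt n :=
  geoX g V z + WithLp.toLp 2 (fun l => ∑ j, ∑ k, christoffel g l j k z.1 * z.2 j * V z k)

/-- The vertical gradient `(g^{jk} ∂_k u) ∂_j`. -/
def gradV (g : MetricField n) (u : Pt n × Pt n → ℝ) (z : Pt n × Pt n) : Pt n :=
  WithLp.toLp 2 (fun j => ∑ k, (g z.1)⁻¹ j k * partialV g k u z)

/-- The horizontal gradient `(g^{jk} δ_k u - (Xu) v^j) ∂_j`. -/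
def gradH (g : MetricField n) (u : Pt n × Pt n → ℝ) (z : Pt n × Pt n) : Pt n :=
  WithLp.toLp 2 (fun j => ∑ k, (g z.1)⁻¹ j k * delta g k u z - geoX g u z * z.2 j)

/-- The vertical divergence `∂_j V^j`. -/
def divV (g : MetricField n) (V : Pt n × Pt n → Pt n) (z : Pt n × Pt n) : ℝ :=
  ∑ j, partialV g j (fun y => V y j) z

/-- The horizontal divergence `(δ_j + Γ^i_{ji}) V^j`. -/
def divH (g : MetricField n) (V : Pt n × Pt n → Pt n) (z : Pt n × Pt n) : ℝ :=
  ∑ j, (delta g j (fun y => V y j) z + ∑ i, christoffel g i j i z.1 * V z j)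

/-- The action `RV = R(V, v)v = R^l_{ijk} V^i v^j v^k ∂_l` of the curvature tensor. -/
def curv (g : MetricField n) (V : Pt n × Pt n → Pt n) (z : Pt n × Pt n) : Pt n :=
  WithLp.toLp 2 (fun l => ∑ i, ∑ j, ∑ k, riemann g l i j k z.1 * V z i * z.2 j * z.2 k)

end Operators

section Spaces

variable {n : ℕ}

/-! ### `C^1` and Lipschitz functions and sections -/

/-- `u ∈ C^1(SM)`. -/
def IsC1 (g : MetricField n) (u : Pt n × Pt n → ℝ) : Prop :=
  ContDiffOn ℝ 1 (u ∘ radial g) (slitTM n)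

/-- `V ∈ C^1(N)`: a `C^1` section of `π^*TM` with `V(x, v) ⟂ v`. -/
structure IsC1N (g : MetricField n) (V : Pt n × Pt n → Pt n) : Prop where
  contDiff : ContDiffOn ℝ 1 (V ∘ radial g) (slitTM n)
  orth : ∀ z ∈ SM g, gInner g z.1 (V z) z.2 = 0

/-- `u ∈ Lip_0(SM)`: Lipschitz on `SM`, and zero on `∂(SM)`. -/
structure IsLip0 (g : MetricField n) (u : Pt n × Pt n → ℝ) : Prop where
  lip : ∃ K : ℝ≥0, LipschitzOnWith K u (SM g)
  zero : ∀ z ∈ boundarySM g, u z = 0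

/-! ### `L^2` and Sobolev spaces -/

/-- `‖u‖²_{L²(SM)}`. -/
def sqNorm (g : MetricField n) (u : Pt n × Pt n → ℝ) : ℝ := ∫ z, u z * u z ∂(sigma g)

/-- `(V, W)_{L²(N)}`. -/
def innerN (g : MetricField n) (V W : Pt n × Pt n → Pt n) : ℝ :=
  ∫ z, gInner g z.1 (V z) (W z) ∂(sigma g)

/-- `‖V‖²_{L²(N)}`. -/
def sqNormN (g : MetricField n) (V : Pt n × Pt n → Pt n) : ℝ := innerN g V V

/-- `u ∈ L²(SM)`. -/
def MemL2 (g : MetricField n) (u : Pt n × Pt n → ℝ) : Prop := MemLp u 2 (sigma g)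

/-- `V ∈ L²(N)`. -/
structure MemL2N (g : MetricField n) (V : Pt n × Pt n → Pt n) : Prop where
  meas : AEStronglyMeasurable V (sigma g)
  orth : ∀ᵐ z ∂(sigma g), gInner g z.1 (V z) z.2 = 0
  memLp : MemLp (fun z => gNorm g z.1 (V z)) 2 (sigma g)

/-- `u_k → u` in `L²(SM)`. -/
def TendstoL2 (g : MetricField n) (uk : ℕ → Pt n × Pt n → ℝ) (u : Pt n × Pt n → ℝ) : Prop :=
  Tendsto (fun k => eLpNorm (fun z => uk k z - u z) 2 (sigma g)) atTop (𝓝 0)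

/-- `V_k → V` in `L²(N)`. -/
def TendstoL2N (g : MetricField n) (Vk : ℕ → Pt n × Pt n → Pt n) (V : Pt n × Pt n → Pt n) : Prop :=
  Tendsto (fun k => eLpNorm (fun z => gNorm g z.1 (Vk k z - V z)) 2 (sigma g)) atTop (𝓝 0)

/-- `u ∈ H¹(SM)`, and the operators `X`, `∇^v`, `∇^h : H¹(SM) → L²` take the values `Xu`, `vu`, `hu`
at `u`: the quadruple is an `L²` limit of `(u_k, X u_k, ∇^v u_k, ∇^h u_k)` with `u_k ∈ C^1(SM)`. The set
of such quadruples is the completion of `C^1(SM)` in the norm of `H¹(SM)`. -/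
structure IsH1 (g : MetricField n) (u Xu : Pt n × Pt n → ℝ) (vu hu : Pt n × Pt n → Pt n) : Prop where
  memL2 : MemL2 g u
  memL2_X : MemL2 g Xu
  memL2_v : MemL2N g vu
  memL2_h : MemL2N g hu
  approx : ∃ uk : ℕ → Pt n × Pt n → ℝ, (∀ k, IsC1 g (uk k)) ∧
    TendstoL2 g uk u ∧ TendstoL2 g (fun k => geoX g (uk k)) Xu ∧
    TendstoL2N g (fun k => gradV g (uk k)) vu ∧ TendstoL2N g (fun k => gradH g (uk k)) hu

/-- `V ∈ H¹(N, X)`, and the operator `X : H¹(N, X) → L²(N)` takes the value `XV` at `V`; this is the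
completion of `C^1(N)` in the norm `(‖V‖² + ‖XV‖²)^{1/2}`. -/
structure IsH1NX (g : MetricField n) (V XV : Pt n × Pt n → Pt n) : Prop where
  memL2 : MemL2N g V
  memL2_X : MemL2N g XV
  approx : ∃ Vk : ℕ → Pt n × Pt n → Pt n, (∀ k, IsC1N g (Vk k)) ∧
    TendstoL2N g Vk V ∧ TendstoL2N g (fun k => geoXN g (Vk k)) XV

/-- `V ∈ H¹_0(N)`, with `X`, `div^v` and `div^h` of `V` equal to `XV`, `dv` and `dh`; this is the
completion of the `C^1` sections that vanish on `∂(SM)` in the norm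
`(‖V‖² + ‖XV‖² + ‖div^v V‖² + ‖div^h V‖²)^{1/2}` of `H¹(N)`. -/
structure IsH10N (g : MetricField n) (V XV : Pt n × Pt n → Pt n) (dv dh : Pt n × Pt n → ℝ) :
    Prop where
  memL2 : MemL2N g V
  memL2_X : MemL2N g XV
  memL2_v : MemL2 g dv
  memL2_h : MemL2 g dh
  approx : ∃ Vk : ℕ → Pt n × Pt n → Pt n,
    (∀ k, IsC1N g (Vk k) ∧ ∀ z ∈ boundarySM g, Vk k z = 0) ∧
    TendstoL2N g Vk V ∧ TendstoL2N g (fun k => geoXN g (Vk k)) XV ∧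
    TendstoL2 g (fun k => divV g (Vk k)) dv ∧ TendstoL2 g (fun k => divH g (Vk k)) dh

/-- The quadratic form `Q(W) = ‖XW‖²_{L²(N)} - (RW, W)_{L²(N)}`; the second section is `XW`. -/
def Q (g : MetricField n) (W XW : Pt n × Pt n → Pt n) : ℝ :=
  sqNormN g XW - innerN g (curv g W) W

/-! ### Geodesics and simplicity -/

/-- The geodesic vector field on `TM`: `(x, v) ↦ (v, -Γ^l_{jk}(x) v^j v^k)`. -/
def spray (g : MetricField n) (z : Pt n × Pt n) : Pt n × Pt n :=
  (z.2, WithLp.toLp 2 (fun l => -∑ j, ∑ k, christoffel g l j k z.1 * z.2 j * z.2 k))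

/-- On the interval `I`, `c` is the lift `(γ, γ')` of a unit speed geodesic `γ` of `M`. -/
def IsGeodesicLift (g : MetricField n) (I : Set ℝ) (c : ℝ → Pt n × Pt n) : Prop :=
  ∀ t ∈ I, c t ∈ SM g ∧ HasDerivWithinAt c (spray g (c t)) I t

/-- `c` is the lift of a unit speed geodesic of length `L` from `x` to `y` that lies in the interior of
`M`, except possibly for its end points. -/
structure Joins (g : MetricField n) (x y : Pt n) (L : ℝ) (c : ℝ → Pt n × Pt n) : Prop where
  nonneg : 0 ≤ L
  geodesic : IsGeodesicLift g (Icc 0 L) c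
  left : (c 0).1 = x
  right : (c L).1 = y
  inside : ∀ t ∈ Ioo 0 L, (c t).1 ∈ Metric.ball (0 : Pt n) 1

/-- The times `T ≥ 0` such that the geodesic with initial data `z` exists in `M` on `[0, T]`. -/
def lifeTimes (g : MetricField n) (z : Pt n × Pt n) : Set ℝ :=
  {T | 0 ≤ T ∧ ∃ c : ℝ → Pt n × Pt n, c 0 = z ∧ IsGeodesicLift g (Icc 0 T) c}

/-- The travel time `τ(z) = τ_+(z)`, the end of the maximal interval of existence. -/
def travelTime (g : MetricField n) (z : Pt n × Pt n) : ℝ := sSup (lifeTimes g z)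

/-- `(M, g)` is a simple `C^{1,1}` Riemannian manifold. -/
structure IsSimple (g : MetricField n) : Prop where
  metric : IsC11Metric g
  /-- `Q(W) ≥ ε ‖W‖²` for all `W ∈ H¹_0(N)`. -/
  coercive : ∃ ε : ℝ, 0 < ε ∧ ∀ (W XW : Pt n × Pt n → Pt n) (dv dh : Pt n × Pt n → ℝ),
    IsH10N g W XW dv dh → ε * sqNormN g W ≤ Q g W XW
  /-- Any two points are joined by a unique geodesic in the interior, of length depending
  continuously on the end points. -/
  joined : ∃ ℓ : Pt n × Pt n → ℝ, ContinuousOn ℓ (M n ×ˢ M n) ∧ ∀ x ∈ M n, ∀ y ∈ M n,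
    (∃ c, Joins g x y (ℓ (x, y)) c) ∧
    ∀ (L L' : ℝ) (c c' : ℝ → Pt n × Pt n), Joins g x y L c → Joins g x y L' c' →
      L = L' ∧ ∀ t ∈ Icc 0 L, (c t).1 = (c' t).1
  /-- The travel time is finite. -/
  finite : ∀ z ∈ SM g, BddAbove (lifeTimes g z)
  /-- `τ²` is Lipschitz on `SM`. -/
  lip : ∃ K : ℝ≥0, LipschitzOnWith K (fun z => travelTime g z ^ 2) (SM g)

end Spaces

end

end SimpleC11

set_option linter.unusedSectionVars false


namespace SimpleC11

/-! ### Locally Lipschitz functions -/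

section LocLip

variable {α β γ : Type*} [PseudoMetricSpace α] [PseudoMetricSpace β] [PseudoMetricSpace γ]

/-! Write a = ∇^v Xu and b = X∇^v u. The commutator formula a - b = ∇^h u gives |a|² - |b|² = ⟨∇^h
u, a⟩ + ⟨∇^h u, b⟩. Since div^h ∇^v - div^v ∇^h = (n-1)X and X is skew-adjoint, the first pairing
integrates to (∇^h Xu, ∇^v u) + (n-1)‖Xu‖². Since X∇^h - ∇^h X = R∇^v, the second integrates to
-(∇^h Xu, ∇^v u) - (R∇^v u, ∇^v u). The terms with ∇^h Xu cancel and the Pestov identity remains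
(`integral_sum_delta_mul_vXu`, `integral_sum_delta_mul_Xvu`, `pestov_identity`).

The difficulty is regularity: u is only Lipschitz and the metric only C^{1,1}, so neither side of a
commutator formula can be applied to u pointwise. Every commutator is used in weak form. Its source
is the symmetry ∫ ∂_p b ∂_q u = ∫ ∂_q b ∂_p u for Lipschitz b of compact support, which difference
quotients prove without second derivatives. Applied to b = w Y^i Z^j it yields, for Lipschitz vector
fields Y, Z, an integrated formula for the Lie bracket [Y, Z] acting on u
(`hasZeroIntegral_bracket`).

On the slit tangent bundle the operators are derivatives of u∘r along explicit Lipschitz fields: the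
geodesic spray, the horizontal lifts, and the vertical fields. Their brackets are computed almost
everywhere, and the curvature arises from the spray and the horizontal lifts. Everything is tested
with (f∘r) φ(|v|²) det g, where φ is a bump function. Homogeneity in v and polar coordinates
(`integral_tm`) split the resulting integrals into an integral over SM and a positive radial factor,
so the integral over SM vanishes.

At the boundary, cutoffs c_m in ρ = 1 - |x|² are inserted, and the terms with the derivative of c_m
must tend to zero. Where this derivative, of size 1/ρ, meets an undifferentiated u, the bound |u| ≤
Cρ suffices. In the curvature identity it meets ⟨∇^h u, ∇^v u⟩ instead. There one needs that ∇^v u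
has zero boundary trace, in the sense that ∫ c_m' (Xρ)² |∇^v u|² → 0 (`tendsto_integral_trace`).
This rests on a trace estimate in H¹(N, X) and on moving the vertical derivative off u. Finally,
approximation by C¹ functions and sections carries the identities to Xu ∈ H¹(SM) and ∇^v u ∈ H¹(N,
X). -/

theorem locallyLipschitzOn_comp {f : β → γ} {h : α → β} {s : Set α} {t : Set β}
    (hf : LocallyLipschitzOn t f) (hh : LocallyLipschitzOn s h) (hst : MapsTo h s t) :
    LocallyLipschitzOn s (f ∘ h) := by
  intro x hx
  obtain ⟨K, a, ha, hKa⟩ := hh hx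
  obtain ⟨K', b, hb, hKb⟩ := hf (hst hx)
  have hc : h ⁻¹' b ∈ 𝓝[s] x :=
    (hh.continuousOn x hx).tendsto_nhdsWithin hst hb
  refine ⟨K' * K, a ∩ h ⁻¹' b, inter_mem ha hc, ?_⟩
  exact hKb.comp (hKa.mono inter_subset_left) (fun y hy => hy.2)

theorem locallyLipschitzOn_prodMk {f : α → β} {h : α → γ} {s : Set α}
    (hf : LocallyLipschitzOn s f) (hh : LocallyLipschitzOn s h) :
    LocallyLipschitzOn s (fun x => (f x, h x)) := by
  intro x hx
  obtain ⟨K, a, ha, hKa⟩ := hf hx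
  obtain ⟨K', b, hb, hKb⟩ := hh hx
  exact ⟨max K K', a ∩ b, inter_mem ha hb,
    (hKa.mono inter_subset_left).prodMk (hKb.mono inter_subset_right)⟩

theorem locallyLipschitzOn_of_lipschitzOnWith {f : α → β} {s : Set α} {K : ℝ≥0}
    (hf : LipschitzOnWith K f s) : LocallyLipschitzOn s f :=
  fun _ _ => ⟨K, s, self_mem_nhdsWithin, hf⟩

theorem locallyLipschitzOn_const {s : Set α} (c : β) : LocallyLipschitzOn s (fun _ => c) :=
  locallyLipschitzOn_of_lipschitzOnWith (LipschitzWith.const c).lipschitzOnWith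

end LocLip

section LocLipNormed

variable {E F : Type*} [NormedAddCommGroup E] [NormedSpace ℝ E]
  [NormedAddCommGroup F] [NormedSpace ℝ F] {α : Type*} [PseudoMetricSpace α]

theorem locallyLipschitzOn_of_contDiffOn {f : E → F} {s : Set E} (hs : IsOpen s)
    (hf : ContDiffOn ℝ 1 f s) : LocallyLipschitzOn s f := by
  intro x hx
  obtain ⟨K, t, ht, hK⟩ := (hf.contDiffAt (hs.mem_nhds hx)).exists_lipschitzOnWith
  exact ⟨K, t, mem_nhdsWithin_of_mem_nhds ht, hK⟩

theorem locallyLipschitzOn_of_contDiff {f : E → F} {s : Set E}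
    (hf : ContDiff ℝ 1 f) : LocallyLipschitzOn s f :=
  (locallyLipschitzOn_univ.2 hf.locallyLipschitz).mono (subset_univ s)

theorem locallyLipschitzOn_mul {f h : α → ℝ} {s : Set α}
    (hf : LocallyLipschitzOn s f) (hh : LocallyLipschitzOn s h) :
    LocallyLipschitzOn s (fun x => f x * h x) :=
  locallyLipschitzOn_comp (f := fun p : ℝ × ℝ => p.1 * p.2) (t := univ)
    (locallyLipschitzOn_of_contDiff (by fun_prop)) (locallyLipschitzOn_prodMk hf hh)
    (mapsTo_univ _ _)

theorem locallyLipschitzOn_add {f h : α → F} {s : Set α}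
    (hf : LocallyLipschitzOn s f) (hh : LocallyLipschitzOn s h) :
    LocallyLipschitzOn s (fun x => f x + h x) :=
  locallyLipschitzOn_comp (f := fun p : F × F => p.1 + p.2) (t := univ)
    (locallyLipschitzOn_of_contDiff (by fun_prop)) (locallyLipschitzOn_prodMk hf hh)
    (mapsTo_univ _ _)

theorem locallyLipschitzOn_clm {G : Type*} [NormedAddCommGroup G] [NormedSpace ℝ G]
    {f : α → F} {s : Set α} (ℓ : F →L[ℝ] G)
    (hf : LocallyLipschitzOn s f) : LocallyLipschitzOn s (fun x => ℓ (f x)) :=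
  locallyLipschitzOn_comp (t := univ)
    (locallyLipschitzOn_of_contDiff ℓ.contDiff) hf (mapsTo_univ _ _)

theorem locallyLipschitzOn_sum {ι : Type*} {f : ι → α → F} {s : Set α} (t : Finset ι)
    (hf : ∀ i ∈ t, LocallyLipschitzOn s (f i)) :
    LocallyLipschitzOn s (fun x => ∑ i ∈ t, f i x) := by
  classical
  induction t using Finset.induction_on with
  | empty => simpa using locallyLipschitzOn_const (0 : F)
  | insert a t ha ih =>
    simp only [Finset.sum_insert ha]
    exact locallyLipschitzOn_add (hf a (by simp)) (ih fun i hi => hf i (by simp [hi]))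

theorem locallyLipschitzOn_smul {f : α → ℝ} {h : α → F} {s : Set α}
    (hf : LocallyLipschitzOn s f) (hh : LocallyLipschitzOn s h) :
    LocallyLipschitzOn s (fun x => f x • h x) :=
  locallyLipschitzOn_comp (f := fun p : ℝ × F => p.1 • p.2) (t := univ)
    (locallyLipschitzOn_of_contDiff (by fun_prop)) (locallyLipschitzOn_prodMk hf hh)
    (mapsTo_univ _ _)

theorem locallyLipschitzOn_toLp {ι : Type*} [Fintype ι] {f : ι → α → ℝ} {s : Set α}
    (hf : ∀ i, LocallyLipschitzOn s (f i)) :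
    LocallyLipschitzOn s (fun x => (WithLp.toLp 2 (fun i => f i x) : EuclideanSpace ℝ ι)) := by
  classical
  have : (fun x => (WithLp.toLp 2 (fun i => f i x) : EuclideanSpace ℝ ι))
      = fun x => ∑ i, f i x • (EuclideanSpace.single i 1 : EuclideanSpace ℝ ι) := by
    funext x
    ext j
    simp [Pi.single_apply]
  rw [this]
  exact locallyLipschitzOn_sum _ fun i _ =>
    locallyLipschitzOn_smul (hf i) (locallyLipschitzOn_const _)

/-- Extended by zero, f is locally Lipschitz everywhere, and compactness gives a constant on a ball
of radius R + 1 containing K with margin 1. A point of K and a point outside that ball are at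
distance at least 1, so there a bound for |f| serves as Lipschitz constant. -/
theorem exists_lipschitzWith_of_compact_support [ProperSpace E] {f : E → ℝ}
    {O K : Set E} (hO : IsOpen O) (hK : IsCompact K) (hKO : K ⊆ O)
    (hf : LocallyLipschitzOn O f) (h0 : ∀ x ∉ K, f x = 0) : ∃ C, LipschitzWith C f := by
  have hloc : LocallyLipschitz f := by
    intro x
    by_cases hx : x ∈ K
    · obtain ⟨C, t, ht, hC⟩ := hf (hKO hx)
      rw [hO.nhdsWithin_eq (hKO hx)] at ht
      exact ⟨C, t, ht, hC⟩
    · refine ⟨0, Kᶜ, hK.isClosed.isOpen_compl.mem_nhds hx, ?_⟩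
      intro y hy z hz
      simp [h0 y hy, h0 z hz]
  obtain ⟨R, hR⟩ := hK.isBounded.subset_closedBall (0 : E)
  obtain ⟨C, hC⟩ := (hloc.locallyLipschitzOn (s := Metric.closedBall (0 : E) (R + 1))
    ).exists_lipschitzOnWith_of_compact (isCompact_closedBall _ _)
  obtain ⟨B, hB⟩ := hK.exists_bound_of_continuousOn (hf.continuousOn.mono hKO)
  have key : ∀ x y, x ∈ K → dist (f x) (f y) ≤ (max C B.toNNReal : ℝ≥0) * dist x y := by
    intro x y hx
    by_cases hy : y ∈ Metric.closedBall (0 : E) (R + 1)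
    · have hx' : x ∈ Metric.closedBall (0 : E) (R + 1) :=
        Metric.closedBall_subset_closedBall (by linarith) (hR hx)
      refine (hC.dist_le_mul x hx' y hy).trans ?_
      gcongr
      exact le_max_left _ _
    · have hyK : y ∉ K := fun h =>
        hy (Metric.closedBall_subset_closedBall (by linarith) (hR h))
      have h1 : 1 ≤ dist x y := by
        have h2 := hR hx
        rw [Metric.mem_closedBall] at h2 hy
        have := dist_triangle y x 0
        rw [dist_comm y x] at this
        linarith
      rw [h0 y hyK, dist_zero_right]
      calc ‖f x‖ ≤ B := hB x hx
        _ ≤ (B.toNNReal : ℝ) * 1 := by simp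
        _ ≤ _ := by
          gcongr
          exact le_max_right _ _
  refine ⟨max C B.toNNReal, LipschitzWith.of_dist_le_mul fun x y => ?_⟩
  by_cases hx : x ∈ K
  · exact key x y hx
  by_cases hy : y ∈ K
  · rw [dist_comm, dist_comm x]
    exact key y x hy
  · rw [h0 x hx, h0 y hy, dist_self]
    positivity

/-- Rademacher's theorem applies near each point, and a set that is null near each of its points is
null. -/
theorem ae_differentiableAt_of_locallyLipschitzOn [FiniteDimensional ℝ E] [FiniteDimensional ℝ F]
    [MeasurableSpace E] [BorelSpace E] (μ : Measure E) [μ.IsAddHaarMeasure]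
    {f : E → F} {O : Set E} (hO : IsOpen O) (hf : LocallyLipschitzOn O f) :
    ∀ᵐ x ∂μ, x ∈ O → DifferentiableAt ℝ f x := by
  have : ∀ x ∈ O, ∃ t ∈ 𝓝[O] x, μ (t ∩ {y | y ∈ O ∧ ¬ DifferentiableAt ℝ f y}) = 0 := by
    intro x hx
    obtain ⟨K, t, ht, hK⟩ := hf hx
    rw [hO.nhdsWithin_eq hx] at ht
    refine ⟨interior t, mem_nhdsWithin_of_mem_nhds (interior_mem_nhds.2 ht), ?_⟩
    have h := (hK.mono interior_subset).ae_differentiableWithinAt_of_mem (μ := μ)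
    refine measure_mono_null ?_ h
    rintro y ⟨hy1, hy2, hy3⟩
    simp only [mem_compl_iff, mem_ofPred_eq, Classical.not_imp]
    exact ⟨hy1, fun h => hy3 (h.differentiableAt (isOpen_interior.mem_nhds hy1))⟩
  have h2 : μ {y | y ∈ O ∧ ¬ DifferentiableAt ℝ f y} = 0 := by
    refine measure_null_of_locally_null _ fun x hx => ?_
    obtain ⟨t, ht, h0⟩ := this x hx.1
    refine ⟨t ∩ {y | y ∈ O ∧ ¬ DifferentiableAt ℝ f y}, ?_, h0⟩
    exact inter_mem (nhdsWithin_mono x (fun y hy => hy.1) ht) self_mem_nhdsWithin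
  rw [ae_iff]
  simpa [Classical.not_imp] using h2

end LocLipNormed

/-! ### Integration by parts for Lipschitz functions -/

section Parts

variable {E : Type*} [NormedAddCommGroup E] [NormedSpace ℝ E] [FiniteDimensional ℝ E]
  [MeasurableSpace E] [BorelSpace E] (μ : Measure E) [μ.IsAddHaarMeasure]

theorem integrable_lineDeriv_of_compact_support {C : ℝ≥0} {b : E → ℝ} (hb : LipschitzWith C b)
    (hs : HasCompactSupport b) (p : E) : Integrable (fun x => lineDeriv ℝ b x p) μ := by
  have hz : ∀ x, x ∉ tsupport b → lineDeriv ℝ b x p = 0 := by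
    intro x hx
    have : b =ᶠ[𝓝 x] fun _ => 0 := by
      filter_upwards [(isClosed_tsupport b).isOpen_compl.mem_nhds hx] with y hy
      exact image_eq_zero_of_notMem_tsupport hy
    rw [this.lineDeriv_eq]
    simp [lineDeriv]
  have hi : IntegrableOn (fun x => lineDeriv ℝ b x p) (tsupport b) μ := by
    refine Measure.integrableOn_of_bounded (M := C * ‖p‖) hs.measure_lt_top.ne
      (aestronglyMeasurable_lineDeriv hb.continuous μ) ?_
    filter_upwards with x
    exact norm_lineDeriv_le_of_lipschitz ℝ hb
  exact (integrableOn_iff_integrable_of_support_subset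
    (fun x hx => by_contra fun h => hx (hz x h))).1 hi

/-- Weak symmetry of second derivatives. The derivative of u in direction q is replaced by a
difference quotient, everything is moved across the integral, and the step tends to zero. -/
theorem integral_lineDeriv_mul_lineDeriv_comm {C D : ℝ≥0} {b u : E → ℝ}
    (hb : LipschitzWith C b) (hbs : HasCompactSupport b)
    (hu : LipschitzWith D u) (hus : HasCompactSupport u) (p q : E) :
    ∫ x, lineDeriv ℝ u x q * lineDeriv ℝ b x p ∂μ
      = ∫ x, lineDeriv ℝ u x p * lineDeriv ℝ b x q ∂μ := by
  have h1 := hu.integral_inv_smul_sub_mul_tendsto_integral_lineDeriv_mul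
    (integrable_lineDeriv_of_compact_support μ hb hbs p) q
  have h2 := hb.integral_inv_smul_sub_mul_tendsto_integral_lineDeriv_mul
    (integrable_lineDeriv_of_compact_support μ hu hus p) (-q)
  -- For fixed t, translation invariance moves the shift from u to b, with -q in place of q, and
  -- integration by parts moves the derivative in direction p from b to u.
  have key : ∀ t : ℝ, ∫ x, (t⁻¹ • (u (x + t • q) - u x)) * lineDeriv ℝ b x p ∂μ
      = - ∫ x, (t⁻¹ • (b (x + t • (-q)) - b x)) * lineDeriv ℝ u x p ∂μ := by
    intro t
    have huq : LipschitzWith D (fun x => u (x + t • q)) := by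
      intro x y
      simpa using hu (x + t • q) (y + t • q)
    have hbq : LipschitzWith C (fun x => b (x + t • (-q))) := by
      intro x y
      simpa using hb (x + t • (-q)) (y + t • (-q))
    have hbqs : HasCompactSupport (fun x => b (x + t • (-q))) :=
      hbs.comp_homeomorph (Homeomorph.addRight (t • (-q)))
    have i1 : ∫ x, u (x + t • q) * lineDeriv ℝ b x p ∂μ
        = ∫ x, u x * lineDeriv ℝ (fun y => b (y + t • (-q))) x p ∂μ := by
      rw [← integral_add_right_eq_self _ (t • (-q))]
      congr 1
      funext x
      have : lineDeriv ℝ b (x + t • -q) p = lineDeriv ℝ (fun y => b (y + t • (-q))) x p := by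
        simp only [lineDeriv]
        congr 1
        funext s
        congr 1
        abel
      rw [this]
      simp
    have i2 : ∀ {b' : E → ℝ} {C' : ℝ≥0}, LipschitzWith C' b' → HasCompactSupport b' →
        ∫ x, u x * lineDeriv ℝ b' x p ∂μ = - ∫ x, b' x * lineDeriv ℝ u x p ∂μ := by
      intro b' C' hb' hbs'
      have := hb'.integral_lineDeriv_mul_eq (μ := μ) hu hus p
      simp only [mul_comm (u _)]
      rw [this, ← integral_neg]
      congr 1
      funext x
      rw [lineDeriv_neg]
      ring
    have iu := integrable_lineDeriv_of_compact_support μ hu hus p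
    have ib := integrable_lineDeriv_of_compact_support μ hb hbs p
    have intmul : ∀ {b' v : E → ℝ} {C' : ℝ≥0}, LipschitzWith C' b' → HasCompactSupport b' →
        Integrable v μ → Integrable (fun x => b' x * v x) μ := by
      intro b' v C' hb' hbs' hv
      obtain ⟨M, hM⟩ := hbs'.exists_bound_of_continuous hb'.continuous
      exact hv.bdd_mul hb'.continuous.aestronglyMeasurable (Eventually.of_forall hM)
    have huqs : HasCompactSupport (fun x => u (x + t • q)) :=
      hus.comp_homeomorph (Homeomorph.addRight (t • q))
    simp only [smul_eq_mul, mul_assoc, integral_const_mul, sub_mul]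
    rw [integral_sub (intmul huq huqs ib) (intmul hu hus ib),
      integral_sub (intmul hbq hbqs iu) (intmul hb hbs iu), i1, i2 hbq hbqs, i2 hb hbs]
    ring
  have h3 := h2.neg
  simp only [← key] at h3
  have h4 := tendsto_nhds_unique h1 h3
  rw [h4, ← integral_neg]
  congr 1
  funext x
  rw [lineDeriv_neg]
  ring

theorem integral_fderiv_mul_fderiv_comm {O K : Set E} (hO : IsOpen O) (hK : IsCompact K)
    (hKO : K ⊆ O) {b u : E → ℝ} (hb : LocallyLipschitzOn O b) (hb0 : ∀ x ∉ K, b x = 0)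
    (hu : LocallyLipschitzOn O u) (p q : E) :
    Integrable (fun x => fderiv ℝ b x p * fderiv ℝ u x q) μ ∧
    ∫ x, fderiv ℝ b x p * fderiv ℝ u x q ∂μ = ∫ x, fderiv ℝ b x q * fderiv ℝ u x p ∂μ := by
  obtain ⟨K', hK'c, hKK', hK'O⟩ := exists_compact_between hK hO hKO
  -- The product θu is globally Lipschitz with compact support and agrees with u near K; outside K
  -- the derivative of b vanishes.
  obtain ⟨θ, hθ1, hθ0, -⟩ := exists_contMDiffMap_one_nhds_of_subset_interior
    (n := 1) (modelWithCornersSelf ℝ E) hK.isClosed hKK'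
  have hθc : ContDiff ℝ 1 θ := θ.contMDiff.contDiff
  obtain ⟨C, hC⟩ := exists_lipschitzWith_of_compact_support hO hK hKO hb hb0
  obtain ⟨D, hD⟩ := exists_lipschitzWith_of_compact_support (f := fun x => θ x * u x) hO hK'c hK'O
    (locallyLipschitzOn_mul (locallyLipschitzOn_of_contDiff hθc) hu)
    (fun x hx => by simp [hθ0 x hx])
  have hbs : HasCompactSupport b := HasCompactSupport.intro hK hb0
  have hus : HasCompactSupport (fun x => θ x * u x) :=
    HasCompactSupport.intro hK'c (fun x hx => by simp [hθ0 x hx])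
  have hnear : ∀ x ∈ K, (fun y => θ y * u y) =ᶠ[𝓝 x] u := by
    intro x hx
    filter_upwards [hθ1.filter_mono (nhds_le_nhdsSet hx)] with y hy
    simp [hy]
  have hfar : ∀ x ∉ K, fderiv ℝ b x = 0 := by
    intro x hx
    have : b =ᶠ[𝓝 x] fun _ => 0 := by
      filter_upwards [hK.isClosed.isOpen_compl.mem_nhds hx] with y hy
      exact hb0 y hy
    rw [this.fderiv_eq, fderiv_fun_const]
    rfl
  have hae : ∀ p q : E, (fun x => lineDeriv ℝ (fun y => θ y * u y) x q * lineDeriv ℝ b x p)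
      =ᵐ[μ] fun x => fderiv ℝ b x p * fderiv ℝ u x q := by
    intro p q
    filter_upwards [hC.ae_differentiableAt (μ := μ), hD.ae_differentiableAt (μ := μ)] with x h1 h2
    rw [h1.lineDeriv_eq_fderiv, h2.lineDeriv_eq_fderiv]
    by_cases hx : x ∈ K
    · rw [(hnear x hx).fderiv_eq, mul_comm]
    · simp [hfar x hx]
  constructor
  · refine Integrable.congr ?_ (hae p q)
    refine (integrable_lineDeriv_of_compact_support μ hC hbs p).bdd_mul (c := D * ‖q‖)
      (aestronglyMeasurable_lineDeriv hD.continuous μ) ?_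
    exact Eventually.of_forall fun x => norm_lineDeriv_le_of_lipschitz ℝ hD
  · rw [← integral_congr_ae (hae p q), ← integral_congr_ae (hae q p)]
    exact integral_lineDeriv_mul_lineDeriv_comm μ hC hbs hD hus p q

/-- The function is integrable, with integral zero. -/
def HasZeroIntegral (f : E → ℝ) : Prop := Integrable f μ ∧ ∫ x, f x ∂μ = 0

variable {μ}

theorem HasZeroIntegral.congr {f h : E → ℝ} (hf : HasZeroIntegral μ f) (he : f =ᵐ[μ] h) :
    HasZeroIntegral μ h :=
  ⟨hf.1.congr he, by rw [← integral_congr_ae he]; exact hf.2⟩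

theorem HasZeroIntegral.sum {ι : Type*} {f : ι → E → ℝ} (s : Finset ι)
    (hf : ∀ i ∈ s, HasZeroIntegral μ (f i)) : HasZeroIntegral μ (fun x => ∑ i ∈ s, f i x) := by
  refine ⟨integrable_finsetSum _ fun i hi => (hf i hi).1, ?_⟩
  rw [integral_finsetSum _ fun i hi => (hf i hi).1]
  exact Finset.sum_eq_zero fun i hi => (hf i hi).2

variable (μ)

theorem hasZeroIntegral_fderiv {O K : Set E} (hO : IsOpen O) (hK : IsCompact K)
    (hKO : K ⊆ O) {b : E → ℝ} (hb : LocallyLipschitzOn O b) (hb0 : ∀ x ∉ K, b x = 0) (p : E) :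
    HasZeroIntegral μ (fun x => fderiv ℝ b x p) := by
  obtain ⟨C, hC⟩ := exists_lipschitzWith_of_compact_support hO hK hKO hb hb0
  have hbs : HasCompactSupport b := HasCompactSupport.intro hK hb0
  have hae : (fun x => lineDeriv ℝ b x p) =ᵐ[μ] fun x => fderiv ℝ b x p := by
    filter_upwards [hC.ae_differentiableAt (μ := μ)] with x h1
    exact h1.lineDeriv_eq_fderiv
  refine ⟨(integrable_lineDeriv_of_compact_support μ hC hbs p).congr hae, ?_⟩
  rw [← integral_congr_ae hae]
  -- Integration by parts against the constant 1, in direction -p because the formula reverses the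
  -- direction.
  have h := (LipschitzWith.const (α := E) (1 : ℝ)).integral_lineDeriv_mul_eq (μ := μ) hC hbs (-p)
  have h0 : ∀ x : E, lineDeriv ℝ (fun _ : E => (1 : ℝ)) x (-p) = 0 := fun x => by
    simp [lineDeriv]
  simpa [h0] using h.symm

/-! ### Divergences and Lie brackets of Lipschitz vector fields. -/

section Frame

variable {ι : Type*} [Fintype ι] (e : ι → E) (ℓ : ι → E →L[ℝ] ℝ)

/-- The divergence of a vector field, in a frame. -/
noncomputable def divFrame (Y : E → E) (x : E) : ℝ := ∑ i, ℓ i (fderiv ℝ Y x (e i))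

theorem frame_expand {F : Type*} [NormedAddCommGroup F] [NormedSpace ℝ F] {e : ι → E}
    {ℓ : ι → E →L[ℝ] ℝ} (hfr : ∀ x, ∑ i, ℓ i x • e i = x) (T : E →L[ℝ] F) (x : E) :
    ∑ i, ℓ i x • T (e i) = T x := by
  conv_rhs => rw [← hfr x]
  simp

variable {e ℓ}

/-- The integrand is the divergence of wY, whose components are Lipschitz with compact support
although Y is controlled on O only. -/
theorem hasZeroIntegral_div (hfr : ∀ x, ∑ i, ℓ i x • e i = x) {O K : Set E} (hO : IsOpen O)
    (hK : IsCompact K) (hKO : K ⊆ O) {w : E → ℝ} {Y : E → E} (hw : LocallyLipschitzOn O w)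
    (hw0 : ∀ x ∉ K, w x = 0) (hY : LocallyLipschitzOn O Y) :
    HasZeroIntegral μ (fun x => w x * divFrame e ℓ Y x + fderiv ℝ w x (Y x)) := by
  have h := HasZeroIntegral.sum (μ := μ) Finset.univ fun i _ =>
    hasZeroIntegral_fderiv μ hO hK hKO (b := fun x => w x * ℓ i (Y x))
      (locallyLipschitzOn_mul hw (locallyLipschitzOn_clm (ℓ i) hY))
      (fun x hx => by simp [hw0 x hx]) (e i)
  refine h.congr ?_
  filter_upwards [ae_differentiableAt_of_locallyLipschitzOn μ hO hw,
    ae_differentiableAt_of_locallyLipschitzOn μ hO hY] with x h1 h2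
  by_cases hx : x ∈ K
  · have hw' := (h1 (hKO hx)).hasFDerivAt
    have hY' := (h2 (hKO hx)).hasFDerivAt
    have : ∀ i, fderiv ℝ (fun x => w x * ℓ i (Y x)) x (e i)
        = w x * ℓ i (fderiv ℝ Y x (e i)) + ℓ i (Y x) * fderiv ℝ w x (e i) := by
      intro i
      have := hw'.fun_mul ((ℓ i).hasFDerivAt.comp x hY')
      simp only [Function.comp_def] at this
      rw [this.fderiv]
      simp
    simp only [this, Finset.sum_add_distrib, divFrame, Finset.mul_sum]
    rw [← frame_expand hfr (fderiv ℝ w x) (Y x)]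
    simp
  · have e1 : w =ᶠ[𝓝 x] fun _ => 0 := by
      filter_upwards [hK.isClosed.isOpen_compl.mem_nhds hx] with y hy
      exact hw0 y hy
    have e2 : ∀ i, (fun y => w y * ℓ i (Y y)) =ᶠ[𝓝 x] fun _ => 0 := by
      intro i
      filter_upwards [e1] with y hy
      simp [hy]
    simp only [e1.fderiv_eq, (e2 _).fderiv_eq, hw0 x hx]
    simp

/-- Formally this integrates div(wY) Zu - div(wZ) Yu by parts and meets w(YZ - ZY)u, for which u
lacks the derivatives. Instead, the weak symmetry for b = w Y^i Z^j is summed over i and j: the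
product rule for ∂_i b and ∂_j b produces the two divergences and, from the derivatives of Z^j and
Y^i, the bracket. -/
theorem hasZeroIntegral_bracket (hfr : ∀ x, ∑ i, ℓ i x • e i = x) {O K : Set E} (hO : IsOpen O)
    (hK : IsCompact K) (hKO : K ⊆ O) {w u : E → ℝ} {Y Z : E → E} (hw : LocallyLipschitzOn O w)
    (hw0 : ∀ x ∉ K, w x = 0) (hY : LocallyLipschitzOn O Y) (hZ : LocallyLipschitzOn O Z)
    (hu : LocallyLipschitzOn O u) :
    HasZeroIntegral μ (fun x =>
      (w x * divFrame e ℓ Y x + fderiv ℝ w x (Y x)) * fderiv ℝ u x (Z x)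
      - (w x * divFrame e ℓ Z x + fderiv ℝ w x (Z x)) * fderiv ℝ u x (Y x)
      + w x * fderiv ℝ u x (fderiv ℝ Z x (Y x) - fderiv ℝ Y x (Z x))) := by
  have hb : ∀ i j, LocallyLipschitzOn O (fun x => w x * (ℓ i (Y x) * ℓ j (Z x))) := fun i j =>
    locallyLipschitzOn_mul hw (locallyLipschitzOn_mul (locallyLipschitzOn_clm (ℓ i) hY)
      (locallyLipschitzOn_clm (ℓ j) hZ))
  have hb0 : ∀ i j, ∀ x ∉ K, w x * (ℓ i (Y x) * ℓ j (Z x)) = 0 := fun i j x hx => by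
    simp [hw0 x hx]
  have h := HasZeroIntegral.sum (μ := μ) Finset.univ fun i _ =>
    HasZeroIntegral.sum (μ := μ) Finset.univ fun j _ =>
      show HasZeroIntegral μ (fun x =>
        fderiv ℝ (fun x => w x * (ℓ i (Y x) * ℓ j (Z x))) x (e i) * fderiv ℝ u x (e j)
        - fderiv ℝ (fun x => w x * (ℓ i (Y x) * ℓ j (Z x))) x (e j) * fderiv ℝ u x (e i)) from by
      have h1 := integral_fderiv_mul_fderiv_comm μ hO hK hKO (hb i j) (hb0 i j) hu (e i) (e j)
      have h2 := integral_fderiv_mul_fderiv_comm μ hO hK hKO (hb i j) (hb0 i j) hu (e j) (e i)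
      refine ⟨h1.1.sub h2.1, ?_⟩
      rw [integral_sub h1.1 h2.1, h1.2, sub_self]
  refine h.congr ?_
  filter_upwards [ae_differentiableAt_of_locallyLipschitzOn μ hO hw,
    ae_differentiableAt_of_locallyLipschitzOn μ hO hY,
    ae_differentiableAt_of_locallyLipschitzOn μ hO hZ] with x h1 h2 h3
  by_cases hx : x ∈ K
  · have hw' := (h1 (hKO hx)).hasFDerivAt
    have hY' := (h2 (hKO hx)).hasFDerivAt
    have hZ' := (h3 (hKO hx)).hasFDerivAt
    have hd : ∀ i j p, fderiv ℝ (fun x => w x * (ℓ i (Y x) * ℓ j (Z x))) x p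
        = fderiv ℝ w x p * ℓ i (Y x) * ℓ j (Z x) + w x * ℓ i (fderiv ℝ Y x p) * ℓ j (Z x)
          + w x * ℓ i (Y x) * ℓ j (fderiv ℝ Z x p) := by
      intro i j p
      have := hw'.fun_mul (((ℓ i).hasFDerivAt.comp x hY').fun_mul ((ℓ j).hasFDerivAt.comp x hZ'))
      simp only [Function.comp_def] at this
      rw [this.fderiv]
      simp
      ring
    have ex := fun (T : E →L[ℝ] ℝ) y => frame_expand hfr T y
    simp only [smul_eq_mul] at ex
    have t1 : ∀ i, ∑ j, fderiv ℝ (fun x => w x * (ℓ i (Y x) * ℓ j (Z x))) x (e i)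
          * fderiv ℝ u x (e j)
        = (ℓ i (Y x) * fderiv ℝ w x (e i) + w x * ℓ i (fderiv ℝ Y x (e i))) * fderiv ℝ u x (Z x)
          + w x * (ℓ i (Y x) * (fderiv ℝ u x ∘L fderiv ℝ Z x) (e i)) := by
      intro i
      rw [ContinuousLinearMap.comp_apply, ← ex (fderiv ℝ u x) (Z x),
        ← ex (fderiv ℝ u x) (fderiv ℝ Z x (e i))]
      simp only [Finset.mul_sum, ← Finset.sum_add_distrib, hd]
      refine Finset.sum_congr rfl fun j _ => ?_
      ring
    have t2 : ∀ i, ∑ j, fderiv ℝ (fun x => w x * (ℓ i (Y x) * ℓ j (Z x))) x (e j)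
          * fderiv ℝ u x (e i)
        = (ℓ i (Y x) * fderiv ℝ u x (e i)) * (fderiv ℝ w x (Z x) + w x * divFrame e ℓ Z x)
          + w x * (ℓ i (fderiv ℝ Y x (Z x)) * fderiv ℝ u x (e i)) := by
      intro i
      have e1 := ex (ℓ i ∘L fderiv ℝ Y x) (Z x)
      rw [ContinuousLinearMap.comp_apply] at e1
      rw [← e1, ← ex (fderiv ℝ w x) (Z x), divFrame]
      simp only [Finset.mul_sum, Finset.sum_mul, ← Finset.sum_add_distrib, hd]
      refine Finset.sum_congr rfl fun j _ => ?_
      simp only [ContinuousLinearMap.comp_apply]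
      ring
    simp only [Finset.sum_sub_distrib, t1, t2]
    simp only [Finset.sum_add_distrib, ← Finset.sum_mul, ← Finset.mul_sum, ex, map_sub,
      ContinuousLinearMap.comp_apply, divFrame]
    have := ex (fderiv ℝ u x ∘L fderiv ℝ Z x) (Y x)
    simp only [ContinuousLinearMap.comp_apply] at this
    rw [this]
    ring
  · have e1 : w =ᶠ[𝓝 x] fun _ => 0 := by
      filter_upwards [hK.isClosed.isOpen_compl.mem_nhds hx] with y hy
      exact hw0 y hy
    have e2 : ∀ i j, (fun y => w y * (ℓ i (Y y) * ℓ j (Z y))) =ᶠ[𝓝 x] fun _ => 0 := by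
      intro i j
      filter_upwards [e1] with y hy
      simp [hy]
    simp only [e1.fderiv_eq, (e2 _ _).fderiv_eq, hw0 x hx]
    simp

end Frame

end Parts

end SimpleC11

namespace SimpleC11

/-! ### The metric and the Christoffel symbols -/

section Metric

variable {n : ℕ} {g : MetricField n}

theorem isCompact_M : IsCompact (M n) := isCompact_closedBall _ _

theorem convex_M : Convex ℝ (M n) := convex_closedBall _ _

theorem interior_M : interior (M n) = Metric.ball 0 1 := interior_closedBall _ one_ne_zero

theorem uniqueDiffOn_M : UniqueDiffOn ℝ (M n) :=
  uniqueDiffOn_convex convex_M (by rw [interior_M]; exact ⟨0, by simp⟩)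

theorem ball_subset_M : Metric.ball (0 : Pt n) 1 ⊆ M n := Metric.ball_subset_closedBall

theorem M_mem_nhds {x : Pt n} (hx : x ∈ Metric.ball (0 : Pt n) 1) : M n ∈ 𝓝 x :=
  mem_of_superset (Metric.isOpen_ball.mem_nhds hx) ball_subset_M

theorem partialX_congr {f h : Pt n → ℝ} (he : EqOn f h (M n)) (k : Fin n) {x : Pt n}
    (hx : x ∈ M n) : partialX f k x = partialX h k x := by
  rw [partialX, partialX, fderivWithin_congr he (he hx)]

theorem IsC11Metric.symm (hg : IsC11Metric g) {x : Pt n} (hx : x ∈ M n) (i j : Fin n) :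
    g x i j = g x j i := by
  simpa using (hg.posDef x hx).isHermitian.apply j i

theorem IsC11Metric.partialX_symm (hg : IsC11Metric g) {x : Pt n} (hx : x ∈ M n) (i j k : Fin n) :
    partialX (fun y => g y i j) k x = partialX (fun y => g y j i) k x :=
  partialX_congr (fun _ hy => hg.symm hy i j) k hx

theorem IsC11Metric.contDiffOn (hg : IsC11Metric g) (i j : Fin n) :
    ContDiffOn ℝ 1 (fun x => g x i j) (M n) := by
  obtain ⟨K, hK⟩ := hg.lip i j
  rw [← zero_add (1 : WithTop ℕ∞), contDiffOn_succ_iff_fderivWithin uniqueDiffOn_M]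
  exact ⟨hg.diff i j, by simp, contDiffOn_zero.2 hK.continuousOn⟩

theorem contDiffOn_det {E : Type*} [NormedAddCommGroup E] [NormedSpace ℝ E]
    {A : E → Matrix (Fin n) (Fin n) ℝ} {s : Set E} (hA : ∀ i j, ContDiffOn ℝ 1 (fun x => A x i j) s) :
    ContDiffOn ℝ 1 (fun x => (A x).det) s := by
  simp only [Matrix.det_apply']
  exact ContDiffOn.sum fun σ _ => contDiffOn_const.mul (contDiffOn_prod fun i _ => hA _ _)

theorem IsC11Metric.contDiffOn_det (hg : IsC11Metric g) :
    ContDiffOn ℝ 1 (fun x => (g x).det) (M n) :=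
  SimpleC11.contDiffOn_det hg.contDiffOn

theorem IsC11Metric.det_pos (hg : IsC11Metric g) {x : Pt n} (hx : x ∈ M n) : 0 < (g x).det :=
  (hg.posDef x hx).det_pos

theorem IsC11Metric.isUnit_det (hg : IsC11Metric g) {x : Pt n} (hx : x ∈ M n) :
    IsUnit (g x).det := (hg.det_pos hx).ne'.isUnit

theorem IsC11Metric.contDiffOn_inv (hg : IsC11Metric g) (i j : Fin n) :
    ContDiffOn ℝ 1 (fun x => (g x)⁻¹ i j) (M n) := by
  -- Cramer's rule writes the entry as a quotient of determinants, hence as a C¹ function.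
  have : ∀ x, (g x)⁻¹ i j = (g x).det⁻¹ * ((g x).updateRow j (Pi.single i 1)).det := by
    intro x
    rw [Matrix.inv_def, Matrix.smul_apply, Matrix.adjugate_apply]
    simp
  simp only [this]
  refine (hg.contDiffOn_det.inv fun x hx => (hg.det_pos hx).ne').mul
    (SimpleC11.contDiffOn_det fun k l => ?_)
  by_cases hk : k = j
  · subst hk
    simpa using contDiffOn_const
  · simpa [Matrix.updateRow_apply, hk] using hg.contDiffOn k l

theorem locallyLipschitzOn_M_of_contDiffOn {F : Type*} [NormedAddCommGroup F] [NormedSpace ℝ F]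
    {f : Pt n → F} (hf : ContDiffOn ℝ 1 f (M n)) : LocallyLipschitzOn (M n) f :=
  fun x hx => (hf x hx).exists_lipschitzOnWith convex_M

theorem IsC11Metric.locallyLipschitzOn_partialX (hg : IsC11Metric g) (i j k : Fin n) :
    LocallyLipschitzOn (M n) (partialX (fun y => g y i j) k) := by
  obtain ⟨K, hK⟩ := hg.lip i j
  exact locallyLipschitzOn_clm (ContinuousLinearMap.apply ℝ ℝ (e k))
    (locallyLipschitzOn_of_lipschitzOnWith hK)

theorem IsC11Metric.locallyLipschitzOn_christoffel (hg : IsC11Metric g) (l j k : Fin n) :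
    LocallyLipschitzOn (M n) (christoffel g l j k) := by
  unfold christoffel
  refine locallyLipschitzOn_mul (locallyLipschitzOn_const _) (locallyLipschitzOn_sum _ fun m _ =>
    locallyLipschitzOn_mul (locallyLipschitzOn_M_of_contDiffOn (hg.contDiffOn_inv l m)) ?_)
  simp only [sub_eq_add_neg]
  have h3 := locallyLipschitzOn_clm (-ContinuousLinearMap.id ℝ ℝ)
    (hg.locallyLipschitzOn_partialX j k m)
  simp only [neg_apply, ContinuousLinearMap.id_apply] at h3
  exact locallyLipschitzOn_add (locallyLipschitzOn_add (hg.locallyLipschitzOn_partialX m k j)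
    (hg.locallyLipschitzOn_partialX j m k)) h3

theorem IsC11Metric.lipschitzOnWith_christoffel (hg : IsC11Metric g) (l j k : Fin n) :
    ∃ K, LipschitzOnWith K (christoffel g l j k) (M n) :=
  (hg.locallyLipschitzOn_christoffel l j k).exists_lipschitzOnWith_of_compact isCompact_M

theorem IsC11Metric.christoffel_symm (hg : IsC11Metric g) {x : Pt n} (hx : x ∈ M n)
    (l j k : Fin n) : christoffel g l j k x = christoffel g l k j x := by
  unfold christoffel
  congr 1
  refine Finset.sum_congr rfl fun m _ => ?_
  rw [hg.partialX_symm hx j m k, hg.partialX_symm hx m k j, hg.partialX_symm hx j k m]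
  ring

theorem IsC11Metric.sum_mul_christoffel (hg : IsC11Metric g) {x : Pt n} (hx : x ∈ M n)
    (b j k : Fin n) : ∑ l, g x b l * christoffel g l j k x
      = (1 / 2) * (partialX (fun y => g y b k) j x + partialX (fun y => g y j b) k x
        - partialX (fun y => g y j k) b x) := by
  have h1 : g x * (g x)⁻¹ = 1 := Matrix.mul_nonsing_inv _ (hg.isUnit_det hx)
  have h2 : ∀ m, ∑ l, g x b l * (g x)⁻¹ l m = if b = m then 1 else 0 := by
    intro m
    have := congrFun (congrFun h1 b) m
    rwa [Matrix.mul_apply, Matrix.one_apply] at this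
  simp only [christoffel, Finset.mul_sum]
  rw [Finset.sum_comm]
  have : ∀ m, ∑ l, g x b l * (1 / 2 * ((g x)⁻¹ l m * (partialX (fun y => g y m k) j x
      + partialX (fun y => g y j m) k x - partialX (fun y => g y j k) m x)))
      = (if b = m then 1 else 0) * (1 / 2 * (partialX (fun y => g y m k) j x
      + partialX (fun y => g y j m) k x - partialX (fun y => g y j k) m x)) := by
    intro m
    rw [← h2 m, Finset.sum_mul]
    refine Finset.sum_congr rfl fun l _ => ?_
    ring
  simp only [this]
  simp

/-- Metric compatibility ∇g = 0: with the index lowered, the two sums are Christoffel symbols of the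
first kind, in which all derivatives but ∂_k g_{ab} cancel. -/
theorem IsC11Metric.partialX_eq (hg : IsC11Metric g) {x : Pt n} (hx : x ∈ M n) (a b k : Fin n) :
    partialX (fun y => g y a b) k x
      = ∑ l, g x l b * christoffel g l k a x + ∑ l, g x a l * christoffel g l k b x := by
  have h1 : ∑ l, g x l b * christoffel g l k a x = ∑ l, g x b l * christoffel g l k a x :=
    Finset.sum_congr rfl fun l _ => by rw [hg.symm hx l b]
  rw [h1, hg.sum_mul_christoffel hx, hg.sum_mul_christoffel hx, hg.partialX_symm hx b a k,
    hg.partialX_symm hx k b a, hg.partialX_symm hx k a b, hg.partialX_symm hx b k a]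
  ring

/-- Jacobi's formula. -/
theorem hasFDerivAt_det {E : Type*} [NormedAddCommGroup E] [NormedSpace ℝ E]
    {A : E → Matrix (Fin n) (Fin n) ℝ} {A' : Fin n → Fin n → E →L[ℝ] ℝ} {x : E}
    (hA : ∀ i j, HasFDerivAt (fun y => A y i j) (A' i j) x) :
    HasFDerivAt (fun y => (A y).det) (∑ i, ∑ j, (A x).adjugate j i • A' i j) x := by
  let D : ContinuousMultilinearMap ℝ (fun _ : Fin n => Fin n → ℝ) ℝ :=
    { toMultilinearMap := (Matrix.detRowAlternating (R := ℝ) (n := Fin n)).toMultilinearMap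
      cont := (continuous_id (X := Matrix (Fin n) (Fin n) ℝ)).matrix_det }
  have h1 : HasFDerivAt (fun y => fun i j => A y i j)
      (ContinuousLinearMap.pi fun i => ContinuousLinearMap.pi fun j => A' i j) x :=
    hasFDerivAt_pi.2 fun i => hasFDerivAt_pi.2 fun j => hA i j
  have h2 := (D.hasFDerivAt (x := fun i j => A x i j)).comp x h1
  refine h2.congr_fderiv ?_
  ext p
  rw [ContinuousLinearMap.comp_apply, ContinuousMultilinearMap.linearDeriv_apply]
  simp only [sum_apply, smul_apply, smul_eq_mul]
  refine Finset.sum_congr rfl fun i _ => ?_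
  have h3 : D (Function.update (fun i j => A x i j) i
      ((ContinuousLinearMap.pi fun i => ContinuousLinearMap.pi fun j => A' i j) p i))
      = ((A x).updateRow i (fun j => A' i j p)).det := rfl
  rw [h3, ← Matrix.cramer_transpose_apply, Matrix.cramer_eq_adjugate_mulVec, Matrix.mulVec,
    dotProduct, ← Matrix.adjugate_transpose]
  rfl

theorem IsC11Metric.hasFDerivAt (hg : IsC11Metric g) {x : Pt n}
    (hx : x ∈ Metric.ball (0 : Pt n) 1) (i j : Fin n) :
    HasFDerivAt (fun y => g y i j) (fderivWithin ℝ (fun y => g y i j) (M n) x) x :=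
  ((hg.diff i j) x (ball_subset_M hx)).hasFDerivWithinAt.hasFDerivAt (M_mem_nhds hx)

/-- The trace `Γ^i_{ji}` of the Christoffel symbols. -/
noncomputable def trChr (g : MetricField n) (j : Fin n) (x : Pt n) : ℝ :=
  ∑ i, christoffel g i j i x

theorem sum_smul_e (a : Pt n) : ∑ i, a i • e i = a := by
  ext j
  simp [e, Pi.single_apply]

theorem clm_eq_sum {F : Type*} [NormedAddCommGroup F] [NormedSpace ℝ F] (T : Pt n →L[ℝ] F)
    (a : Pt n) : T a = ∑ i, a i • T (e i) := by
  conv_lhs => rw [← sum_smul_e a]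
  simp

theorem sum_inv_mul (hg : IsC11Metric g) {x : Pt n} (hx : x ∈ M n) (i j : Fin n) :
    ∑ l, (g x)⁻¹ i l * g x l j = if i = j then 1 else 0 := by
  have h1 : (g x)⁻¹ * g x = 1 := Matrix.nonsing_inv_mul _ (hg.isUnit_det hx)
  have := congrFun (congrFun h1 i) j
  rwa [Matrix.mul_apply, Matrix.one_apply] at this

theorem sum_mul_inv (hg : IsC11Metric g) {x : Pt n} (hx : x ∈ M n) (i j : Fin n) :
    ∑ l, g x i l * (g x)⁻¹ l j = if i = j then 1 else 0 := by
  have h1 : g x * (g x)⁻¹ = 1 := Matrix.mul_nonsing_inv _ (hg.isUnit_det hx)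
  have := congrFun (congrFun h1 i) j
  rwa [Matrix.mul_apply, Matrix.one_apply] at this

/-- Jacobi's formula gives det g · g^{ij} ∂_k g_{ij}, and by metric compatibility the two indices of
g_{ij} contribute the same trace, whence the factor 2. -/
theorem IsC11Metric.fderiv_det (hg : IsC11Metric g) {x : Pt n}
    (hx : x ∈ Metric.ball (0 : Pt n) 1) (k : Fin n) :
    fderiv ℝ (fun y => (g y).det) x (e k) = 2 * (g x).det * trChr g k x := by
  have hxM := ball_subset_M hx
  rw [(hasFDerivAt_det fun i j => hg.hasFDerivAt hx i j).fderiv]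
  have h0 : (g x).adjugate = (g x).det • (g x)⁻¹ := by
    rw [Matrix.inv_def, smul_smul, Ring.inverse_eq_inv', mul_inv_cancel₀ (hg.det_pos hxM).ne',
      one_smul]
  simp only [sum_apply, smul_apply, smul_eq_mul, h0,
    Matrix.smul_apply]
  have h1 : ∀ i j, fderivWithin ℝ (fun y => g y i j) (M n) x (e k)
      = ∑ l, g x l j * christoffel g l k i x + ∑ l, g x i l * christoffel g l k j x := fun i j =>
    hg.partialX_eq hxM i j k
  simp only [h1, mul_add, Finset.sum_add_distrib, Finset.mul_sum]
  have s1 : ∑ i, ∑ j, ∑ l, (g x).det * (g x)⁻¹ j i * (g x l j * christoffel g l k i x)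
      = (g x).det * trChr g k x := by
    calc _ = ∑ i, ∑ l, (g x).det * ((∑ j, g x l j * (g x)⁻¹ j i) * christoffel g l k i x) := by
          refine Finset.sum_congr rfl fun i _ => ?_
          rw [Finset.sum_comm]
          refine Finset.sum_congr rfl fun l _ => ?_
          rw [Finset.sum_mul, Finset.mul_sum]
          exact Finset.sum_congr rfl fun j _ => by ring
      _ = _ := by
          simp [sum_mul_inv hg hxM, trChr, Finset.mul_sum]
  have s2 : ∑ i, ∑ j, ∑ l, (g x).det * (g x)⁻¹ j i * (g x i l * christoffel g l k j x)
      = (g x).det * trChr g k x := by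
    rw [Finset.sum_comm]
    calc _ = ∑ j, ∑ l, (g x).det * ((∑ i, (g x)⁻¹ j i * g x i l) * christoffel g l k j x) := by
          refine Finset.sum_congr rfl fun j _ => ?_
          rw [Finset.sum_comm]
          refine Finset.sum_congr rfl fun l _ => ?_
          rw [Finset.sum_mul, Finset.mul_sum]
          exact Finset.sum_congr rfl fun i _ => by ring
      _ = _ := by
          simp [sum_inv_mul hg hxM, trChr, Finset.mul_sum]
  rw [s1, s2]
  ring

theorem IsC11Metric.differentiableAt_inv (hg : IsC11Metric g) {x : Pt n}
    (hx : x ∈ Metric.ball (0 : Pt n) 1) (i j : Fin n) :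
    DifferentiableAt ℝ (fun y => (g y)⁻¹ i j) x :=
  ((hg.contDiffOn_inv i j).differentiableOn one_ne_zero x (ball_subset_M hx)).differentiableAt
    (M_mem_nhds hx)

/-- Compatibility for the inverse metric, obtained by differentiating g g⁻¹ = 1 and multiplying by
g⁻¹ from the left. -/
theorem IsC11Metric.fderiv_inv (hg : IsC11Metric g) {x : Pt n}
    (hx : x ∈ Metric.ball (0 : Pt n) 1) (i j k : Fin n) :
    fderiv ℝ (fun y => (g y)⁻¹ i j) x (e k)
      = -∑ m, christoffel g i k m x * (g x)⁻¹ m j - ∑ m, (g x)⁻¹ i m * christoffel g j k m x := by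
  have hxM := ball_subset_M hx
  set D : Fin n → Fin n → ℝ := fun i j => fderiv ℝ (fun y => (g y)⁻¹ i j) x (e k)
  have h1 : ∀ a, ∑ m, (g x a m * D m j
      + (g x)⁻¹ m j * fderivWithin ℝ (fun y => g y a m) (M n) x (e k)) = 0 := by
    intro a
    have hd : HasFDerivAt (fun y => ∑ m, g y a m * (g y)⁻¹ m j) (∑ m, (g x a m •
        fderiv ℝ (fun y => (g y)⁻¹ m j) x + (g x)⁻¹ m j •
        fderivWithin ℝ (fun y => g y a m) (M n) x)) x :=
      HasFDerivAt.fun_sum fun m _ =>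
        (hg.hasFDerivAt hx a m).fun_mul (hg.differentiableAt_inv hx m j).hasFDerivAt
    have he : (fun y => ∑ m, g y a m * (g y)⁻¹ m j) =ᶠ[𝓝 x] fun _ => if a = j then 1 else 0 := by
      filter_upwards [M_mem_nhds hx] with y hy
      exact sum_mul_inv hg hy a j
    have h2 := hd.fderiv
    rw [he.fderiv_eq, fderiv_fun_const] at h2
    have := congrArg (fun T => T (e k)) h2
    simpa [D] using this.symm
  have h2 : D i j = ∑ a, (g x)⁻¹ i a * ∑ m, g x a m * D m j := by
    simp only [Finset.mul_sum]
    rw [Finset.sum_comm]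
    have : ∀ m, ∑ a, (g x)⁻¹ i a * (g x a m * D m j) = (if i = m then 1 else 0) * D m j := by
      intro m
      rw [← sum_inv_mul hg hxM i m, Finset.sum_mul]
      exact Finset.sum_congr rfl fun a _ => by ring
    simp only [this]
    simp
  have h3 : ∀ a, ∑ m, g x a m * D m j
      = -∑ m, (g x)⁻¹ m j * fderivWithin ℝ (fun y => g y a m) (M n) x (e k) := by
    intro a
    have := h1 a
    rw [Finset.sum_add_distrib] at this
    linarith
  have h4 : ∀ a m, fderivWithin ℝ (fun y => g y a m) (M n) x (e k)
      = ∑ l, g x l m * christoffel g l k a x + ∑ l, g x a l * christoffel g l k m x := fun a m =>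
    hg.partialX_eq hxM a m k
  have h5 : ∀ a, ∑ m, (g x)⁻¹ m j * ∑ l, g x l m * christoffel g l k a x
      = christoffel g j k a x := by
    intro a
    simp only [Finset.mul_sum]
    rw [Finset.sum_comm]
    have : ∀ l, ∑ m, (g x)⁻¹ m j * (g x l m * christoffel g l k a x)
        = (if l = j then 1 else 0) * christoffel g l k a x := by
      intro l
      rw [← sum_mul_inv hg hxM l j, Finset.sum_mul]
      exact Finset.sum_congr rfl fun a _ => by ring
    simp only [this]
    simp
  have h6 : ∑ a, (g x)⁻¹ i a * ∑ m, (g x)⁻¹ m j * ∑ l, g x a l * christoffel g l k m x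
      = ∑ m, christoffel g i k m x * (g x)⁻¹ m j := by
    simp only [Finset.mul_sum]
    rw [Finset.sum_comm]
    refine Finset.sum_congr rfl fun m _ => ?_
    rw [Finset.sum_comm]
    have : ∀ l, ∑ a, (g x)⁻¹ i a * ((g x)⁻¹ m j * (g x a l * christoffel g l k m x))
        = (if i = l then 1 else 0) * (christoffel g l k m x * (g x)⁻¹ m j) := by
      intro l
      rw [← sum_inv_mul hg hxM i l, Finset.sum_mul]
      exact Finset.sum_congr rfl fun a _ => by ring
    simp only [this]
    simp
  change D i j = _
  rw [h2]
  simp only [h3, h4, mul_add, Finset.sum_add_distrib, h5]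
  simp only [mul_neg, neg_add, mul_add, Finset.sum_add_distrib, Finset.sum_neg_distrib, h6]
  ring

end Metric

end SimpleC11

namespace SimpleC11

/-! ### Geometry of the slit tangent bundle -/

section Geometry

variable {n : ℕ} {g : MetricField n}

theorem gInner_add_left (x a b c : Pt n) :
    gInner g x (a + b) c = gInner g x a c + gInner g x b c := by
  simp [gInner, ← Finset.sum_add_distrib, mul_add, add_mul]

theorem gInner_smul_left (x a b : Pt n) (t : ℝ) : gInner g x (t • a) b = t * gInner g x a b := by
  simp only [gInner, Finset.mul_sum, PiLp.smul_apply, smul_eq_mul]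
  exact Finset.sum_congr rfl fun i _ => Finset.sum_congr rfl fun j _ => by ring

theorem gInner_add_right (x a b c : Pt n) :
    gInner g x a (b + c) = gInner g x a b + gInner g x a c := by
  simp [gInner, ← Finset.sum_add_distrib, mul_add]

theorem gInner_smul_right (x a b : Pt n) (t : ℝ) : gInner g x a (t • b) = t * gInner g x a b := by
  simp only [gInner, Finset.mul_sum, PiLp.smul_apply, smul_eq_mul]
  exact Finset.sum_congr rfl fun i _ => Finset.sum_congr rfl fun j _ => by ring

theorem IsC11Metric.gInner_comm (hg : IsC11Metric g) {x : Pt n} (hx : x ∈ M n) (a b : Pt n) :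
    gInner g x a b = gInner g x b a := by
  rw [gInner, gInner, Finset.sum_comm]
  exact Finset.sum_congr rfl fun i _ => Finset.sum_congr rfl fun j _ => by
    rw [hg.symm hx]; ring

theorem gInner_zero_left (x a : Pt n) : gInner g x 0 a = 0 := by simp [gInner]

theorem gInner_zero_right (x a : Pt n) : gInner g x a 0 = 0 := by simp [gInner]

theorem gInner_neg_left (x a b : Pt n) : gInner g x (-a) b = -gInner g x a b := by
  simpa using gInner_smul_left (g := g) x a b (-1)

theorem gInner_neg_right (x a b : Pt n) : gInner g x a (-b) = -gInner g x a b := by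
  simpa using gInner_smul_right (g := g) x a b (-1)

theorem gInner_sub_left (x a b c : Pt n) :
    gInner g x (a - b) c = gInner g x a c - gInner g x b c := by
  rw [sub_eq_add_neg, gInner_add_left, gInner_neg_left, sub_eq_add_neg]

theorem gInner_sub_right (x a b c : Pt n) :
    gInner g x a (b - c) = gInner g x a b - gInner g x a c := by
  rw [sub_eq_add_neg, gInner_add_right, gInner_neg_right, sub_eq_add_neg]

theorem IsC11Metric.gInner_pos (hg : IsC11Metric g) {x : Pt n} (hx : x ∈ M n) {a : Pt n}
    (ha : a ≠ 0) : 0 < gInner g x a a := by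
  have h0 : a.ofLp ≠ 0 := fun h => ha (by ext i; simpa using congrFun h i)
  have h1 := (hg.posDef x hx).dotProduct_mulVec_pos h0
  suffices h : gInner g x a a = star a.ofLp ⬝ᵥ (g x).mulVec a.ofLp from h ▸ h1
  simp only [gInner, dotProduct, Matrix.mulVec, Finset.mul_sum]
  refine Finset.sum_congr rfl fun i _ => Finset.sum_congr rfl fun j _ => ?_
  rw [Pi.star_apply, star_trivial]
  ring

theorem IsC11Metric.gInner_nonneg (hg : IsC11Metric g) {x : Pt n} (hx : x ∈ M n) (a : Pt n) :
    0 ≤ gInner g x a a := by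
  by_cases ha : a = 0
  · simp [ha, gInner_zero_left]
  · exact (hg.gInner_pos hx ha).le

theorem IsC11Metric.gNorm_sq (hg : IsC11Metric g) {x : Pt n} (hx : x ∈ M n) (a : Pt n) :
    gNorm g x a ^ 2 = gInner g x a a := Real.sq_sqrt (hg.gInner_nonneg hx a)

theorem IsC11Metric.gNorm_pos (hg : IsC11Metric g) {x : Pt n} (hx : x ∈ M n) {a : Pt n}
    (ha : a ≠ 0) : 0 < gNorm g x a := Real.sqrt_pos.2 (hg.gInner_pos hx ha)

theorem gNorm_smul (x a : Pt n) {t : ℝ} (ht : 0 ≤ t) : gNorm g x (t • a) = t * gNorm g x a := by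
  rw [gNorm, gInner_smul_left, gInner_smul_right, ← mul_assoc, Real.sqrt_mul (mul_self_nonneg t),
    Real.sqrt_mul_self ht, gNorm]

theorem IsC11Metric.contDiffOn_gInner (hg : IsC11Metric g) {F : Type*} [NormedAddCommGroup F]
    [NormedSpace ℝ F] {s : Set F} {f h k : F → Pt n} (hf : ContDiffOn ℝ 1 f s)
    (hfs : MapsTo f s (M n)) (hh : ContDiffOn ℝ 1 h s) (hk : ContDiffOn ℝ 1 k s) :
    ContDiffOn ℝ 1 (fun z => gInner g (f z) (h z) (k z)) s := by
  have hc : ∀ {k : F → Pt n}, ContDiffOn ℝ 1 k s → ∀ i, ContDiffOn ℝ 1 (fun z => k z i) s :=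
    fun hk i => contDiffOn_euclidean.1 hk i
  unfold gInner
  exact ContDiffOn.sum fun i _ => ContDiffOn.sum fun j _ =>
    (((hg.contDiffOn i j).comp hf hfs).mul (hc hh i)).mul (hc hk j)

theorem IsC11Metric.continuousOn_gInner (hg : IsC11Metric g) {F : Type*} [TopologicalSpace F]
    {s : Set F} {f h k : F → Pt n} (hf : ContinuousOn f s)
    (hfs : MapsTo f s (M n)) (hh : ContinuousOn h s) (hk : ContinuousOn k s) :
    ContinuousOn (fun z => gInner g (f z) (h z) (k z)) s := by
  have hc : ∀ {k : F → Pt n}, ContinuousOn k s → ∀ i, ContinuousOn (fun z => k z i) s :=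
    fun hk i => (PiLp.continuous_apply 2 _ i).comp_continuousOn hk
  unfold gInner
  exact continuousOn_finsetSum _ fun i _ => continuousOn_finsetSum _ fun j _ =>
    (((hg.contDiffOn i j).continuousOn.comp hf hfs).mul (hc hh i)).mul (hc hk j)

/-- The form has a positive minimum over the compact product of M with the Euclidean unit sphere;
homogeneity does the rest. -/
theorem IsC11Metric.exists_lower_bound (hg : IsC11Metric g) :
    ∃ c > 0, ∀ x ∈ M n, ∀ a, c * ‖a‖ ^ 2 ≤ gInner g x a a := by
  have hK : IsCompact (M n ×ˢ Metric.sphere (0 : Pt n) 1) :=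
    isCompact_M.prod (isCompact_sphere _ _)
  have hcont : ContinuousOn (fun z : Pt n × Pt n => gInner g z.1 z.2 z.2)
      (M n ×ˢ Metric.sphere (0 : Pt n) 1) :=
    hg.continuousOn_gInner continuousOn_fst (fun z hz => hz.1) continuousOn_snd continuousOn_snd
  obtain ⟨c, hc, h⟩ := hK.exists_forall_le' hcont (a := 0) (fun z hz =>
    hg.gInner_pos hz.1 (fun h0 => by simpa [h0] using hz.2))
  refine ⟨c, hc, fun x hx a => ?_⟩
  by_cases ha : a = 0
  · simp [ha, gInner_zero_left]
  have hn : ‖a‖ ≠ 0 := norm_ne_zero_iff.2 ha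
  have h1 := h (x, ‖a‖⁻¹ • a) ⟨hx, by simp [norm_smul, hn]⟩
  simp only [gInner_smul_left, gInner_smul_right] at h1
  have h2 := mul_le_mul_of_nonneg_right h1 (sq_nonneg ‖a‖)
  calc c * ‖a‖ ^ 2 ≤ _ := h2
    _ = _ := by field_simp

theorem IsC11Metric.exists_upper_bound (hg : IsC11Metric g) :
    ∃ C, 0 ≤ C ∧ ∀ x ∈ M n, ∀ a b, |gInner g x a b| ≤ C * ‖a‖ * ‖b‖ := by
  have h : ∀ i j, ∃ B, ∀ x ∈ M n, ‖g x i j‖ ≤ B := fun i j =>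
    isCompact_M.exists_bound_of_continuousOn (hg.contDiffOn i j).continuousOn
  choose B hB using h
  have hB0 : ∀ i j, 0 ≤ B i j := fun i j =>
    (norm_nonneg _).trans (hB i j 0 (by simp [M]))
  refine ⟨∑ i, ∑ j, B i j, Finset.sum_nonneg fun i _ => Finset.sum_nonneg fun j _ => hB0 i j,
    fun x hx a b => ?_⟩
  simp only [gInner, Finset.sum_mul]
  refine (Finset.abs_sum_le_sum_abs _ _).trans (Finset.sum_le_sum fun i _ =>
    (Finset.abs_sum_le_sum_abs _ _).trans (Finset.sum_le_sum fun j _ => ?_))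
  rw [abs_mul, abs_mul]
  have h1 := hB i j x hx
  have h2 := PiLp.norm_apply_le a i
  have h3 := PiLp.norm_apply_le b j
  simp only [Real.norm_eq_abs] at h1 h2 h3
  have := hB0 i j
  gcongr

theorem measurableSet_slitTM : MeasurableSet (slitTM n) :=
  (Metric.isClosed_closedBall.preimage continuous_fst).measurableSet.inter
    ((isOpen_compl_singleton (x := (0 : Pt n))).preimage continuous_snd).measurableSet

theorem IsC11Metric.contDiffOn_gNorm (hg : IsC11Metric g) :
    ContDiffOn ℝ 1 (fun z : Pt n × Pt n => gNorm g z.1 z.2) (slitTM n) :=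
  (hg.contDiffOn_gInner contDiffOn_fst (fun _ hz => hz.1) contDiffOn_snd contDiffOn_snd).sqrt
    fun _ hz => (hg.gInner_pos hz.1 hz.2).ne'

theorem IsC11Metric.contDiffOn_radial (hg : IsC11Metric g) :
    ContDiffOn ℝ 1 (radial g) (slitTM n) :=
  contDiffOn_fst.prodMk ((hg.contDiffOn_gNorm.inv fun _ hz => (hg.gNorm_pos hz.1 hz.2).ne').smul
    contDiffOn_snd)

theorem IsC11Metric.radial_mem (hg : IsC11Metric g) {z : Pt n × Pt n} (hz : z ∈ slitTM n) :
    radial g z ∈ SM g := by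
  refine ⟨hz.1, ?_⟩
  have h := hg.gNorm_pos hz.1 hz.2
  have h2 := hg.gNorm_sq hz.1 z.2
  simp only [radial, gInner_smul_left, gInner_smul_right, ← h2]
  field_simp

theorem ne_zero_of_mem_SM {z : Pt n × Pt n} (hz : z ∈ SM g) : z.2 ≠ 0 := by
  intro h
  have := hz.2
  simp [h, gInner_zero_left] at this

theorem SM_subset_slitTM : SM g ⊆ slitTM n := fun _ hz => ⟨hz.1, ne_zero_of_mem_SM hz⟩

theorem gNorm_of_mem_SM {z : Pt n × Pt n} (hz : z ∈ SM g) : gNorm g z.1 z.2 = 1 := by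
  rw [gNorm, hz.2, Real.sqrt_one]

theorem radial_of_mem_SM {z : Pt n × Pt n} (hz : z ∈ SM g) : radial g z = z := by
  rw [radial, gNorm_of_mem_SM hz]
  simp

theorem radial_smul (x v : Pt n) {t : ℝ} (ht : 0 < t) :
    radial g (x, t • v) = radial g (x, v) := by
  simp only [radial, gNorm_smul x v ht.le, smul_smul]
  rw [mul_inv_rev, mul_assoc, inv_mul_cancel₀ ht.ne', mul_one]

theorem IsC11Metric.gNorm_le (hg : IsC11Metric g) :
    ∃ C, 0 < C ∧ ∀ z ∈ SM g, ‖z.2‖ ≤ C := by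
  obtain ⟨c, hc, h⟩ := hg.exists_lower_bound
  refine ⟨Real.sqrt c⁻¹, Real.sqrt_pos.2 (inv_pos.2 hc), fun z hz => ?_⟩
  refine Real.le_sqrt_of_sq_le ?_
  have := h z.1 hz.1 z.2
  rw [hz.2] at this
  rw [← one_div, le_div_iff₀ hc]
  linarith

theorem IsC11Metric.isCompact_SM (hg : IsC11Metric g) : IsCompact (SM g) := by
  obtain ⟨C, -, hC⟩ := hg.gNorm_le
  have hK : IsCompact (M n ×ˢ Metric.closedBall (0 : Pt n) C) :=
    isCompact_M.prod (isCompact_closedBall _ _)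
  have hcont : ContinuousOn (fun z : Pt n × Pt n => gInner g z.1 z.2 z.2)
      (M n ×ˢ Metric.closedBall (0 : Pt n) C) :=
    hg.continuousOn_gInner continuousOn_fst (fun z hz => hz.1) continuousOn_snd continuousOn_snd
  have : SM g = (M n ×ˢ Metric.closedBall (0 : Pt n) C) ∩
      (fun z : Pt n × Pt n => gInner g z.1 z.2 z.2) ⁻¹' {1} := by
    ext z
    constructor
    · intro hz
      exact ⟨⟨hz.1, by simpa using hC z hz⟩, hz.2⟩
    · rintro ⟨h1, h2⟩
      exact ⟨h1.1, h2⟩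
  rw [this]
  exact hK.of_isClosed_subset (hcont.preimage_isClosed_of_isClosed hK.isClosed isClosed_singleton)
    inter_subset_left

theorem measurableSet_inter_preimage_of_continuousOn {α β : Type*} [TopologicalSpace α]
    [MeasurableSpace α] [OpensMeasurableSpace α] [TopologicalSpace β] [MeasurableSpace β]
    [BorelSpace β] {f : α → β} {s : Set α} {t : Set β} (hs : MeasurableSet s)
    (hf : ContinuousOn f s) (ht : MeasurableSet t) : MeasurableSet (s ∩ f ⁻¹' t) := by
  have h1 : Measurable (s.domRestrict f) := (continuousOn_iff_continuous_domRestrict.1 hf).measurable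
  have h2 := hs.subtype_image (h1 ht)
  convert h2 using 1
  ext x
  simp
  tauto

/-! ### Polar coordinates -/

/-- The measure `det g dx dv` on the slit tangent bundle. -/
noncomputable def tmMeasure (g : MetricField n) : Measure (Pt n × Pt n) :=
  (volume.restrict (slitTM n)).withDensity (fun z => ENNReal.ofReal (g z.1).det)

/-- The measure `s^{n-1} ds` on the half line. -/
noncomputable def powMeasure (n : ℕ) : Measure ℝ :=
  (volume.restrict (Ioi 0)).withDensity (fun s => ENNReal.ofReal (s ^ (n - 1)))

theorem powMeasure_Iio (hn : n ≠ 0) (t : ℝ) :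
    powMeasure n (Iio t) = ENNReal.ofReal ((max t 0) ^ n / n) := by
  rw [powMeasure, withDensity_apply _ measurableSet_Iio, Measure.restrict_restrict measurableSet_Iio,
    Iio_inter_Ioi]
  rcases le_total t 0 with h | h
  · simp [Ioo_eq_empty_of_le h, max_eq_right h, hn]
  · rw [Measure.restrict_congr_set Ioo_ae_eq_Ioc, ← ofReal_integral_eq_lintegral_ofReal
      (intervalIntegral.intervalIntegrable_pow _).1,
      ← intervalIntegral.integral_of_le h, integral_pow, max_eq_left h]
    · obtain ⟨m, rfl⟩ := Nat.exists_eq_succ_of_ne_zero hn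
      simp
    · filter_upwards [ae_restrict_mem measurableSet_Ioc] with y hy
      exact pow_nonneg hy.1.le _

theorem lintegral_smul_snd (f : Pt n × Pt n → ℝ≥0∞) {t : ℝ} (ht : 0 < t) :
    ∫⁻ z, f z = ENNReal.ofReal (t ^ n) * ∫⁻ z : Pt n × Pt n, f (z.1, t • z.2) := by
  let S : (Pt n × Pt n) ≃ᵐ (Pt n × Pt n) :=
    (Homeomorph.prodCongr (Homeomorph.refl _)
      (Homeomorph.smulOfNeZero t ht.ne')).toMeasurableEquiv
  have hS : Measure.map S (volume : Measure (Pt n × Pt n))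
      = ENNReal.ofReal |(t ^ n)⁻¹| • volume := by
    have h1 : Measure.map (Prod.map id (fun v : Pt n => t • v))
        (volume : Measure (Pt n × Pt n)) = _ :=
      (Measure.map_prod_map (volume : Measure (Pt n)) (volume : Measure (Pt n)) measurable_id
        (measurable_const_smul t)).symm
    rw [Measure.map_id, Measure.map_addHaar_smul volume ht.ne', Measure.prod_smul_right] at h1
    rw [finrank_euclideanSpace_fin] at h1
    exact h1
  have h2 := lintegral_map_equiv (μ := (volume : Measure (Pt n × Pt n))) f S
  rw [hS, lintegral_smul_measure, smul_eq_mul] at h2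
  have h3 : ∫⁻ z : Pt n × Pt n, f (z.1, t • z.2) = ∫⁻ z, f (S z) := rfl
  rw [h3, ← h2, ← mul_assoc, ← ENNReal.ofReal_mul (by positivity), abs_of_pos (by positivity),
    mul_inv_cancel₀ (by positivity)]
  simp

theorem IsC11Metric.aemeasurable_radial (hg : IsC11Metric g) :
    AEMeasurable (radial g) (volume.restrict (slitTM n)) :=
  hg.contDiffOn_radial.continuousOn.aemeasurable measurableSet_slitTM

theorem IsC11Metric.aemeasurable_gNorm (hg : IsC11Metric g) :
    AEMeasurable (fun z : Pt n × Pt n => gNorm g z.1 z.2) (volume.restrict (slitTM n)) :=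
  hg.contDiffOn_gNorm.continuousOn.aemeasurable measurableSet_slitTM

theorem IsC11Metric.contDiffOn_det_fst (hg : IsC11Metric g) :
    ContDiffOn ℝ 1 (fun z : Pt n × Pt n => (g z.1).det) (slitTM n) :=
  hg.contDiffOn_det.comp contDiffOn_fst (fun _ hz => hz.1)

theorem IsC11Metric.aemeasurable_det (hg : IsC11Metric g) :
    AEMeasurable (fun z : Pt n × Pt n => ENNReal.ofReal (g z.1).det)
      (volume.restrict (slitTM n)) :=
  (hg.contDiffOn_det_fst.continuousOn.aemeasurable measurableSet_slitTM).ennreal_ofReal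

theorem IsC11Metric.measurableSet_slit (hg : IsC11Metric g) {A : Set (Pt n × Pt n)}
    (hA : MeasurableSet A) (t : ℝ) :
    MeasurableSet {z | z ∈ slitTM n ∧ radial g z ∈ A ∧ gNorm g z.1 z.2 < t} := by
  have h1 := measurableSet_inter_preimage_of_continuousOn measurableSet_slitTM
    hg.contDiffOn_radial.continuousOn hA
  have h2 := measurableSet_inter_preimage_of_continuousOn measurableSet_slitTM
    hg.contDiffOn_gNorm.continuousOn (measurableSet_Iio (a := t))
  have h3 : {z | z ∈ slitTM n ∧ radial g z ∈ A ∧ gNorm g z.1 z.2 < t}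
      = (slitTM n ∩ radial g ⁻¹' A) ∩ (slitTM n ∩ (fun z => gNorm g z.1 z.2) ⁻¹' Iio t) := by
    ext z
    simp only [mem_ofPred_eq, mem_inter_iff, mem_preimage, mem_Iio]
    tauto
  exact h3 ▸ h1.inter h2

theorem IsC11Metric.sigma_apply (hg : IsC11Metric g) {A : Set (Pt n × Pt n)}
    (hA : MeasurableSet A) : sigma g A = n * ∫⁻ z in
      {z | z ∈ slitTM n ∧ radial g z ∈ A ∧ gNorm g z.1 z.2 < 1}, ENNReal.ofReal (g z.1).det := by
  have hD : MeasurableSet {z | z ∈ slitTM n ∧ gNorm g z.1 z.2 < 1} := by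
    simpa using hg.measurableSet_slit MeasurableSet.univ 1
  have hsub : {z | z ∈ slitTM n ∧ gNorm g z.1 z.2 < 1} ⊆ slitTM n := fun z hz => hz.1
  have hr : AEMeasurable (radial g) ((volume.restrict
      {z | z ∈ slitTM n ∧ gNorm g z.1 z.2 < 1}).withDensity
      (fun z => ENNReal.ofReal (g z.1).det)) :=
    (hg.contDiffOn_radial.continuousOn.mono hsub).aemeasurable hD |>.mono_ac
      (withDensity_absolutelyContinuous _ _)
  rw [sigma, Measure.smul_apply, Measure.map_apply_of_aemeasurable hr hA, smul_eq_mul,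
    withDensity_apply', Measure.restrict_restrict₀' hD.nullMeasurableSet]
  congr 3
  ext z
  simp
  tauto

/-- Dilation of the fibres by t maps the set for t = 1 onto this one and scales the volume by t^n.
The factor n in `sigma` accounts for the division by n. -/
theorem IsC11Metric.tmMeasure_apply (hg : IsC11Metric g) (hn : n ≠ 0) {A : Set (Pt n × Pt n)}
    (hA : MeasurableSet A) {t : ℝ} (ht : 0 < t) :
    tmMeasure g {z | radial g z ∈ A ∧ gNorm g z.1 z.2 < t}
      = sigma g A * ENNReal.ofReal (t ^ n / n) := by
  have h1 : tmMeasure g {z | radial g z ∈ A ∧ gNorm g z.1 z.2 < t} = ∫⁻ z in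
      {z | z ∈ slitTM n ∧ radial g z ∈ A ∧ gNorm g z.1 z.2 < t}, ENNReal.ofReal (g z.1).det := by
    rw [tmMeasure, withDensity_apply', Measure.restrict_restrict₀' measurableSet_slitTM.nullMeasurableSet]
    congr 2
    ext z
    simp
    tauto
  rw [h1, ← lintegral_indicator (hg.measurableSet_slit hA t), lintegral_smul_snd _ ht,
    hg.sigma_apply hA, ← lintegral_indicator (hg.measurableSet_slit hA 1)]
  have h2 : ∀ z : Pt n × Pt n, {z | z ∈ slitTM n ∧ radial g z ∈ A ∧ gNorm g z.1 z.2 < t}.indicator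
      (fun z => ENNReal.ofReal (g z.1).det) (z.1, t • z.2)
      = {z | z ∈ slitTM n ∧ radial g z ∈ A ∧ gNorm g z.1 z.2 < 1}.indicator
      (fun z => ENNReal.ofReal (g z.1).det) z := by
    rintro ⟨x, v⟩
    have : ((x, t • v) ∈ {z | z ∈ slitTM n ∧ radial g z ∈ A ∧ gNorm g z.1 z.2 < t})
        ↔ (x, v) ∈ {z | z ∈ slitTM n ∧ radial g z ∈ A ∧ gNorm g z.1 z.2 < 1} := by
      simp only [mem_ofPred_eq, slitTM, radial_smul x v ht, gNorm_smul x v ht.le, ne_eq, smul_eq_zero,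
        ht.ne', false_or]
      rw [mul_lt_iff_lt_one_right ht]
    by_cases hz : (x, v) ∈ {z | z ∈ slitTM n ∧ radial g z ∈ A ∧ gNorm g z.1 z.2 < 1}
    · rw [indicator_of_mem hz, indicator_of_mem (this.2 hz)]
    · rw [indicator_of_notMem hz, indicator_of_notMem (fun h => hz (this.1 h))]
  simp only [h2]
  have hn' : (n : ℝ≥0∞) ≠ 0 := by exact_mod_cast hn
  rw [ENNReal.ofReal_div_of_pos (by positivity), ENNReal.ofReal_natCast, ENNReal.div_eq_inv_mul]
  calc _ = (n : ℝ≥0∞)⁻¹ * n * (ENNReal.ofReal (t ^ n) * _) := by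
        rw [ENNReal.inv_mul_cancel hn' (ENNReal.natCast_ne_top n), one_mul]
    _ = _ := by ring

theorem IsC11Metric.isFiniteMeasure_sigma (hg : IsC11Metric g) : IsFiniteMeasure (sigma g) := by
  constructor
  rw [hg.sigma_apply MeasurableSet.univ]
  refine ENNReal.mul_lt_top (ENNReal.natCast_lt_top n) ?_
  obtain ⟨B, hB⟩ := isCompact_M.exists_bound_of_continuousOn hg.contDiffOn_det.continuousOn
  obtain ⟨c, hc, h⟩ := hg.exists_lower_bound
  have hsub : {z : Pt n × Pt n | z ∈ slitTM n ∧ radial g z ∈ univ ∧ gNorm g z.1 z.2 < 1}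
      ⊆ M n ×ˢ Metric.closedBall 0 (Real.sqrt c⁻¹) := by
    rintro z ⟨hz, -, hz1⟩
    refine ⟨hz.1, ?_⟩
    rw [mem_closedBall_zero_iff]
    refine Real.le_sqrt_of_sq_le ?_
    have h1 := h z.1 hz.1 z.2
    have h2 : gInner g z.1 z.2 z.2 < 1 := by
      rw [← hg.gNorm_sq hz.1]
      have := (hg.gNorm_pos hz.1 hz.2)
      nlinarith
    rw [← one_div, le_div_iff₀ hc]
    linarith
  have hK : IsCompact (M n ×ˢ Metric.closedBall (0 : Pt n) (Real.sqrt c⁻¹)) :=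
    isCompact_M.prod (isCompact_closedBall _ _)
  calc _ ≤ ∫⁻ z in {z : Pt n × Pt n | z ∈ slitTM n ∧ radial g z ∈ univ ∧ gNorm g z.1 z.2 < 1},
        ENNReal.ofReal B := by
        refine setLIntegral_mono' (hg.measurableSet_slit MeasurableSet.univ 1) fun z hz => ?_
        exact ENNReal.ofReal_le_ofReal ((le_abs_self _).trans (hB z.1 hz.1.1))
    _ = ENNReal.ofReal B * volume {z : Pt n × Pt n | z ∈ slitTM n ∧ radial g z ∈ univ ∧
        gNorm g z.1 z.2 < 1} := by rw [setLIntegral_const]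
    _ < ∞ := ENNReal.mul_lt_top ENNReal.ofReal_lt_top
        ((measure_mono hsub).trans_lt hK.measure_lt_top)

/-- Polar coordinates in the fibres. Rectangles A × (-∞, t) form a generating π-system, and on them
both measures are known. -/
theorem IsC11Metric.map_tmMeasure (hg : IsC11Metric g) (hn : n ≠ 0) :
    Measure.map (fun z => (radial g z, gNorm g z.1 z.2)) (tmMeasure g)
      = (sigma g).prod (powMeasure n) := by
  have := hg.isFiniteMeasure_sigma
  have hmeas : AEMeasurable (fun z => (radial g z, gNorm g z.1 z.2)) (tmMeasure g) :=
    (hg.aemeasurable_radial.prodMk hg.aemeasurable_gNorm).mono_ac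
      (withDensity_absolutelyContinuous _ _)
  -- The half-lines have finite mass because the measure is carried by the positive axis.
  let sp : (powMeasure n).FiniteSpanningSetsIn (range Iio) :=
    { set := fun k => Iio (k : ℝ)
      set_mem := fun k => mem_range_self _
      finite := fun k => by rw [powMeasure_Iio hn]; exact ENNReal.ofReal_lt_top
      spanning := iUnion_eq_univ_iff.2 fun x => exists_nat_gt x }
  symm
  refine Measure.prod_eq_generateFrom MeasurableSpace.generateFrom_measurableSet
    ((borel_eq_generateFrom_Iio ℝ).symm.trans BorelSpace.measurable_eq.symm)
    MeasurableSpace.isPiSystem_measurableSet isPiSystem_Iio (sigma g).toFiniteSpanningSetsIn sp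
    fun A hA => forall_mem_range.2 fun t => ?_
  rw [Measure.map_apply_of_aemeasurable hmeas (MeasurableSet.prod hA measurableSet_Iio),
    powMeasure_Iio hn]
  rcases le_or_gt t 0 with h | h
  · have : (fun z => (radial g z, gNorm g z.1 z.2)) ⁻¹' A ×ˢ Iio t = ∅ := by
      ext z
      simp only [mem_preimage, mem_prod, mem_Iio, mem_empty_iff_false, iff_false, not_and, not_lt]
      exact fun _ => h.trans (Real.sqrt_nonneg _)
    rw [this, max_eq_right h]
    simp [hn]
  · rw [max_eq_left h.le]
    exact hg.tmMeasure_apply hn hA h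

/-- This brings identities down from the slit tangent bundle to SM: a homogeneous integrand is a
function on SM times a function of |v|, and its integral factors. -/
theorem IsC11Metric.integral_tm (hg : IsC11Metric g) (hn : n ≠ 0) {h : ℝ → ℝ} (hh : Measurable h)
    {G : Pt n × Pt n → ℝ} (hG : AEStronglyMeasurable G (sigma g)) :
    ∫ z in slitTM n, G (radial g z) * h (gNorm g z.1 z.2) * (g z.1).det
      = (∫ z, G z ∂(sigma g)) * ∫ s in Ioi (0 : ℝ), h s * s ^ (n - 1) := by
  have := hg.isFiniteMeasure_sigma
  have hsf : SFinite (powMeasure n) := by unfold powMeasure; infer_instance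
  have hmeas : AEMeasurable (fun z => (radial g z, gNorm g z.1 z.2)) (tmMeasure g) :=
    (hg.aemeasurable_radial.prodMk hg.aemeasurable_gNorm).mono_ac
      (withDensity_absolutelyContinuous _ _)
  have h1 := integral_prod_mul (μ := sigma g) (ν := powMeasure n) G h
  rw [← hg.map_tmMeasure hn, integral_map hmeas] at h1
  · rw [tmMeasure, powMeasure, integral_withDensity_eq_integral_toReal_smul₀ hg.aemeasurable_det
      (by simp), integral_withDensity_eq_integral_toReal_smul₀ (by fun_prop) (by simp)] at h1
    have e1 : ∫ z in slitTM n, G (radial g z) * h (gNorm g z.1 z.2) * (g z.1).det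
        = ∫ z in slitTM n, (ENNReal.ofReal (g z.1).det).toReal •
          (G (radial g z) * h (gNorm g z.1 z.2)) := by
      refine setIntegral_congr_fun measurableSet_slitTM fun z hz => ?_
      simp only [smul_eq_mul]
      rw [ENNReal.toReal_ofReal (hg.det_pos hz.1).le, mul_comm]
    have e2 : ∫ s in Ioi (0 : ℝ), h s * s ^ (n - 1)
        = ∫ s in Ioi (0 : ℝ), (ENNReal.ofReal (s ^ (n - 1))).toReal • h s := by
      refine setIntegral_congr_fun measurableSet_Ioi fun s hs => ?_
      simp only [smul_eq_mul]
      rw [ENNReal.toReal_ofReal (pow_nonneg (le_of_lt hs) _), mul_comm]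
    rw [e1, e2, h1]
  · rw [hg.map_tmMeasure hn]
    exact hG.comp_fst.mul (hh.aestronglyMeasurable.comp_snd)

/-- SM is Lebesgue null in ℝⁿ × ℝⁿ, so statements that hold Lebesgue almost everywhere reach it only
through the radial map. -/
theorem IsC11Metric.ae_of_ae_radial (hg : IsC11Metric g) {p : Pt n × Pt n → Prop}
    (hm : MeasurableSet {z | p z}) (hp : ∀ᵐ z, z ∈ slitTM n → p (radial g z)) :
    ∀ᵐ z ∂(sigma g), p z := by
  rw [ae_iff, show {z | ¬ p z} = {z | p z}ᶜ from rfl, hg.sigma_apply hm.compl]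
  have : volume {z | z ∈ slitTM n ∧ radial g z ∈ {z | p z}ᶜ ∧ gNorm g z.1 z.2 < 1} = 0 := by
    refine measure_mono_null ?_ hp
    rintro z ⟨h1, h2, -⟩ h3
    exact h2 (h3 h1)
  rw [Measure.restrict_eq_zero.2 this]
  simp

theorem nontrivial_Pt (hn : n ≠ 0) : Nontrivial (Pt n) := by
  have : Nonempty (Fin n) := ⟨⟨0, Nat.pos_of_ne_zero hn⟩⟩
  infer_instance

theorem volume_boundary (hn : n ≠ 0) : ∀ᵐ z : Pt n × Pt n, ‖z.1‖ ≠ 1 := by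
  have := nontrivial_Pt hn
  have h : ∀ᵐ x : Pt n, ‖x‖ ≠ 1 := by
    have := Measure.addHaar_sphere (volume : Measure (Pt n)) 0 1
    rw [ae_iff]
    simpa [Metric.sphere] using this
  exact Measure.quasiMeasurePreserving_fst.ae h

theorem IsC11Metric.ae_mem_SM (hg : IsC11Metric g) (hn : n ≠ 0) :
    ∀ᵐ z ∂(sigma g), z ∈ SM g ∧ z.1 ∈ Metric.ball (0 : Pt n) 1 := by
  refine hg.ae_of_ae_radial (hg.isCompact_SM.measurableSet.inter
    (Metric.isOpen_ball.preimage continuous_fst).measurableSet) ?_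
  filter_upwards [volume_boundary hn] with z hz hzs
  refine ⟨hg.radial_mem hzs, ?_⟩
  have h1 : ‖z.1‖ ≤ 1 := by simpa [M] using hzs.1
  rw [Metric.mem_ball, dist_zero_right]
  exact lt_of_le_of_ne h1 hz

end Geometry

end SimpleC11

namespace SimpleC11

/-! ### Horizontal lifts and their derivatives -/

section Lifts

variable {n : ℕ} {g : MetricField n}

/-- The vector `Γ^l_{jk} a^j b^k`. -/
noncomputable def chr (g : MetricField n) (x a b : Pt n) : Pt n :=
  WithLp.toLp 2 (fun l => ∑ j, ∑ k, christoffel g l j k x * a j * b k)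

/-- The vector `(∂_c Γ^l_{jk}) a^j b^k`. -/
noncomputable def dchr (g : MetricField n) (x c a b : Pt n) : Pt n :=
  WithLp.toLp 2 (fun l => ∑ j, ∑ k, fderiv ℝ (christoffel g l j k) x c * a j * b k)

/-- The horizontal lift of the tangent vector `a`. -/
noncomputable def hlift (g : MetricField n) (a : Pt n) (z : Pt n × Pt n) : Pt n × Pt n :=
  (a, -chr g z.1 a z.2)

theorem chr_apply (x a b : Pt n) (l : Fin n) :
    chr g x a b l = ∑ j, ∑ k, christoffel g l j k x * a j * b k := rfl

theorem dchr_apply (x c a b : Pt n) (l : Fin n) :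
    dchr g x c a b l = ∑ j, ∑ k, fderiv ℝ (christoffel g l j k) x c * a j * b k := rfl

theorem chr_add_left (x a a' b : Pt n) : chr g x (a + a') b = chr g x a b + chr g x a' b := by
  ext l
  simp [chr_apply, mul_add, add_mul, Finset.sum_add_distrib]

theorem chr_add_right (x a b b' : Pt n) : chr g x a (b + b') = chr g x a b + chr g x a b' := by
  ext l
  simp [chr_apply, mul_add, Finset.sum_add_distrib]

theorem chr_smul_left (x a b : Pt n) (t : ℝ) : chr g x (t • a) b = t • chr g x a b := by
  ext l
  simp only [chr_apply, PiLp.smul_apply, smul_eq_mul, Finset.mul_sum]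
  exact Finset.sum_congr rfl fun i _ => Finset.sum_congr rfl fun j _ => by ring

theorem chr_smul_right (x a b : Pt n) (t : ℝ) : chr g x a (t • b) = t • chr g x a b := by
  ext l
  simp only [chr_apply, PiLp.smul_apply, smul_eq_mul, Finset.mul_sum]
  exact Finset.sum_congr rfl fun i _ => Finset.sum_congr rfl fun j _ => by ring

theorem chr_neg_left (x a b : Pt n) : chr g x (-a) b = -chr g x a b := by
  simpa using chr_smul_left (g := g) x a b (-1)

theorem chr_neg_right (x a b : Pt n) : chr g x a (-b) = -chr g x a b := by
  simpa using chr_smul_right (g := g) x a b (-1)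

theorem chr_zero_left (x b : Pt n) : chr g x 0 b = 0 := by
  simpa using chr_smul_left (g := g) x 0 b 0

theorem IsC11Metric.chr_comm (hg : IsC11Metric g) {x : Pt n} (hx : x ∈ M n) (a b : Pt n) :
    chr g x a b = chr g x b a := by
  ext l
  rw [chr_apply, chr_apply, Finset.sum_comm]
  exact Finset.sum_congr rfl fun i _ => Finset.sum_congr rfl fun j _ => by
    rw [hg.christoffel_symm hx]; ring

theorem sum_mul_ite_e (f : Fin n → ℝ) (i : Fin n) : ∑ j, f j * (e i : Pt n) j = f i := by
  simp [e]

theorem chr_e_left (x b : Pt n) (j l : Fin n) :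
    chr g x (e j) b l = ∑ k, christoffel g l j k x * b k := by
  rw [chr_apply, Finset.sum_comm]
  refine Finset.sum_congr rfl fun k _ => ?_
  rw [← sum_mul_ite_e (fun j => christoffel g l j k x * b k) j]
  exact Finset.sum_congr rfl fun i _ => by ring

theorem chr_e_right (x a : Pt n) (k l : Fin n) :
    chr g x a (e k) l = ∑ j, christoffel g l j k x * a j := by
  rw [chr_apply]
  exact Finset.sum_congr rfl fun j _ => sum_mul_ite_e (fun k => christoffel g l j k x * a j) k

theorem sum_smul_chr_left (x a b : Pt n) : ∑ k, a k • chr g x (e k) b = chr g x a b := by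
  ext l
  rw [chr_apply]
  simp only [WithLp.ofLp_sum, WithLp.ofLp_smul, Finset.sum_apply, Pi.smul_apply, chr_e_left,
    smul_eq_mul, Finset.mul_sum]
  exact Finset.sum_congr rfl fun i _ => Finset.sum_congr rfl fun j _ => by ring

theorem sum_smul_dchr_middle (x c a b : Pt n) :
    ∑ k, a k • dchr g x c (e k) b = dchr g x c a b := by
  ext l
  rw [dchr_apply]
  simp only [WithLp.ofLp_sum, WithLp.ofLp_smul, Finset.sum_apply, Pi.smul_apply, smul_eq_mul,
    dchr_apply]
  refine Finset.sum_congr rfl fun i _ => ?_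
  rw [Finset.sum_comm, Finset.mul_sum]
  refine Finset.sum_congr rfl fun k _ => ?_
  have h2 : ∑ j, fderiv ℝ (christoffel g l j k) x c * (e i : Pt n) j * b k
      = fderiv ℝ (christoffel g l i k) x c * b k := by
    rw [← sum_mul_ite_e (fun j => fderiv ℝ (christoffel g l j k) x c * b k) i]
    exact Finset.sum_congr rfl fun j _ => by ring
  rw [h2]
  ring

theorem sum_smul_dchr_left (x c a b : Pt n) :
    ∑ k, c k • dchr g x (e k) a b = dchr g x c a b := by
  ext l
  rw [dchr_apply]
  simp only [WithLp.ofLp_sum, WithLp.ofLp_smul, Finset.sum_apply, Pi.smul_apply, smul_eq_mul,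
    dchr_apply, Finset.mul_sum]
  rw [Finset.sum_comm]
  refine Finset.sum_congr rfl fun i _ => ?_
  rw [Finset.sum_comm]
  refine Finset.sum_congr rfl fun j _ => ?_
  rw [clm_eq_sum (fderiv ℝ (christoffel g l i j) x) c]
  simp only [smul_eq_mul, Finset.sum_mul]
  exact Finset.sum_congr rfl fun k _ => by ring

theorem sum_smul_hlift (a : Pt n) (z : Pt n × Pt n) : ∑ k, a k • hlift g (e k) z = hlift g a z := by
  refine Prod.ext ?_ ?_
  · simp [hlift, Prod.fst_sum, sum_smul_e]
  · simp [hlift, Prod.snd_sum, sum_smul_chr_left]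

theorem spray_eq (z : Pt n × Pt n) : spray g z = hlift g z.2 z := by
  refine Prod.ext rfl ?_
  ext l
  simp [spray, hlift, chr]

/-! ### The operators as derivatives along vector fields, and their homogeneity in v. -/

section Operators

variable {F : Type*} [NormedAddCommGroup F] [NormedSpace ℝ F]

theorem clm_snd_eq_sum (T : Pt n × Pt n →L[ℝ] F) (b : Pt n) :
    T (0, b) = ∑ l, b l • T (0, e l) :=
  clm_eq_sum (T ∘L ContinuousLinearMap.inr ℝ (Pt n) (Pt n)) b

/-- With δ_j a derivative along a horizontal lift and X one along the spray, commutators of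
operators become Lie brackets of explicit fields. -/
theorem delta_eq (j : Fin n) (f : Pt n × Pt n → F) (z : Pt n × Pt n) :
    delta g j f z = dRadial g f z (hlift g (e j) z) := by
  have h : hlift g (e j) z = (e j, 0) - (0, chr g z.1 (e j) z.2) := by
    simp [hlift]
  rw [h, map_sub, clm_snd_eq_sum, delta]
  congr 1
  refine Finset.sum_congr rfl fun l _ => ?_
  rw [chr_e_left, Finset.sum_smul]
  rfl

theorem geoX_eq (f : Pt n × Pt n → F) (z : Pt n × Pt n) :
    geoX g f z = dRadial g f z (spray g z) := by
  simp only [geoX, delta_eq]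
  rw [spray_eq, ← sum_smul_hlift, map_sum]
  simp

theorem geoXN_eq (V : Pt n × Pt n → Pt n) (z : Pt n × Pt n) :
    geoXN g V z = geoX g V z + chr g z.1 z.2 (V z) := rfl

theorem partialV_eq (k : Fin n) (f : Pt n × Pt n → F) (z : Pt n × Pt n) :
    partialV g k f z = dRadial g f z (0, e k) := rfl

/-- The part of the slit tangent bundle over the interior. -/
def slitInt (n : ℕ) : Set (Pt n × Pt n) := Metric.ball 0 1 ×ˢ {0}ᶜ

theorem isOpen_slitInt : IsOpen (slitInt n) := Metric.isOpen_ball.prod isOpen_compl_singleton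

theorem slitInt_subset : slitInt n ⊆ slitTM n := fun _ hz => ⟨ball_subset_M hz.1, hz.2⟩

theorem slitTM_mem_nhds {z : Pt n × Pt n} (hz : z ∈ slitInt n) : slitTM n ∈ 𝓝 z :=
  mem_of_superset (isOpen_slitInt.mem_nhds hz) slitInt_subset

theorem dRadial_eq_fderiv (f : Pt n × Pt n → F) {z : Pt n × Pt n} (hz : z ∈ slitInt n) :
    dRadial g f z = fderiv ℝ (f ∘ radial g) z :=
  fderivWithin_of_mem_nhds (slitTM_mem_nhds hz)

theorem uniqueDiffOn_slitTM : UniqueDiffOn ℝ (slitTM n) :=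
  uniqueDiffOn_M.prod (isOpen_compl_singleton (x := (0 : Pt n))).uniqueDiffOn

/-- The extension f∘r is invariant under dilation of the fibres; this is the chain rule for that
dilation. -/
theorem dRadial_smul (f : Pt n × Pt n → F) {x v : Pt n} (hz : (x, v) ∈ slitTM n) {t : ℝ}
    (ht : 0 < t) (a b : Pt n) :
    dRadial g f (x, t • v) (a, t • b) = dRadial g f (x, v) (a, b) := by
  let S : (Pt n × Pt n) ≃L[ℝ] (Pt n × Pt n) :=
    (ContinuousLinearEquiv.refl ℝ (Pt n)).prodCongr
      (ContinuousLinearEquiv.smulLeft (Units.mk0 t ht.ne'))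
  have hS : ∀ z : Pt n × Pt n, S z = (z.1, t • z.2) := fun z => rfl
  have h1 : S ⁻¹' (slitTM n) = slitTM n := by
    ext z
    simp [hS, slitTM, ht.ne']
  have h2 : (f ∘ radial g) ∘ S = f ∘ radial g := by
    funext z
    simp [hS, radial_smul _ _ ht]
  have h3 := S.comp_right_fderivWithin (f := f ∘ radial g) (s := slitTM n) (x := (x, v))
    (by rw [h1]; exact uniqueDiffOn_slitTM _ hz)
  rw [h1, h2, hS] at h3
  rw [dRadial, dRadial, h3]
  rfl

theorem IsC11Metric.dRadial_radial (hg : IsC11Metric g) (f : Pt n × Pt n → F) {z : Pt n × Pt n}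
    (hz : z ∈ slitTM n) (a b : Pt n) :
    dRadial g f (radial g z) (a, b) = dRadial g f z (a, gNorm g z.1 z.2 • b) := by
  have hs := hg.gNorm_pos hz.1 hz.2
  have h := dRadial_smul (g := g) f (x := z.1) (v := (gNorm g z.1 z.2)⁻¹ • z.2)
    ⟨hz.1, smul_ne_zero (inv_ne_zero hs.ne') hz.2⟩ hs a b
  rw [smul_smul, mul_inv_cancel₀ hs.ne', one_smul] at h
  exact h.symm

/-- Applied to f∘r, the operators ∂_k, δ_j and X give functions homogeneous in v of degrees -1, 0
and 1. These degrees fix the powers of |v| in every integral identity below. -/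
theorem IsC11Metric.partialV_radial (hg : IsC11Metric g) (f : Pt n × Pt n → F) {z : Pt n × Pt n}
    (hz : z ∈ slitTM n) (k : Fin n) :
    partialV g k f (radial g z) = gNorm g z.1 z.2 • partialV g k f z := by
  rw [partialV_eq, hg.dRadial_radial f hz, partialV_eq, ← map_smul]
  simp

theorem IsC11Metric.delta_radial (hg : IsC11Metric g) (f : Pt n × Pt n → F) {z : Pt n × Pt n}
    (hz : z ∈ slitTM n) (j : Fin n) :
    delta g j f (radial g z) = delta g j f z := by
  have hs := hg.gNorm_pos hz.1 hz.2
  rw [delta_eq, delta_eq, hlift, hg.dRadial_radial f hz]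
  simp only [radial, chr_smul_right, smul_neg, smul_smul, mul_inv_cancel₀ hs.ne', one_smul]
  rfl

theorem IsC11Metric.geoX_radial (hg : IsC11Metric g) (f : Pt n × Pt n → F) {z : Pt n × Pt n}
    (hz : z ∈ slitTM n) :
    geoX g f (radial g z) = (gNorm g z.1 z.2)⁻¹ • geoX g f z := by
  simp only [geoX, hg.delta_radial f hz, Finset.smul_sum, smul_smul]
  rfl

end Operators

/-! ### Metric compatibility -/

theorem IsC11Metric.sum_fderiv_g (hg : IsC11Metric g) {x : Pt n} (hx : x ∈ M n) (c a b : Pt n) :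
    ∑ i, ∑ j, fderivWithin ℝ (fun y => g y i j) (M n) x c * a i * b j
      = gInner g x (chr g x c a) b + gInner g x a (chr g x c b) := by
  have h1 : ∀ i j, fderivWithin ℝ (fun y => g y i j) (M n) x c
      = ∑ k, c k * (∑ l, g x l j * christoffel g l k i x + ∑ l, g x i l * christoffel g l k j x) := by
    intro i j
    rw [clm_eq_sum]
    refine Finset.sum_congr rfl fun k _ => ?_
    rw [smul_eq_mul, ← hg.partialX_eq hx i j k]
    rfl
  simp only [h1, mul_add, Finset.sum_add_distrib, add_mul]
  congr 1
  · simp only [gInner, chr_apply, Finset.mul_sum, Finset.sum_mul]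
    have e1 : ∀ i j : Fin n, ∑ k, ∑ l, c k * (g x l j * christoffel g l k i x) * a i * b j
        = ∑ l, ∑ k, c k * (g x l j * christoffel g l k i x) * a i * b j := fun i j =>
      Finset.sum_comm
    simp only [e1]
    rw [Finset.sum_congr rfl fun i _ => Finset.sum_comm, Finset.sum_comm]
    refine Finset.sum_congr rfl fun l _ => ?_
    rw [Finset.sum_comm]
    refine Finset.sum_congr rfl fun j _ => ?_
    rw [Finset.sum_comm]
    exact Finset.sum_congr rfl fun k _ => Finset.sum_congr rfl fun i _ => by ring
  · simp only [gInner, chr_apply, Finset.mul_sum]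
    refine Finset.sum_congr rfl fun i _ => ?_
    simp only [Finset.sum_mul]
    have e1 : ∀ j : Fin n, ∑ k, ∑ l, c k * (g x i l * christoffel g l k j x) * a i * b j
        = ∑ l, ∑ k, c k * (g x i l * christoffel g l k j x) * a i * b j := fun j =>
      Finset.sum_comm
    simp only [e1]
    rw [Finset.sum_comm]
    refine Finset.sum_congr rfl fun l _ => ?_
    rw [Finset.sum_comm]
    exact Finset.sum_congr rfl fun k _ => Finset.sum_congr rfl fun j _ => by ring

/-- Metric compatibility turns the derivatives of g_{ij} into Christoffel terms, which complete the
derivatives of P and R to covariant ones. -/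
theorem IsC11Metric.fderiv_gInner (hg : IsC11Metric g) {z : Pt n × Pt n}
    (hz : z.1 ∈ Metric.ball (0 : Pt n) 1) {P R : Pt n × Pt n → Pt n}
    (hP : DifferentiableAt ℝ P z) (hR : DifferentiableAt ℝ R z) :
    DifferentiableAt ℝ (fun y : Pt n × Pt n => gInner g y.1 (P y) (R y)) z ∧ ∀ p,
    fderiv ℝ (fun y : Pt n × Pt n => gInner g y.1 (P y) (R y)) z p
      = gInner g z.1 (chr g z.1 p.1 (P z) + fderiv ℝ P z p) (R z)
        + gInner g z.1 (P z) (chr g z.1 p.1 (R z) + fderiv ℝ R z p) := by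
  have hc : ∀ {P : Pt n × Pt n → Pt n}, DifferentiableAt ℝ P z → ∀ i,
      HasFDerivAt (fun y => P y i) (EuclideanSpace.proj i ∘L fderiv ℝ P z) z := fun hP i =>
    (EuclideanSpace.proj i : Pt n →L[ℝ] ℝ).hasFDerivAt.comp z hP.hasFDerivAt
  have hgd : ∀ i j, HasFDerivAt (fun y : Pt n × Pt n => g y.1 i j)
      (fderivWithin ℝ (fun y => g y i j) (M n) z.1 ∘L ContinuousLinearMap.fst ℝ _ _) z := fun i j =>
    (hg.hasFDerivAt hz i j).comp z hasFDerivAt_fst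
  have h := HasFDerivAt.fun_sum (u := Finset.univ) fun i _ => HasFDerivAt.fun_sum
    (u := Finset.univ) fun j _ => ((hgd i j).fun_mul (hc hP i)).fun_mul (hc hR j)
  refine ⟨h.differentiableAt, fun p => ?_⟩
  have h' := h.fderiv
  unfold gInner at *
  rw [h']
  have h2 := hg.sum_fderiv_g (ball_subset_M hz) p.1 (P z) (R z)
  have h3 : ∀ a b c : Pt n, gInner g z.1 (a + b) c = gInner g z.1 a c + gInner g z.1 b c :=
    fun a b c => gInner_add_left _ _ _ _
  have h4 : ∀ a b c : Pt n, gInner g z.1 a (b + c) = gInner g z.1 a b + gInner g z.1 a c :=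
    fun a b c => gInner_add_right _ _ _ _
  unfold gInner at h2 h3 h4
  rw [h3, h4]
  have h5 : ∀ a b c d : ℝ, a + b + (c + d) = (a + c) + b + d := fun a b c d => by ring
  rw [h5, ← h2]
  simp only [sum_apply, add_apply,
    smul_apply, ContinuousLinearMap.comp_apply, smul_eq_mul,
    ← Finset.sum_add_distrib]
  refine Finset.sum_congr rfl fun i _ => Finset.sum_congr rfl fun j _ => ?_
  simp
  ring

/-! ### The derivatives of the lifts -/

/-- The Christoffel symbols are differentiable at `x`. -/
def ChrDiffAt (g : MetricField n) (x : Pt n) : Prop :=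
  ∀ l j k, DifferentiableAt ℝ (christoffel g l j k) x

theorem differentiableAt_toLp {E : Type*} [NormedAddCommGroup E] [NormedSpace ℝ E]
    {f : Fin n → E → ℝ} {z : E} (hf : ∀ i, DifferentiableAt ℝ (f i) z) :
    DifferentiableAt ℝ (fun y => (WithLp.toLp 2 (fun i => f i y) : Pt n)) z ∧ ∀ p i,
      (fderiv ℝ (fun y => (WithLp.toLp 2 (fun i => f i y) : Pt n)) z p) i = fderiv ℝ (f i) z p := by
  have h : DifferentiableAt ℝ (fun y => (WithLp.toLp 2 (fun i => f i y) : Pt n)) z :=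
    differentiableAt_euclidean.2 hf
  refine ⟨h, fun p i => ?_⟩
  have := ((EuclideanSpace.proj i : Pt n →L[ℝ] ℝ).hasFDerivAt.comp z h.hasFDerivAt).fderiv
  have h2 : fderiv ℝ (f i) z = EuclideanSpace.proj i ∘L
      fderiv ℝ (fun y => (WithLp.toLp 2 (fun i => f i y) : Pt n)) z := this
  rw [h2]
  rfl

theorem ChrDiffAt.fderiv_chr {z : Pt n × Pt n} (h : ChrDiffAt g z.1) (A B : Pt n × Pt n → Pt n)
    (hA : DifferentiableAt ℝ A z) (hB : DifferentiableAt ℝ B z) :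
    DifferentiableAt ℝ (fun y : Pt n × Pt n => chr g y.1 (A y) (B y)) z ∧ ∀ p,
    fderiv ℝ (fun y : Pt n × Pt n => chr g y.1 (A y) (B y)) z p
      = dchr g z.1 p.1 (A z) (B z) + chr g z.1 (fderiv ℝ A z p) (B z)
        + chr g z.1 (A z) (fderiv ℝ B z p) := by
  have hc : ∀ {P : Pt n × Pt n → Pt n}, DifferentiableAt ℝ P z → ∀ i,
      HasFDerivAt (fun y => P y i) (EuclideanSpace.proj i ∘L fderiv ℝ P z) z := fun hP i =>
    (EuclideanSpace.proj i : Pt n →L[ℝ] ℝ).hasFDerivAt.comp z hP.hasFDerivAt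
  have hgd : ∀ l i j, HasFDerivAt (fun y : Pt n × Pt n => christoffel g l i j y.1)
      (fderiv ℝ (christoffel g l i j) z.1 ∘L ContinuousLinearMap.fst ℝ _ _) z := fun l i j =>
    (h l i j).hasFDerivAt.comp z hasFDerivAt_fst
  have hd := fun l => HasFDerivAt.fun_sum (u := Finset.univ) fun i _ => HasFDerivAt.fun_sum
    (u := Finset.univ) fun j _ => ((hgd l i j).fun_mul (hc hA i)).fun_mul (hc hB j)
  obtain ⟨h1, h2⟩ := differentiableAt_toLp fun l => (hd l).differentiableAt
  refine ⟨h1, fun p => ?_⟩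
  ext l
  have h3 := h2 p l
  unfold chr
  rw [h3, (hd l).fderiv]
  simp only [WithLp.ofLp_add, Pi.add_apply, dchr_apply, sum_apply,
    add_apply, smul_apply, ContinuousLinearMap.comp_apply,
    smul_eq_mul, ← Finset.sum_add_distrib]
  refine Finset.sum_congr rfl fun i _ => Finset.sum_congr rfl fun j _ => ?_
  simp
  ring

theorem ChrDiffAt.fderiv_spray {z : Pt n × Pt n} (h : ChrDiffAt g z.1) :
    ∀ p, fderiv ℝ (spray g) z p = (p.2, -(dchr g z.1 p.1 z.2 z.2 + chr g z.1 p.2 z.2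
      + chr g z.1 z.2 p.2)) := by
  intro p
  obtain ⟨h1, h2⟩ := h.fderiv_chr Prod.snd Prod.snd differentiableAt_snd differentiableAt_snd
  have h3 : spray g = fun y => (y.2, -chr g y.1 y.2 y.2) := by
    funext y
    rw [spray_eq, hlift]
  rw [h3, (hasFDerivAt_snd.prodMk h1.hasFDerivAt.fun_neg).fderiv]
  have h4 := h2 p
  rw [fderiv_snd] at h4
  simp only [ContinuousLinearMap.prod_apply, neg_apply, h4]
  rfl

theorem ChrDiffAt.fderiv_hlift {z : Pt n × Pt n} (h : ChrDiffAt g z.1) (a : Pt n) :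
    ∀ p, fderiv ℝ (hlift g a) z p = (0, -(dchr g z.1 p.1 a z.2 + chr g z.1 a p.2)) := by
  intro p
  obtain ⟨h1, h2⟩ := h.fderiv_chr (fun _ => a) Prod.snd (differentiableAt_const a)
    differentiableAt_snd
  have h3 : hlift g a = fun y => (a, -chr g y.1 a y.2) := rfl
  rw [h3, ((hasFDerivAt_const a z).prodMk h1.hasFDerivAt.fun_neg).fderiv]
  have h4 := h2 p
  rw [fderiv_snd, fderiv_fun_const] at h4
  simp only [ContinuousLinearMap.prod_apply, neg_apply, h4, Pi.zero_apply,
    zero_apply, chr_zero_left, add_zero]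
  rfl

end Lifts

end SimpleC11

namespace SimpleC11

/-! ### Weights and divergences on the tangent bundle -/

section Weights

variable {n : ℕ} {g : MetricField n}

instance isAddHaarMeasure_volume_prod :
    (volume : Measure (Pt n × Pt n)).IsAddHaarMeasure :=
  inferInstanceAs ((volume : Measure (Pt n)).prod (volume : Measure (Pt n))).IsAddHaarMeasure

/-- The coordinate frame of `ℝⁿ × ℝⁿ`. -/
noncomputable def frE : Fin n ⊕ Fin n → Pt n × Pt n :=
  Sum.elim (fun j => (e j, 0)) (fun j => (0, e j))

/-- The coordinate functions of `ℝⁿ × ℝⁿ`. -/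
noncomputable def frL : Fin n ⊕ Fin n → Pt n × Pt n →L[ℝ] ℝ :=
  Sum.elim (fun j => EuclideanSpace.proj j ∘L ContinuousLinearMap.fst ℝ (Pt n) (Pt n))
    (fun j => EuclideanSpace.proj j ∘L ContinuousLinearMap.snd ℝ (Pt n) (Pt n))

theorem sum_frL_smul (z : Pt n × Pt n) : ∑ i, frL i z • (frE i : Pt n × Pt n) = z := by
  rw [Fintype.sum_sum_type]
  refine Prod.ext ?_ ?_
  · simp [frL, frE, Prod.fst_sum, sum_smul_e]
  · simp [frL, frE, Prod.snd_sum, sum_smul_e]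

theorem divFrame_eq (Y : Pt n × Pt n → Pt n × Pt n) (z : Pt n × Pt n) :
    divFrame frE frL Y z = ∑ j, (fderiv ℝ Y z (e j, 0)).1 j + ∑ j, (fderiv ℝ Y z (0, e j)).2 j := by
  rw [divFrame, Fintype.sum_sum_type]
  rfl

theorem sum_chr_e (x a : Pt n) : ∑ i, chr g x a (e i) i = ∑ k, a k * trChr g k x := by
  simp only [chr_e_right, trChr, Finset.mul_sum]
  rw [Finset.sum_comm]
  exact Finset.sum_congr rfl fun i _ => Finset.sum_congr rfl fun j _ => by ring

theorem ChrDiffAt.div_spray (hg : IsC11Metric g) {z : Pt n × Pt n} (hz : z.1 ∈ M n)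
    (h : ChrDiffAt g z.1) :
    divFrame frE frL (spray g) z = -(2 * ∑ k, z.2 k * trChr g k z.1) := by
  simp only [divFrame_eq, h.fderiv_spray]
  have h1 : ∀ j, chr g z.1 (e j) z.2 = chr g z.1 z.2 (e j) := fun j => hg.chr_comm hz _ _
  have h2 : ∀ j, dchr g z.1 0 z.2 z.2 j = 0 := fun j => by simp [dchr_apply]
  simp only [WithLp.ofLp_zero, Pi.zero_apply, Finset.sum_const_zero, zero_add, WithLp.ofLp_neg,
    Pi.neg_apply, WithLp.ofLp_add, Pi.add_apply, h1, h2, Finset.sum_neg_distrib,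
    Finset.sum_add_distrib, sum_chr_e]
  ring

theorem ChrDiffAt.div_hlift {z : Pt n × Pt n} (h : ChrDiffAt g z.1) (a : Pt n) :
    divFrame frE frL (hlift g a) z = -∑ k, a k * trChr g k z.1 := by
  simp only [divFrame_eq, h.fderiv_hlift]
  have h2 : ∀ j, dchr g z.1 0 a z.2 j = 0 := fun j => by simp [dchr_apply]
  simp only [WithLp.ofLp_zero, Pi.zero_apply, Finset.sum_const_zero, zero_add, WithLp.ofLp_neg,
    Pi.neg_apply, WithLp.ofLp_add, Pi.add_apply, h2, Finset.sum_neg_distrib, sum_chr_e]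

theorem div_const (c z : Pt n × Pt n) : divFrame frE frL (fun _ => c) z = 0 := by
  simp [divFrame]

/-- The weight `φ(|v|²) det g`. -/
noncomputable def weight (g : MetricField n) (φ : ℝ → ℝ) (z : Pt n × Pt n) : ℝ :=
  φ (gInner g z.1 z.2 z.2) * (g z.1).det

variable {φ : ℝ → ℝ}

theorem IsC11Metric.contDiffOn_weight (hg : IsC11Metric g) (hφ : ContDiff ℝ 1 φ) :
    ContDiffOn ℝ 1 (weight g φ) (slitTM n) :=
  (hφ.comp_contDiffOn (hg.contDiffOn_gInner contDiffOn_fst (fun _ hz => hz.1) contDiffOn_snd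
    contDiffOn_snd)).mul hg.contDiffOn_det_fst

theorem IsC11Metric.fderiv_weight (hg : IsC11Metric g) (hφ : ContDiff ℝ 1 φ) {z : Pt n × Pt n}
    (hz : z.1 ∈ Metric.ball (0 : Pt n) 1) :
    DifferentiableAt ℝ (weight g φ) z ∧ ∀ p, fderiv ℝ (weight g φ) z p
      = deriv φ (gInner g z.1 z.2 z.2) * (2 * gInner g z.1 (chr g z.1 p.1 z.2 + p.2) z.2)
          * (g z.1).det
        + weight g φ z * (2 * ∑ k, p.1 k * trChr g k z.1) := by
  have hzM := ball_subset_M hz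
  obtain ⟨h1, h2⟩ := hg.fderiv_gInner hz (P := Prod.snd) (R := Prod.snd) differentiableAt_snd
    differentiableAt_snd
  have h3 : HasFDerivAt (fun y : Pt n × Pt n => (g y.1).det)
      (fderiv ℝ (fun y => (g y).det) z.1 ∘L ContinuousLinearMap.fst ℝ _ _) z :=
    (hasFDerivAt_det fun i j => hg.hasFDerivAt hz i j).differentiableAt.hasFDerivAt.comp z
      hasFDerivAt_fst
  have h4 := (((hφ.differentiable one_ne_zero _).hasDerivAt.comp_hasFDerivAt z
    h1.hasFDerivAt).fun_mul h3)
  refine ⟨h4.differentiableAt, fun p => ?_⟩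
  have h5 : fderiv ℝ (fun y => (g y).det) z.1 p.1
      = 2 * (g z.1).det * ∑ k, p.1 k * trChr g k z.1 := by
    rw [clm_eq_sum, Finset.mul_sum]
    refine Finset.sum_congr rfl fun k _ => ?_
    rw [hg.fderiv_det hz, smul_eq_mul]
    ring
  have h6 := h4.fderiv
  have h7 : weight g φ = fun y => (φ ∘ fun y : Pt n × Pt n => gInner g y.1 y.2 y.2) y
      * (g y.1).det := rfl
  have h8 := h2 p
  rw [fderiv_snd] at h8
  rw [h7, h6]
  simp only [add_apply, smul_apply, ContinuousLinearMap.comp_apply, ContinuousLinearMap.coe_fst',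
    h5, smul_eq_mul, h8, Function.comp]
  simp only [ContinuousLinearMap.coe_snd']
  rw [hg.gInner_comm hzM z.2 (chr g z.1 p.1 z.2 + p.2)]
  ring

/-- Parallel transport preserves |v|, so a horizontal lift differentiates only the factor det g. -/
theorem IsC11Metric.fderiv_weight_hlift (hg : IsC11Metric g) (hφ : ContDiff ℝ 1 φ)
    {z : Pt n × Pt n} (hz : z.1 ∈ Metric.ball (0 : Pt n) 1) (a : Pt n) :
    fderiv ℝ (weight g φ) z (hlift g a z) = weight g φ z * (2 * ∑ k, a k * trChr g k z.1) := by
  rw [(hg.fderiv_weight hφ hz).2, hlift]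
  simp [gInner_zero_left]

theorem IsC11Metric.fderiv_weight_snd (hg : IsC11Metric g) (hφ : ContDiff ℝ 1 φ)
    {z : Pt n × Pt n} (hz : z.1 ∈ Metric.ball (0 : Pt n) 1) (b : Pt n) :
    fderiv ℝ (weight g φ) z (0, b)
      = 2 * deriv φ (gInner g z.1 z.2 z.2) * gInner g z.1 b z.2 * (g z.1).det := by
  rw [(hg.fderiv_weight hφ hz).2]
  simp only [chr_zero_left, zero_add, PiLp.zero_apply, zero_mul, Finset.sum_const_zero, mul_zero,
    add_zero]
  ring

/-- Liouville's theorem: the geodesic flow preserves |v|² and the measure det g dx dv. The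
Christoffel trace from the divergence of the spray, taken twice, cancels the derivative of det g. -/
theorem IsC11Metric.weight_div_spray (hg : IsC11Metric g) (hφ : ContDiff ℝ 1 φ)
    {z : Pt n × Pt n} (hz : z.1 ∈ Metric.ball (0 : Pt n) 1) (h : ChrDiffAt g z.1) :
    weight g φ z * divFrame frE frL (spray g) z + fderiv ℝ (weight g φ) z (spray g z) = 0 := by
  rw [h.div_spray hg (ball_subset_M hz), spray_eq, hg.fderiv_weight_hlift hφ hz]
  ring

/-- A horizontal lift has one trace from its divergence against two from det g. The trace left over
is the zero-order term in the definition of div^h. -/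
theorem IsC11Metric.weight_div_hlift (hg : IsC11Metric g) (hφ : ContDiff ℝ 1 φ)
    {z : Pt n × Pt n} (hz : z.1 ∈ Metric.ball (0 : Pt n) 1) (h : ChrDiffAt g z.1) (j : Fin n) :
    weight g φ z * divFrame frE frL (hlift g (e j)) z
      + fderiv ℝ (weight g φ) z (hlift g (e j) z) = weight g φ z * trChr g j z.1 := by
  have h1 : ∑ k, (e j : Pt n) k * trChr g k z.1 = trChr g j z.1 := by
    rw [← sum_mul_ite_e (fun k => trChr g k z.1) j]
    refine Finset.sum_congr rfl fun k _ => ?_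
    simp [e, eq_comm]
  rw [h.div_hlift, hg.fderiv_weight_hlift hφ hz, h1]
  ring

/-! ### Locally Lipschitz functions on the sphere bundle, and supports -/

/-- The radial extension is locally Lipschitz over the interior. -/
def LipSM {F : Type*} [PseudoMetricSpace F] (g : MetricField n) (f : Pt n × Pt n → F) : Prop :=
  LocallyLipschitzOn (slitInt n) (f ∘ radial g)

/-- The function vanishes near the boundary of `M`. -/
def XSupp {F : Type*} [Zero F] (f : Pt n × Pt n → F) : Prop :=
  ∃ r < (1 : ℝ), ∀ z, r < ‖z.1‖ → f z = 0

/-- A lower and an upper bound on |v|_g keep v in a compact set away from zero, since g is uniformly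
equivalent to the Euclidean metric; the bound r < 1 keeps x off the boundary. -/
theorem IsC11Metric.exists_compact (hg : IsC11Metric g) {r : ℝ} (hr : r < 1) {α β : ℝ} (hα : 0 < α)
    (hφ : ∀ t ∉ Icc α β, φ t = 0) : ∃ K : Set (Pt n × Pt n), IsCompact K ∧ K ⊆ slitInt n ∧
      ∀ z ∉ K, ‖z.1‖ ≤ r → weight g φ z = 0 := by
  obtain ⟨c, hc, h⟩ := hg.exists_lower_bound
  obtain ⟨C, hC, h'⟩ := hg.exists_upper_bound
  refine ⟨(Metric.closedBall 0 r) ×ˢ (Metric.closedBall 0 (Real.sqrt (β / c)) \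
      {v | ‖v‖ ^ 2 * (C + 1) < α}),
    (isCompact_closedBall _ _).prod ((isCompact_closedBall _ _).diff
      (isOpen_lt (by fun_prop) continuous_const)), ?_, ?_⟩
  · rintro z ⟨h1, -, h3⟩
    refine ⟨Metric.closedBall_subset_ball hr h1, fun h0 => h3 ?_⟩
    rw [mem_singleton_iff.1 h0]
    simpa using hα
  · intro z hz hzr
    have hzM : z.1 ∈ M n := by simpa [M] using hzr.trans hr.le
    have h1 := h z.1 hzM z.2
    have h2 := h' z.1 hzM z.2 z.2
    rw [weight, hφ, zero_mul]
    rintro ⟨hα', hβ'⟩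
    refine hz ⟨by simpa using hzr, ?_, ?_⟩
    · rw [mem_closedBall_zero_iff]
      refine Real.le_sqrt_of_sq_le ?_
      rw [le_div_iff₀ hc]
      linarith
    · simp only [mem_ofPred_eq, not_lt]
      have := le_abs_self (gInner g z.1 z.2 z.2)
      nlinarith [sq_nonneg ‖z.2‖]

theorem fderiv_eq_zero_of_notMem {E F : Type*} [NormedAddCommGroup E] [NormedSpace ℝ E]
    [NormedAddCommGroup F] [NormedSpace ℝ F] {w : E → F} {K : Set E} (hK : IsClosed K)
    (hw : ∀ z ∉ K, w z = 0) {z : E} (hz : z ∉ K) : fderiv ℝ w z = 0 := by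
  have : w =ᶠ[𝓝 z] fun _ => 0 := by
    filter_upwards [hK.isOpen_compl.mem_nhds hz] with y hy
    exact hw y hy
  rw [this.fderiv_eq, fderiv_fun_const]
  rfl

theorem IsC11Metric.ae_chrDiffAt (hg : IsC11Metric g) :
    ∀ᵐ z : Pt n × Pt n, z ∈ slitInt n → ChrDiffAt g z.1 := by
  have h : ∀ᵐ x : Pt n, x ∈ Metric.ball (0 : Pt n) 1 → ChrDiffAt g x := by
    have : ∀ l j k, ∀ᵐ x : Pt n, x ∈ Metric.ball (0 : Pt n) 1 →
        DifferentiableAt ℝ (christoffel g l j k) x := fun l j k =>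
      ae_differentiableAt_of_locallyLipschitzOn volume Metric.isOpen_ball
        ((hg.locallyLipschitzOn_christoffel l j k).mono ball_subset_M)
    filter_upwards [ae_all_iff.2 fun l => ae_all_iff.2 fun j => ae_all_iff.2 fun k => this l j k]
      with x hx hxb l j k
    exact hx l j k hxb
  filter_upwards [Measure.quasiMeasurePreserving_fst.ae h] with z hz hzO
  exact hz hzO.1

theorem LipSM.ae_differentiableAt {F : Type*} [NormedAddCommGroup F] [NormedSpace ℝ F]
    [FiniteDimensional ℝ F] {f : Pt n × Pt n → F} (hf : LipSM g f) :
    ∀ᵐ z : Pt n × Pt n, z ∈ slitInt n → DifferentiableAt ℝ (f ∘ radial g) z :=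
  ae_differentiableAt_of_locallyLipschitzOn volume isOpen_slitInt hf

/-- If a function with zero integral on the slit bundle splits almost everywhere into an angular and
a radial factor, one of the two integrals must vanish. -/
theorem IsC11Metric.integral_mul_eq_zero (hg : IsC11Metric g) (hn : n ≠ 0)
    {f : Pt n × Pt n → ℝ} (hf : HasZeroIntegral volume f) {h : ℝ → ℝ} (hh : Measurable h)
    {G : Pt n × Pt n → ℝ} (hG : AEStronglyMeasurable G (sigma g))
    (hz : ∀ᵐ z : Pt n × Pt n, z ∈ slitInt n →
      f z = G (radial g z) * h (gNorm g z.1 z.2) * (g z.1).det)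
    (h0 : ∀ z ∉ slitInt n, f z = 0) :
    (∫ z, G z ∂(sigma g)) * ∫ s in Ioi (0 : ℝ), h s * s ^ (n - 1) = 0 := by
  rw [← hg.integral_tm hn hh hG, ← hf.2, ← setIntegral_eq_integral_of_forall_compl_eq_zero
    (s := slitTM n) (f := f) fun z hzs => h0 z fun h => hzs (slitInt_subset h)]
  refine setIntegral_congr_ae measurableSet_slitTM ?_
  filter_upwards [hz, volume_boundary hn] with z h1 h2 h3
  refine (h1 ⟨?_, h3.2⟩).symm
  have : ‖z.1‖ ≤ 1 := by simpa [M] using h3.1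
  rw [Metric.mem_ball, dist_zero_right]
  exact lt_of_le_of_ne this h2

/-! ### A fixed weight -/

/-- A smooth bump function on the line, supported in `[1, 3]`. -/
noncomputable def phi : ℝ → ℝ := (⟨1 / 2, 1, by norm_num, by norm_num⟩ : ContDiffBump (2 : ℝ))

theorem contDiff_phi : ContDiff ℝ 1 phi := ContDiffBump.contDiff _

theorem phi_nonneg (t : ℝ) : 0 ≤ phi t := ContDiffBump.nonneg _

theorem phi_pos {t : ℝ} (ht : t ∈ Ioo (1 : ℝ) 3) : 0 < phi t := by
  refine ContDiffBump.pos_of_mem_ball _ ?_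
  rw [Real.ball_eq_Ioo]
  norm_num
  exact ht

theorem phi_zero : ∀ t ∉ Icc (1 : ℝ) 3, phi t = 0 := by
  intro t ht
  refine ContDiffBump.zero_of_le_dist _ ?_
  by_contra h
  push Not at h
  rw [← Metric.mem_ball, Real.ball_eq_Ioo] at h
  norm_num at h
  exact ht ⟨h.1.le, h.2.le⟩

theorem phi_sq_zero {s : ℝ} (hs : 2 ≤ s) : phi (s ^ 2) = 0 := by
  refine phi_zero _ fun h => ?_
  have := h.2
  nlinarith

theorem integral_Ioi_eq_interval {f : ℝ → ℝ} (hf : ∀ s, 2 ≤ s → f s = 0) :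
    ∫ s in Ioi (0 : ℝ), f s = ∫ s in (0 : ℝ)..2, f s := by
  rw [intervalIntegral.integral_of_le (by norm_num)]
  refine (setIntegral_eq_of_subset_of_forall_sdiff_eq_zero measurableSet_Ioi
    Ioc_subset_Ioi_self fun s hs => hf s ?_)
  by_contra h
  push Not at h
  exact hs.2 ⟨hs.1, h.le⟩

theorem integral_phi_pos (m : ℕ) : 0 < ∫ s in Ioi (0 : ℝ), phi (s ^ 2) * s ^ m := by
  have hc : Continuous fun s : ℝ => phi (s ^ 2) * s ^ m :=
    (contDiff_phi.continuous.comp (continuous_pow 2)).mul (continuous_pow m)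
  rw [integral_Ioi_eq_interval fun s hs => by rw [phi_sq_zero hs, zero_mul]]
  -- The point s = 3/2 has s² = 9/4 inside (1, 3), where the bump function is positive.
  refine intervalIntegral.integral_pos (by norm_num) hc.continuousOn (fun s hs => ?_)
    ⟨3 / 2, by norm_num, ?_⟩
  · exact mul_nonneg (phi_nonneg _) (pow_nonneg hs.1.le _)
  · exact mul_pos (phi_pos (by norm_num)) (by positivity)

end Weights

end SimpleC11

namespace SimpleC11

/-! ### Measurability -/

section Measurability

variable {n : ℕ} {g : MetricField n}

theorem IsC11Metric.aestronglyMeasurable_of_continuousOn (hg : IsC11Metric g) (hn : n ≠ 0)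
    {F : Type*} [TopologicalSpace F] [TopologicalSpace.PseudoMetrizableSpace F]
    [SecondCountableTopologyEither (Pt n × Pt n) F]
    {c : Pt n × Pt n → F} (hc : ContinuousOn c (SM g)) : AEStronglyMeasurable c (sigma g) := by
  have h := hc.aestronglyMeasurable (μ := sigma g) hg.isCompact_SM.measurableSet
  rwa [Measure.restrict_eq_self_of_ae_mem
    ((hg.ae_mem_SM hn).mono fun z hz => hz.1)] at h

theorem IsC11Metric.continuousOn_christoffel (hg : IsC11Metric g) (l j k : Fin n) :
    ContinuousOn (fun z : Pt n × Pt n => christoffel g l j k z.1) (SM g) :=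
  (hg.locallyLipschitzOn_christoffel l j k).continuousOn.comp continuousOn_fst fun _ hz => hz.1

theorem IsC11Metric.continuousOn_inv (hg : IsC11Metric g) (i j : Fin n) :
    ContinuousOn (fun z : Pt n × Pt n => (g z.1)⁻¹ i j) (SM g) :=
  (hg.contDiffOn_inv i j).continuousOn.comp continuousOn_fst fun _ hz => hz.1

theorem IsC11Metric.ae_mem_slitInt (hg : IsC11Metric g) (hn : n ≠ 0) :
    ∀ᵐ z ∂(sigma g), z ∈ slitInt n :=
  (hg.ae_mem_SM hn).mono fun _ hz => ⟨hz.2, ne_zero_of_mem_SM hz.1⟩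

theorem IsC11Metric.aestronglyMeasurable_dRadial (hg : IsC11Metric g) (hn : n ≠ 0)
    (f : Pt n × Pt n → ℝ) (p : Pt n × Pt n) :
    AEStronglyMeasurable (fun z => dRadial g f z p) (sigma g) := by
  refine ((measurable_fderiv_apply_const ℝ (f ∘ radial g) p).aestronglyMeasurable
    (μ := sigma g)).congr ?_
  filter_upwards [hg.ae_mem_slitInt hn] with z hz
  rw [dRadial_eq_fderiv f hz]

theorem IsC11Metric.aestronglyMeasurable_partialV (hg : IsC11Metric g) (hn : n ≠ 0) (k : Fin n)
    (f : Pt n × Pt n → ℝ) : AEStronglyMeasurable (partialV g k f) (sigma g) :=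
  hg.aestronglyMeasurable_dRadial hn f _

theorem aestronglyMeasurable_snd_apply {μ : Measure (Pt n × Pt n)} (j : Fin n) :
    AEStronglyMeasurable (fun z : Pt n × Pt n => z.2 j) μ :=
  ((PiLp.continuous_apply 2 _ j).comp continuous_snd).aestronglyMeasurable

theorem IsC11Metric.aestronglyMeasurable_delta (hg : IsC11Metric g) (hn : n ≠ 0) (j : Fin n)
    (f : Pt n × Pt n → ℝ) : AEStronglyMeasurable (delta g j f) (sigma g) := by
  unfold delta
  refine (hg.aestronglyMeasurable_dRadial hn f _).sub
    (Finset.aestronglyMeasurable_fun_sum _ fun l _ => Finset.aestronglyMeasurable_fun_sum _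
      fun k _ => ?_)
  exact ((hg.aestronglyMeasurable_of_continuousOn hn (hg.continuousOn_christoffel l j k)).mul
    (aestronglyMeasurable_snd_apply k)).smul (hg.aestronglyMeasurable_partialV hn l f)

theorem IsC11Metric.aestronglyMeasurable_geoX (hg : IsC11Metric g) (hn : n ≠ 0)
    (f : Pt n × Pt n → ℝ) : AEStronglyMeasurable (geoX g f) (sigma g) := by
  unfold geoX
  exact Finset.aestronglyMeasurable_fun_sum _ fun j _ =>
    (aestronglyMeasurable_snd_apply j).smul (hg.aestronglyMeasurable_delta hn j f)

theorem IsC11Metric.aestronglyMeasurable_riemann (hg : IsC11Metric g) (hn : n ≠ 0)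
    (l i j k : Fin n) :
    AEStronglyMeasurable (fun z : Pt n × Pt n => riemann g l i j k z.1) (sigma g) := by
  have h1 : ∀ l i j k, AEStronglyMeasurable
      (fun z : Pt n × Pt n => partialX (christoffel g l j k) i z.1) (sigma g) := by
    intro l i j k
    have h2 : Measurable fun z : Pt n × Pt n => fderiv ℝ (christoffel g l j k) z.1 (e i) :=
      (measurable_fderiv_apply_const ℝ _ _).comp measurable_fst
    refine h2.aestronglyMeasurable.congr ?_
    filter_upwards [hg.ae_mem_SM hn] with z hz
    rw [partialX, fderivWithin_of_mem_nhds (M_mem_nhds hz.2)]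
  have hc : ∀ l j k, AEStronglyMeasurable
      (fun z : Pt n × Pt n => christoffel g l j k z.1) (sigma g) := fun l j k =>
    hg.aestronglyMeasurable_of_continuousOn hn (hg.continuousOn_christoffel l j k)
  unfold riemann
  exact ((h1 l i j k).sub (h1 l j i k)).add (Finset.aestronglyMeasurable_fun_sum _ fun m _ =>
    ((hc m j k).mul (hc l i m)).sub ((hc m i k).mul (hc l j m)))

end Measurability

/-! ### Integral identities on the sphere bundle -/

section Identities

variable {n : ℕ} {g : MetricField n}

theorem LipSM.mul {f h : Pt n × Pt n → ℝ} (hf : LipSM g f) (hh : LipSM g h) :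
    LipSM g (fun z => f z * h z) := locallyLipschitzOn_mul hf hh

theorem XSupp.mul_right {f : Pt n × Pt n → ℝ} (hf : XSupp f) (h : Pt n × Pt n → ℝ) :
    XSupp (fun z => f z * h z) := by
  obtain ⟨r, hr, h0⟩ := hf
  exact ⟨r, hr, fun z hz => by simp [h0 z hz]⟩

theorem locallyLipschitzOn_fst_comp {F : Type*} [PseudoMetricSpace F] {c : Pt n → F}
    (hc : LocallyLipschitzOn (M n) c) :
    LocallyLipschitzOn (slitInt n) (fun z => c z.1) :=
  locallyLipschitzOn_comp hc (locallyLipschitzOn_of_contDiff contDiff_fst)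
    (fun _ hz => ball_subset_M hz.1)

theorem lipSM_fst_comp {F : Type*} [PseudoMetricSpace F] {c : Pt n → F}
    (hc : LocallyLipschitzOn (M n) c) : LipSM g (fun z => c z.1) :=
  locallyLipschitzOn_fst_comp hc

theorem LipSM.apply {W : Pt n × Pt n → Pt n} (hW : LipSM g W) (k : Fin n) :
    LipSM g (fun z => W z k) :=
  locallyLipschitzOn_clm (EuclideanSpace.proj k : Pt n →L[ℝ] ℝ) hW

theorem LipSM.aestronglyMeasurable (hg : IsC11Metric g) (hn : n ≠ 0) {f : Pt n × Pt n → ℝ}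
    (hf : LipSM g f) : AEStronglyMeasurable f (sigma g) := by
  have h := hf.continuousOn.aestronglyMeasurable (μ := sigma g) isOpen_slitInt.measurableSet
  rw [Measure.restrict_eq_self_of_ae_mem (hg.ae_mem_slitInt hn)] at h
  refine h.congr ?_
  filter_upwards [hg.ae_mem_SM hn] with z hz
  rw [Function.comp, radial_of_mem_SM hz.1]

theorem XSupp.apply {W : Pt n × Pt n → Pt n} (hW : XSupp W) (k : Fin n) :
    XSupp (fun z => W z k) := by
  obtain ⟨r, hr, h0⟩ := hW
  exact ⟨r, hr, fun z hz => by simp [h0 z hz]⟩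

theorem IsC11Metric.locallyLipschitzOn_chr (hg : IsC11Metric g) {A B : Pt n × Pt n → Pt n}
    (hA : ContDiff ℝ 1 A) (hB : ContDiff ℝ 1 B) :
    LocallyLipschitzOn (slitInt n) (fun z => chr g z.1 (A z) (B z)) := by
  refine locallyLipschitzOn_toLp fun l => locallyLipschitzOn_sum _ fun j _ =>
    locallyLipschitzOn_sum _ fun k _ => locallyLipschitzOn_mul (locallyLipschitzOn_mul
      (locallyLipschitzOn_fst_comp (hg.locallyLipschitzOn_christoffel l j k)) ?_) ?_
  · exact locallyLipschitzOn_of_contDiff (contDiff_euclidean.1 hA j)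
  · exact locallyLipschitzOn_of_contDiff (contDiff_euclidean.1 hB k)

theorem IsC11Metric.locallyLipschitzOn_hlift (hg : IsC11Metric g) {A : Pt n × Pt n → Pt n}
    (hA : ContDiff ℝ 1 A) : LocallyLipschitzOn (slitInt n) (fun z => hlift g (A z) z) := by
  refine locallyLipschitzOn_prodMk (locallyLipschitzOn_of_contDiff hA) ?_
  have := locallyLipschitzOn_clm (-ContinuousLinearMap.id ℝ (Pt n))
    (hg.locallyLipschitzOn_chr hA contDiff_snd)
  simpa using this

theorem IsC11Metric.locallyLipschitzOn_spray (hg : IsC11Metric g) :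
    LocallyLipschitzOn (slitInt n) (spray g) := by
  have : spray g = fun z => hlift g z.2 z := funext spray_eq
  rw [this]
  exact hg.locallyLipschitzOn_hlift contDiff_snd

variable {φ : ℝ → ℝ}

/-- The compactly supported test function `(f ∘ r) φ(|v|²) det g`. -/
noncomputable def testFn (g : MetricField n) (φ : ℝ → ℝ) (f : Pt n × Pt n → ℝ)
    (z : Pt n × Pt n) : ℝ := f (radial g z) * weight g φ z

theorem IsC11Metric.locallyLipschitzOn_testFn (hg : IsC11Metric g) (hφ : ContDiff ℝ 1 φ)
    {f : Pt n × Pt n → ℝ} (hf : LipSM g f) :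
    LocallyLipschitzOn (slitInt n) (testFn g φ f) :=
  locallyLipschitzOn_mul hf (locallyLipschitzOn_of_contDiffOn isOpen_slitInt
    ((hg.contDiffOn_weight hφ).mono slitInt_subset))

theorem IsC11Metric.exists_compact_testFn (hg : IsC11Metric g)
    (hφ0 : ∀ t ∉ Icc (1 : ℝ) 3, φ t = 0) {f : Pt n × Pt n → ℝ} (hs : XSupp f) :
    ∃ K : Set (Pt n × Pt n), IsCompact K ∧ K ⊆ slitInt n ∧ ∀ z ∉ K, testFn g φ f z = 0 := by
  obtain ⟨r, hr, h0⟩ := hs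
  obtain ⟨K, hK, hKs, h⟩ := hg.exists_compact hr one_pos hφ0
  refine ⟨K, hK, hKs, fun z hz => ?_⟩
  rcases le_or_gt ‖z.1‖ r with h1 | h1
  · rw [testFn, h z hz h1, mul_zero]
  · rw [testFn, h0 (radial g z) h1, zero_mul]

theorem IsC11Metric.fderiv_testFn (hg : IsC11Metric g) (hφ : ContDiff ℝ 1 φ)
    {f : Pt n × Pt n → ℝ} {z : Pt n × Pt n} (hz : z ∈ slitInt n)
    (hf : DifferentiableAt ℝ (f ∘ radial g) z) (p : Pt n × Pt n) :
    fderiv ℝ (testFn g φ f) z p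
      = dRadial g f z p * weight g φ z + f (radial g z) * fderiv ℝ (weight g φ) z p := by
  have h1 := (hf.hasFDerivAt.fun_mul (hg.fderiv_weight hφ hz.1).1.hasFDerivAt).fderiv
  have h2 : testFn g φ f = fun y => (f ∘ radial g) y * weight g φ y := rfl
  rw [h2, h1, dRadial_eq_fderiv f hz]
  simp
  ring

theorem IsC11Metric.weight_eq (hg : IsC11Metric g) {z : Pt n × Pt n} (hz : z.1 ∈ M n) :
    weight g φ z = φ (gNorm g z.1 z.2 ^ 2) * (g z.1).det := by
  rw [weight, hg.gNorm_sq hz]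

/-- The exponent a is the total degree of homogeneity in v. The radial factor is the integral of
φ(s²) s^{a+n-1}, which is positive and can be divided out. -/
theorem IsC11Metric.integral_eq_zero_of_hasZeroIntegral (hg : IsC11Metric g) (hn : n ≠ 0)
    {f : Pt n × Pt n → ℝ} (hf : HasZeroIntegral volume f) (a : ℕ)
    {G : Pt n × Pt n → ℝ} (hG : AEStronglyMeasurable G (sigma g))
    (hz : ∀ᵐ z : Pt n × Pt n, z ∈ slitInt n →
      f z = G (radial g z) * (phi (gNorm g z.1 z.2 ^ 2) * gNorm g z.1 z.2 ^ a) * (g z.1).det)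
    (h0 : ∀ z ∉ slitInt n, f z = 0) :
    ∫ z, G z ∂(sigma g) = 0 := by
  have h := hg.integral_mul_eq_zero hn hf (h := fun s => phi (s ^ 2) * s ^ a)
    ((contDiff_phi.continuous.comp (continuous_pow 2)).mul (continuous_pow a)).measurable hG hz h0
  simp only [mul_assoc, ← pow_add] at h
  exact (mul_eq_zero.1 h).resolve_right (integral_phi_pos _).ne'

theorem IsC11Metric.geoX_eq_radial (hg : IsC11Metric g) (f : Pt n × Pt n → ℝ) {z : Pt n × Pt n}
    (hz : z ∈ slitTM n) : dRadial g f z (spray g z) = gNorm g z.1 z.2 * geoX g f (radial g z) := by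
  have := hg.gNorm_pos hz.1 hz.2
  rw [hg.geoX_radial f hz, ← geoX_eq, smul_eq_mul]
  field_simp

theorem IsC11Metric.delta_eq_radial (hg : IsC11Metric g) (f : Pt n × Pt n → ℝ) {z : Pt n × Pt n}
    (hz : z ∈ slitTM n) (j : Fin n) :
    dRadial g f z (hlift g (e j) z) = delta g j f (radial g z) := by
  rw [hg.delta_radial f hz, ← delta_eq]

theorem IsC11Metric.partialV_eq_radial (hg : IsC11Metric g) (f : Pt n × Pt n → ℝ)
    {z : Pt n × Pt n} (hz : z ∈ slitTM n) (k : Fin n) :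
    dRadial g f z (0, e k) = (gNorm g z.1 z.2)⁻¹ * partialV g k f (radial g z) := by
  have := hg.gNorm_pos hz.1 hz.2
  rw [hg.partialV_radial f hz, ← partialV_eq, smul_eq_mul]
  field_simp

/-- By Liouville's theorem, X acting on the test function only sees f. -/
theorem IsC11Metric.integral_geoX (hg : IsC11Metric g) (hn : n ≠ 0) {f : Pt n × Pt n → ℝ}
    (hf : LipSM g f) (hs : XSupp f) : ∫ z, geoX g f z ∂(sigma g) = 0 := by
  obtain ⟨K, hK, hKs, hK0⟩ := hg.exists_compact_testFn phi_zero hs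
  have h := hasZeroIntegral_div volume sum_frL_smul isOpen_slitInt hK hKs
    (hg.locallyLipschitzOn_testFn contDiff_phi hf) hK0 hg.locallyLipschitzOn_spray
  refine hg.integral_eq_zero_of_hasZeroIntegral hn h 1 (hg.aestronglyMeasurable_geoX hn f) ?_ ?_
  · filter_upwards [hf.ae_differentiableAt, hg.ae_chrDiffAt] with z h1 h2 hz
    have hzs := slitInt_subset hz
    have h3 := hg.weight_div_spray contDiff_phi hz.1 (h2 hz)
    rw [hg.fderiv_testFn contDiff_phi hz (h1 hz), testFn, hg.geoX_eq_radial f hzs]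
    rw [hg.weight_eq hzs.1] at *
    linear_combination (f (radial g z)) * h3
  · intro z hz
    have hzK : z ∉ K := fun h => hz (hKs h)
    rw [hK0 z hzK, fderiv_eq_zero_of_notMem hK.isClosed hK0 hzK]
    simp

theorem IsC11Metric.integral_divH (hg : IsC11Metric g) (hn : n ≠ 0) {W : Pt n × Pt n → Pt n}
    (hf : LipSM g W) (hs : XSupp W) : ∫ z, divH g W z ∂(sigma g) = 0 := by
  have hC := fun j => hg.exists_compact_testFn phi_zero (hs.apply j)
  choose K hK hKs hK0 using hC
  have h := HasZeroIntegral.sum (μ := volume) Finset.univ fun j _ =>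
    hasZeroIntegral_div volume sum_frL_smul isOpen_slitInt (hK j) (hKs j)
    (hg.locallyLipschitzOn_testFn contDiff_phi (hf.apply j)) (hK0 j)
    (hg.locallyLipschitzOn_hlift (A := fun _ => e j) contDiff_const)
  -- Exponent 0: the operators δ_j preserve the degree.
  refine hg.integral_eq_zero_of_hasZeroIntegral hn h 0 ?_ ?_ ?_
  · exact Finset.aestronglyMeasurable_fun_sum _ fun j _ =>
      (hg.aestronglyMeasurable_delta hn j _).add (Finset.aestronglyMeasurable_fun_sum _ fun i _ =>
        (hg.aestronglyMeasurable_of_continuousOn hn (hg.continuousOn_christoffel i j i)).mul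
          ((hf.apply j).aestronglyMeasurable hg hn))
  · filter_upwards [ae_all_iff.2 fun j => (hf.apply j).ae_differentiableAt, hg.ae_chrDiffAt]
      with z h1 h2 hz
    have hzs := slitInt_subset hz
    have h3 := fun j => hg.weight_div_hlift contDiff_phi hz.1 (h2 hz) j
    rw [divH, Finset.sum_mul, Finset.sum_mul]
    refine Finset.sum_congr rfl fun j _ => ?_
    rw [hg.fderiv_testFn contDiff_phi hz (h1 j hz), testFn, hg.delta_eq_radial _ hzs]
    have h4 := h3 j
    rw [hg.weight_eq hzs.1] at *
    rw [← Finset.sum_mul]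
    have h5 : ∑ i, christoffel g i j i (radial g z).1 = trChr g j z.1 := rfl
    rw [h5]
    linear_combination (W (radial g z) j) * h4
  · intro z hz
    refine Finset.sum_eq_zero fun j _ => ?_
    have hzK : z ∉ K j := fun h => hz (hKs j h)
    rw [hK0 j z hzK, fderiv_eq_zero_of_notMem (hK j).isClosed (hK0 j) hzK]
    simp

/-- The weight tφ(t) at t = |v|² supplies a factor |v|². It compensates the negative degree of ∂_k,
so that the exponent of |v| is again a natural number. -/
theorem contDiff_id_mul_phi : ContDiff ℝ 1 (fun t => t * phi t) := contDiff_id.mul contDiff_phi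

theorem id_mul_phi_zero : ∀ t ∉ Icc (1 : ℝ) 3, t * phi t = 0 := fun t ht => by
  rw [phi_zero t ht, mul_zero]

theorem IsC11Metric.sum_orth (hg : IsC11Metric g) {W : Pt n × Pt n → Pt n}
    (ho : ∀ z ∈ SM g, gInner g z.1 (W z) z.2 = 0) {z : Pt n × Pt n} (hz : z ∈ slitTM n) :
    gInner g z.1 (W (radial g z)) z.2 = 0 := by
  have h := ho _ (hg.radial_mem hz)
  have hs := hg.gNorm_pos hz.1 hz.2
  rw [radial, gInner_smul_right] at h
  exact (mul_eq_zero.1 h).resolve_left (inv_ne_zero hs.ne')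

/-- The weight depends on v only through |v|, so it is constant in directions orthogonal to v. -/
theorem IsC11Metric.sum_fderiv_weight (hg : IsC11Metric g) (hφ : ContDiff ℝ 1 φ)
    {z : Pt n × Pt n} (hz : z ∈ slitInt n) {a : Pt n} (ha : gInner g z.1 a z.2 = 0) :
    ∑ k, a k * fderiv ℝ (weight g φ) z (0, e k) = 0 := by
  have := clm_snd_eq_sum (fderiv ℝ (weight g φ) z) a
  simp only [smul_eq_mul] at this
  rw [← this, hg.fderiv_weight_snd hφ hz.1, ha]
  ring

/-- Integration by parts in the fibres could leave a derivative of the weight, which is proportional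
to ⟨W, v⟩; for sections of N it vanishes. -/
theorem IsC11Metric.integral_divV (hg : IsC11Metric g) (hn : n ≠ 0) {W : Pt n × Pt n → Pt n}
    (hf : LipSM g W) (hs : XSupp W) (ho : ∀ z ∈ SM g, gInner g z.1 (W z) z.2 = 0) :
    ∫ z, divV g W z ∂(sigma g) = 0 := by
  have hC := fun j => hg.exists_compact_testFn id_mul_phi_zero (hs.apply j)
  choose K hK hKs hK0 using hC
  have h := HasZeroIntegral.sum (μ := volume) Finset.univ fun j _ =>
    hasZeroIntegral_div volume sum_frL_smul isOpen_slitInt (hK j) (hKs j)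
    (hg.locallyLipschitzOn_testFn contDiff_id_mul_phi (hf.apply j)) (hK0 j)
    (locallyLipschitzOn_const (0, e j))
  -- Degree 2 from the weight and degree -1 from the vertical derivative.
  refine hg.integral_eq_zero_of_hasZeroIntegral hn h 1 ?_ ?_ ?_
  · exact Finset.aestronglyMeasurable_fun_sum _ fun j _ =>
      hg.aestronglyMeasurable_partialV hn j _
  · filter_upwards [ae_all_iff.2 fun j => (hf.apply j).ae_differentiableAt] with z h1 hz
    have hzs := slitInt_subset hz
    have hpos := hg.gNorm_pos hzs.1 hzs.2
    simp only [div_const, mul_zero, zero_add]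
    have h2 : ∀ j, fderiv ℝ (testFn g (fun t => t * phi t) fun z => W z j) z (0, e j)
        = (partialV g j (fun y => W y j) (radial g z)) * (phi (gNorm g z.1 z.2 ^ 2)
          * gNorm g z.1 z.2 ^ 1 * (g z.1).det) + W (radial g z) j *
          fderiv ℝ (weight g (fun t => t * phi t)) z (0, e j) := by
      intro j
      rw [hg.fderiv_testFn contDiff_id_mul_phi hz (h1 j hz), hg.partialV_eq_radial _ hzs,
        hg.weight_eq hzs.1]
      field_simp
    simp only [h2, Finset.sum_add_distrib,
      hg.sum_fderiv_weight contDiff_id_mul_phi hz (hg.sum_orth ho hzs)]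
    rw [← Finset.sum_mul, divV]
    ring
  · intro z hz
    refine Finset.sum_eq_zero fun j _ => ?_
    have hzK : z ∉ K j := fun h => hz (hKs j h)
    rw [hK0 j z hzK, fderiv_eq_zero_of_notMem (hK j).isClosed (hK0 j) hzK]
    simp

theorem dchr_zero_left (x a b : Pt n) : dchr g x 0 a b = 0 := by
  ext l
  simp [dchr_apply]

theorem IsC11Metric.aestronglyMeasurable_chr_apply (hg : IsC11Metric g) (hn : n ≠ 0)
    {W : Pt n × Pt n → Pt n} (hW : ∀ k, AEStronglyMeasurable (fun z => W z k) (sigma g))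
    (l : Fin n) : AEStronglyMeasurable (fun z => chr g z.1 z.2 (W z) l) (sigma g) := by
  simp only [chr_apply]
  exact Finset.aestronglyMeasurable_fun_sum _ fun j _ => Finset.aestronglyMeasurable_fun_sum _
    fun k _ => ((hg.aestronglyMeasurable_of_continuousOn hn
      (hg.continuousOn_christoffel l j k)).mul (aestronglyMeasurable_snd_apply j)).mul (hW k)

/-- The commutator identity `[X, ∇^v] = -∇^h` in weak form. -/
theorem IsC11Metric.integral_commutator_geoX_partialV (hg : IsC11Metric g) (hn : n ≠ 0)
    {u : Pt n × Pt n → ℝ} {W : Pt n × Pt n → Pt n} (hu : LipSM g u) (hW : LipSM g W)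
    (hs : XSupp W) (ho : ∀ z ∈ SM g, gInner g z.1 (W z) z.2 = 0) :
    ∫ z, (∑ k, partialV g k u z * (geoX g (fun y => W y k) z + chr g z.1 z.2 (W z) k)
      - geoX g u z * divV g W z - ∑ k, delta g k u z * W z k) ∂(sigma g) = 0 := by
  have hC := fun j => hg.exists_compact_testFn phi_zero (hs.apply j)
  choose K hK hKs hK0 using hC
  have h := HasZeroIntegral.sum (μ := volume) Finset.univ fun j _ =>
    hasZeroIntegral_bracket volume sum_frL_smul isOpen_slitInt (hK j) (hKs j)
    (hg.locallyLipschitzOn_testFn contDiff_phi (hW.apply j)) (hK0 j)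
    hg.locallyLipschitzOn_spray (locallyLipschitzOn_const (0, e j)) hu
  have hWm := fun k => (hW.apply k).aestronglyMeasurable hg hn
  -- The degrees 1 of X and -1 of the vertical derivative cancel.
  refine hg.integral_eq_zero_of_hasZeroIntegral hn h 0 ?_ ?_ ?_
  · refine ((Finset.aestronglyMeasurable_fun_sum _ fun k _ =>
      (hg.aestronglyMeasurable_partialV hn k u).mul ((hg.aestronglyMeasurable_geoX hn _).add
        (hg.aestronglyMeasurable_chr_apply hn hWm k))).sub
      ((hg.aestronglyMeasurable_geoX hn u).mul (Finset.aestronglyMeasurable_fun_sum _ fun j _ =>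
      hg.aestronglyMeasurable_partialV hn j _))).sub (Finset.aestronglyMeasurable_fun_sum _
      fun k _ => (hg.aestronglyMeasurable_delta hn k u).mul (hWm k))
  · filter_upwards [ae_all_iff.2 fun j => (hW.apply j).ae_differentiableAt, hg.ae_chrDiffAt]
      with z h1 h2 hz
    have hzs := slitInt_subset hz
    have hpos := hg.gNorm_pos hzs.1 hzs.2
    have hX := hg.weight_div_spray contDiff_phi hz.1 (h2 hz)
    -- The bracket of the spray with ∂_{v^k}: minus the horizontal lift, which gives -∇^h, and a
    -- vertical Christoffel term.
    have hbr : ∀ k, fderiv ℝ (u ∘ radial g) z (fderiv ℝ (fun _ => ((0, e k) : Pt n × Pt n)) z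
        (spray g z) - fderiv ℝ (spray g) z (0, e k))
        = dRadial g u z (0, chr g z.1 z.2 (e k)) - dRadial g u z (hlift g (e k) z) := by
      intro k
      rw [(h2 hz).fderiv_spray, fderiv_fun_const, ← dRadial_eq_fderiv u hz, ← map_sub]
      congr 1
      simp [hlift, dchr_zero_left]
      abel
    -- By the symmetry of Γ the vertical term completes the componentwise derivative of W along X to
    -- the covariant one.
    have hchr : ∑ k, W (radial g z) k * dRadial g u z (0, chr g z.1 z.2 (e k))
        = ∑ k, chr g z.1 z.2 (W (radial g z)) k * dRadial g u z (0, e k) := by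
      have e1 := clm_snd_eq_sum (dRadial g u z) (chr g z.1 z.2 (W (radial g z)))
      simp only [smul_eq_mul] at e1
      rw [← e1, hg.chr_comm hzs.1, ← sum_smul_chr_left]
      have e2 : ((0, ∑ k, (W (radial g z)) k • chr g z.1 (e k) z.2) : Pt n × Pt n)
          = ∑ k, (W (radial g z)) k • ((0, chr g z.1 z.2 (e k)) : Pt n × Pt n) := by
        refine Prod.ext ?_ ?_
        · simp [Prod.fst_sum]
        · simp only [Prod.snd_sum, Prod.smul_snd]
          exact Finset.sum_congr rfl fun k _ => by rw [hg.chr_comm hzs.1]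
      rw [e2, map_sum]
      simp only [map_smul, smul_eq_mul]
    -- The vertical derivative also falls on the weight; orthogonality of W to v removes this term.
    have horth := hg.sum_fderiv_weight contDiff_phi hz (hg.sum_orth ho hzs)
    have hterm : ∀ k, (testFn g phi (fun z => W z k) z * divFrame frE frL (spray g) z
          + fderiv ℝ (testFn g phi fun z => W z k) z (spray g z))
            * fderiv ℝ (u ∘ radial g) z (0, e k)
        - (testFn g phi (fun z => W z k) z * divFrame frE frL (fun _ => (0, e k)) z
          + fderiv ℝ (testFn g phi fun z => W z k) z (0, e k))
            * fderiv ℝ (u ∘ radial g) z (spray g z)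
        + testFn g phi (fun z => W z k) z * fderiv ℝ (u ∘ radial g) z
            (fderiv ℝ (fun _ => ((0, e k) : Pt n × Pt n)) z (spray g z)
              - fderiv ℝ (spray g) z (0, e k))
        = weight g phi z * (dRadial g (fun y => W y k) z (spray g z) * dRadial g u z (0, e k)
            - dRadial g (fun y => W y k) z (0, e k) * dRadial g u z (spray g z)
            - W (radial g z) k * dRadial g u z (hlift g (e k) z))
          + weight g phi z * (W (radial g z) k * dRadial g u z (0, chr g z.1 z.2 (e k)))
          - dRadial g u z (spray g z) * (W (radial g z) k *
            fderiv ℝ (weight g phi) z (0, e k)) := by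
      intro k
      rw [hbr, hg.fderiv_testFn contDiff_phi hz (h1 k hz),
        hg.fderiv_testFn contDiff_phi hz (h1 k hz), testFn, div_const,
        ← dRadial_eq_fderiv u hz]
      linear_combination (W (radial g z) k * dRadial g u z (0, e k)) * hX
    simp only [hterm, Finset.sum_add_distrib, Finset.sum_sub_distrib, ← Finset.mul_sum, horth, hchr]
    simp only [hg.geoX_eq_radial _ hzs, hg.partialV_eq_radial _ hzs, hg.delta_eq_radial _ hzs]
    have e3 : ∀ k, chr g z.1 z.2 (W (radial g z)) k
        = gNorm g z.1 z.2 * chr g (radial g z).1 (radial g z).2 (W (radial g z)) k := by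
      intro k
      simp only [radial, chr_smul_left, PiLp.smul_apply, smul_eq_mul]
      field_simp
    simp only [e3]
    rw [hg.weight_eq hzs.1]
    simp only [divV, Finset.mul_sum, Finset.sum_mul, ← Finset.sum_add_distrib,
      ← Finset.sum_sub_distrib, mul_zero, sub_zero]
    refine Finset.sum_congr rfl fun k _ => ?_
    field_simp
    ring
  · intro z hz
    refine Finset.sum_eq_zero fun j _ => ?_
    have hzK : z ∉ K j := fun h => hz (hKs j h)
    rw [hK0 j z hzK, fderiv_eq_zero_of_notMem (hK j).isClosed (hK0 j) hzK]
    simp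

end Identities

end SimpleC11

namespace SimpleC11

/-! ### Curvature as the bracket of the spray with horizontal lifts. -/

section Curvature

variable {n : ℕ} {g : MetricField n}

theorem sum_riemann {x : Pt n} (hx : x ∈ Metric.ball (0 : Pt n) 1) (a v : Pt n) (l : Fin n) :
    ∑ i, ∑ j, ∑ k, riemann g l i j k x * a i * v j * v k
      = (dchr g x a v v - dchr g x v a v + chr g x a (chr g x v v) - chr g x v (chr g x a v)) l := by
  have hp : ∀ l j k i, partialX (christoffel g l j k) i x = fderiv ℝ (christoffel g l j k) x (e i) :=
    fun l j k i => by rw [partialX, fderivWithin_of_mem_nhds (M_mem_nhds hx)]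
  have e1 : dchr g x a v v l
      = ∑ i, ∑ j, ∑ k, fderiv ℝ (christoffel g l j k) x (e i) * a i * v j * v k := by
    rw [← sum_smul_dchr_left]
    simp only [WithLp.ofLp_sum, WithLp.ofLp_smul, Finset.sum_apply, Pi.smul_apply, smul_eq_mul,
      dchr_apply, Finset.mul_sum]
    exact Finset.sum_congr rfl fun i _ => Finset.sum_congr rfl fun j _ =>
      Finset.sum_congr rfl fun k _ => by ring
  have e2 : dchr g x v a v l
      = ∑ i, ∑ j, ∑ k, fderiv ℝ (christoffel g l i k) x (e j) * a i * v j * v k := by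
    rw [← sum_smul_dchr_left, Finset.sum_comm]
    simp only [WithLp.ofLp_sum, WithLp.ofLp_smul, Finset.sum_apply, Pi.smul_apply, smul_eq_mul,
      dchr_apply, Finset.mul_sum]
    exact Finset.sum_congr rfl fun i _ => Finset.sum_congr rfl fun j _ =>
      Finset.sum_congr rfl fun k _ => by ring
  have e3 : chr g x a (chr g x v v) l = ∑ i, ∑ j, ∑ k,
      (∑ m, christoffel g m j k x * christoffel g l i m x) * a i * v j * v k := by
    rw [chr_apply]
    refine Finset.sum_congr rfl fun i _ => ?_
    simp only [chr_apply, Finset.mul_sum, Finset.sum_mul]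
    rw [Finset.sum_comm]
    refine Finset.sum_congr rfl fun j _ => ?_
    rw [Finset.sum_comm]
    exact Finset.sum_congr rfl fun k _ => Finset.sum_congr rfl fun m _ => by ring
  have e4 : chr g x v (chr g x a v) l = ∑ i, ∑ j, ∑ k,
      (∑ m, christoffel g m i k x * christoffel g l j m x) * a i * v j * v k := by
    rw [chr_apply, Finset.sum_comm (s := (Finset.univ : Finset (Fin n)))
      (f := fun i j => ∑ k, (∑ m, christoffel g m i k x * christoffel g l j m x) * a i * v j * v k)]
    refine Finset.sum_congr rfl fun j _ => ?_
    simp only [chr_apply, Finset.mul_sum, Finset.sum_mul]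
    rw [Finset.sum_comm]
    refine Finset.sum_congr rfl fun i _ => ?_
    rw [Finset.sum_comm]
    exact Finset.sum_congr rfl fun k _ => Finset.sum_congr rfl fun m _ => by ring
  simp only [PiLp.sub_apply, PiLp.add_apply, e1, e2, e3, e4, ← Finset.sum_sub_distrib,
    ← Finset.sum_add_distrib]
  refine Finset.sum_congr rfl fun i _ => Finset.sum_congr rfl fun j _ =>
      Finset.sum_congr rfl fun k _ => ?_
  rw [riemann, hp, hp, Finset.sum_sub_distrib]
  ring

theorem sum_smul_snd_mk (a : Fin n → ℝ) (b : Fin n → Pt n) :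
    ∑ k, a k • ((0, b k) : Pt n × Pt n) = (0, ∑ k, a k • b k) := by
  refine Prod.ext ?_ ?_
  · simp [Prod.fst_sum]
  · simp [Prod.snd_sum]

/-- The horizontal distribution fails to be integrable by the curvature. With constant coefficients
a, the horizontal part of the bracket is the lift of Γ(v, a) and the vertical part is R(a, v)v. The
former becomes the Christoffel term of the covariant derivative along X, the latter the curvature
term of the identity. -/
theorem ChrDiffAt.sum_bracket (hg : IsC11Metric g) {z : Pt n × Pt n}
    (hz : z.1 ∈ Metric.ball (0 : Pt n) 1) (h : ChrDiffAt g z.1) (a : Pt n) :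
    ∑ k, a k • (fderiv ℝ (hlift g (e k)) z (spray g z) - fderiv ℝ (spray g) z (hlift g (e k) z))
      = hlift g (chr g z.1 z.2 a) z + (0, WithLp.toLp 2 fun l =>
        ∑ i, ∑ j, ∑ k, riemann g l i j k z.1 * a i * z.2 j * z.2 k) := by
  have hzM := ball_subset_M hz
  have h1 : (WithLp.toLp 2 fun l => ∑ i, ∑ j, ∑ k, riemann g l i j k z.1 * a i * z.2 j * z.2 k)
      = dchr g z.1 a z.2 z.2 - dchr g z.1 z.2 a z.2 + chr g z.1 a (chr g z.1 z.2 z.2)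
        - chr g z.1 z.2 (chr g z.1 a z.2) := by
    ext l
    exact sum_riemann hz a z.2 l
  have h2 : ∀ k, fderiv ℝ (hlift g (e k)) z (spray g z) - fderiv ℝ (spray g) z (hlift g (e k) z)
      = hlift g (chr g z.1 (e k) z.2) z + (0, dchr g z.1 (e k) z.2 z.2 - dchr g z.1 z.2 (e k) z.2
        + chr g z.1 (e k) (chr g z.1 z.2 z.2) - chr g z.1 z.2 (chr g z.1 (e k) z.2)) := by
    intro k
    rw [h.fderiv_hlift, h.fderiv_spray, spray_eq]
    refine Prod.ext ?_ ?_
    · simp [hlift]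
    · simp only [hlift, Prod.snd_sub, Prod.snd_add, chr_neg_right, chr_neg_left]
      abel
  have h3 : ∑ k, a k • hlift g (chr g z.1 (e k) z.2) z = hlift g (chr g z.1 z.2 a) z := by
    rw [hg.chr_comm hzM z.2 a, ← sum_smul_chr_left z.1 a]
    refine Prod.ext ?_ ?_
    · simp [hlift, Prod.fst_sum]
    · simp only [Prod.snd_sum, Prod.smul_snd, hlift, smul_neg, Finset.sum_neg_distrib]
      congr 1
      have : ∀ (s : Finset (Fin n)), ∑ k ∈ s, a k • chr g z.1 (chr g z.1 (e k) z.2) z.2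
          = chr g z.1 (∑ k ∈ s, a k • chr g z.1 (e k) z.2) z.2 := by
        intro s
        classical
        induction s using Finset.induction_on with
        | empty => simp [chr_zero_left]
        | insert i s hi ih => rw [Finset.sum_insert hi, Finset.sum_insert hi, ih, chr_add_left,
            chr_smul_left]
      exact this _
  have h4 : ∑ k, a k • chr g z.1 z.2 (chr g z.1 (e k) z.2)
      = chr g z.1 z.2 (chr g z.1 a z.2) := by
    rw [← sum_smul_chr_left z.1 a]
    have : ∀ (s : Finset (Fin n)), ∑ k ∈ s, a k • chr g z.1 z.2 (chr g z.1 (e k) z.2)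
        = chr g z.1 z.2 (∑ k ∈ s, a k • chr g z.1 (e k) z.2) := by
      intro s
      classical
      induction s using Finset.induction_on with
      | empty => simpa using (chr_smul_right (g := g) z.1 z.2 0 0).symm
      | insert i s hi ih => rw [Finset.sum_insert hi, Finset.sum_insert hi, ih, chr_add_right,
          chr_smul_right]
    exact this _
  simp only [h2, smul_add, Finset.sum_add_distrib, h3]
  rw [sum_smul_snd_mk, h1]
  simp only [smul_sub, smul_add, Finset.sum_sub_distrib, Finset.sum_add_distrib, h4,
    sum_smul_dchr_left, sum_smul_dchr_middle, sum_smul_chr_left]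

theorem IsC11Metric.aestronglyMeasurable_curv_apply (hg : IsC11Metric g) (hn : n ≠ 0)
    {W : Pt n × Pt n → Pt n} (hW : ∀ k, AEStronglyMeasurable (fun z => W z k) (sigma g))
    (l : Fin n) : AEStronglyMeasurable (fun z => curv g W z l) (sigma g) := by
  have : AEStronglyMeasurable (fun z : Pt n × Pt n => ∑ i, ∑ j, ∑ k,
      riemann g l i j k z.1 * W z i * z.2 j * z.2 k) (sigma g) :=
    Finset.aestronglyMeasurable_fun_sum _ fun i _ => Finset.aestronglyMeasurable_fun_sum _
      fun j _ => Finset.aestronglyMeasurable_fun_sum _ fun k _ =>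
      (((hg.aestronglyMeasurable_riemann hn l i j k).mul (hW i)).mul
        (aestronglyMeasurable_snd_apply j)).mul (aestronglyMeasurable_snd_apply k)
  exact this

/-- The commutator identity `[∇^h, X] = R ∇^v` in weak form. -/
theorem IsC11Metric.integral_commutator_geoX_delta (hg : IsC11Metric g) (hn : n ≠ 0)
    {u : Pt n × Pt n → ℝ} {W : Pt n × Pt n → Pt n} (hu : LipSM g u) (hW : LipSM g W)
    (hs : XSupp W) :
    ∫ z, (∑ k, delta g k u z * (geoX g (fun y => W y k) z + chr g z.1 z.2 (W z) k)
      - geoX g u z * divH g W z + ∑ l, curv g W z l * partialV g l u z) ∂(sigma g) = 0 := by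
  have hC := fun j => hg.exists_compact_testFn phi_zero (hs.apply j)
  choose K hK hKs hK0 using hC
  have h := HasZeroIntegral.sum (μ := volume) Finset.univ fun j _ =>
    hasZeroIntegral_bracket volume sum_frL_smul isOpen_slitInt (hK j) (hKs j)
    (hg.locallyLipschitzOn_testFn contDiff_phi (hW.apply j)) (hK0 j)
    hg.locallyLipschitzOn_spray (hg.locallyLipschitzOn_hlift (A := fun _ => e j) contDiff_const) hu
  have hWm := fun k => (hW.apply k).aestronglyMeasurable hg hn
  -- Degree 1 from X and degree 0 from the horizontal derivative.
  refine hg.integral_eq_zero_of_hasZeroIntegral hn h 1 ?_ ?_ ?_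
  · refine ((Finset.aestronglyMeasurable_fun_sum _ fun k _ =>
      (hg.aestronglyMeasurable_delta hn k u).mul ((hg.aestronglyMeasurable_geoX hn _).add
        (hg.aestronglyMeasurable_chr_apply hn hWm k))).sub
      ((hg.aestronglyMeasurable_geoX hn u).mul (Finset.aestronglyMeasurable_fun_sum _ fun j _ =>
      (hg.aestronglyMeasurable_delta hn j _).add (Finset.aestronglyMeasurable_fun_sum _ fun i _ =>
        (hg.aestronglyMeasurable_of_continuousOn hn (hg.continuousOn_christoffel i j i)).mul
          (hWm j))))).add (Finset.aestronglyMeasurable_fun_sum _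
      fun l _ => AEStronglyMeasurable.mul ?_ (hg.aestronglyMeasurable_partialV hn l u))
    exact hg.aestronglyMeasurable_curv_apply hn hWm l
  · filter_upwards [ae_all_iff.2 fun j => (hW.apply j).ae_differentiableAt, hg.ae_chrDiffAt]
      with z h1 h2 hz
    have hzs := slitInt_subset hz
    have hpos := hg.gNorm_pos hzs.1 hzs.2
    have hX := hg.weight_div_spray contDiff_phi hz.1 (h2 hz)
    have hH := fun k => hg.weight_div_hlift contDiff_phi hz.1 (h2 hz) k
    set L := dRadial g u z with hL
    set a := W (radial g z) with ha
    have hbr : ∑ k, a k * L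
        (fderiv ℝ (hlift g (e k)) z (spray g z) - fderiv ℝ (spray g) z (hlift g (e k) z))
        = ∑ k, chr g z.1 z.2 a k * L (hlift g (e k) z) + ∑ l, (∑ i, ∑ j, ∑ k,
          riemann g l i j k z.1 * a i * z.2 j * z.2 k) * L (0, e l) := by
      have e1 := congrArg L ((h2 hz).sum_bracket hg hz.1 a)
      rw [map_add, clm_snd_eq_sum, ← sum_smul_hlift, map_sum, map_sum] at e1
      simpa only [map_smul, smul_eq_mul] using e1
    have hterm : ∀ k, (testFn g phi (fun z => W z k) z * divFrame frE frL (spray g) z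
          + fderiv ℝ (testFn g phi fun z => W z k) z (spray g z))
            * fderiv ℝ (u ∘ radial g) z (hlift g (e k) z)
        - (testFn g phi (fun z => W z k) z * divFrame frE frL (hlift g (e k)) z
          + fderiv ℝ (testFn g phi fun z => W z k) z (hlift g (e k) z))
            * fderiv ℝ (u ∘ radial g) z (spray g z)
        + testFn g phi (fun z => W z k) z * fderiv ℝ (u ∘ radial g) z
            (fderiv ℝ (hlift g (e k)) z (spray g z)
              - fderiv ℝ (spray g) z (hlift g (e k) z))
        = weight g phi z * (dRadial g (fun y => W y k) z (spray g z) * L (hlift g (e k) z)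
            - (dRadial g (fun y => W y k) z (hlift g (e k) z) + a k * trChr g k z.1)
              * L (spray g z))
          + weight g phi z * (a k * L (fderiv ℝ (hlift g (e k)) z (spray g z)
              - fderiv ℝ (spray g) z (hlift g (e k) z))) := by
      intro k
      rw [hg.fderiv_testFn contDiff_phi hz (h1 k hz),
        hg.fderiv_testFn contDiff_phi hz (h1 k hz), testFn,
        ← dRadial_eq_fderiv u hz]
      linear_combination (a k * L (hlift g (e k) z)) * hX - (a k * L (spray g z)) * hH k
    rw [Finset.sum_congr rfl fun k _ => hterm k]
    simp only [Finset.sum_add_distrib, Finset.sum_sub_distrib, ← Finset.mul_sum, hbr]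
    simp only [hL, hg.geoX_eq_radial _ hzs, hg.partialV_eq_radial _ hzs, hg.delta_eq_radial _ hzs]
    have e3 : ∀ k, chr g z.1 z.2 a k
        = gNorm g z.1 z.2 * chr g (radial g z).1 (radial g z).2 a k := by
      intro k
      simp only [radial, chr_smul_left, PiLp.smul_apply, smul_eq_mul]
      field_simp
    -- The curvature is quadratic in v; paired with a vertical derivative of degree -1, it too has
    -- degree 1.
    have e4 : ∀ l, ∑ i, ∑ j, ∑ k, riemann g l i j k z.1 * a i * z.2 j * z.2 k
        = gNorm g z.1 z.2 ^ 2 * curv g W (radial g z) l := by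
      intro l
      simp only [curv, Finset.mul_sum]
      refine Finset.sum_congr rfl fun i _ => Finset.sum_congr rfl fun j _ =>
        Finset.sum_congr rfl fun k _ => ?_
      simp only [radial, PiLp.smul_apply, smul_eq_mul]
      rw [← radial, ← ha]
      field_simp
    have e5 : divH g W (radial g z) = ∑ k, (delta g k (fun y => W y k) (radial g z)
        + a k * trChr g k z.1) := by
      rw [divH]
      refine Finset.sum_congr rfl fun k _ => ?_
      rw [← Finset.sum_mul, mul_comm (a k)]
      rfl
    simp only [e3, e4]
    rw [hg.weight_eq hzs.1, e5]
    simp only [Finset.mul_sum, Finset.sum_mul, ← Finset.sum_add_distrib,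
      ← Finset.sum_sub_distrib]
    refine Finset.sum_congr rfl fun k _ => ?_
    field_simp
    ring
  · intro z hz
    refine Finset.sum_eq_zero fun j _ => ?_
    have hzK : z ∉ K j := fun h => hz (hKs j h)
    rw [hK0 j z hzK, fderiv_eq_zero_of_notMem (hK j).isClosed (hK0 j) hzK]
    simp

end Curvature

end SimpleC11

namespace SimpleC11

/-! ### The commutator of the vertical and the horizontal gradient -/

section GradientCommutator

variable {n : ℕ} {g : MetricField n}

theorem dRadial_smul_fun {F : Type*} [NormedAddCommGroup F] [NormedSpace ℝ F]
    {a : Pt n × Pt n → ℝ} {b : Pt n × Pt n → F} {z : Pt n × Pt n}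
    (hz : z ∈ slitInt n) (ha : DifferentiableAt ℝ (a ∘ radial g) z)
    (hb : DifferentiableAt ℝ (b ∘ radial g) z) (p : Pt n × Pt n) :
    dRadial g (fun y => a y • b y) z p
      = a (radial g z) • dRadial g b z p + dRadial g a z p • b (radial g z) := by
  have h := (ha.hasFDerivAt.fun_smul hb.hasFDerivAt).fderiv
  rw [dRadial_eq_fderiv _ hz, dRadial_eq_fderiv _ hz, dRadial_eq_fderiv _ hz]
  have h2 : (fun y => a y • b y) ∘ radial g = fun y => (a ∘ radial g) y • (b ∘ radial g) y := rfl
  rw [h2, h]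
  simp

theorem dRadial_mul {a b : Pt n × Pt n → ℝ} {z : Pt n × Pt n}
    (hz : z ∈ slitInt n) (ha : DifferentiableAt ℝ (a ∘ radial g) z)
    (hb : DifferentiableAt ℝ (b ∘ radial g) z) (p : Pt n × Pt n) :
    dRadial g (fun y => a y * b y) z p
      = a (radial g z) * dRadial g b z p + dRadial g a z p * b (radial g z) :=
  dRadial_smul_fun hz ha hb p

theorem hasFDerivAt_fst_comp {F : Type*} [NormedAddCommGroup F] [NormedSpace ℝ F] {c : Pt n → F}
    {z : Pt n × Pt n} (hc : DifferentiableAt ℝ c z.1) :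
    HasFDerivAt ((fun y : Pt n × Pt n => c y.1) ∘ radial g)
      (fderiv ℝ c z.1 ∘L ContinuousLinearMap.fst ℝ (Pt n) (Pt n)) z :=
  hc.hasFDerivAt.comp z hasFDerivAt_fst

theorem dRadial_fst {F : Type*} [NormedAddCommGroup F] [NormedSpace ℝ F] {c : Pt n → F}
    {z : Pt n × Pt n} (hz : z ∈ slitInt n)
    (hc : DifferentiableAt ℝ c z.1) (p : Pt n × Pt n) :
    dRadial g (fun y => c y.1) z p = fderiv ℝ c z.1 p.1 := by
  rw [dRadial_eq_fderiv _ hz, (hasFDerivAt_fst_comp hc).fderiv]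
  rfl

/-- Euler's relation in degree 0: the extension is constant along rays. -/
theorem dRadial_euler {F : Type*} [NormedAddCommGroup F] [NormedSpace ℝ F] (f : Pt n × Pt n → F)
    {z : Pt n × Pt n} (hz : z ∈ slitInt n) (hf : DifferentiableAt ℝ (f ∘ radial g) z) :
    dRadial g f z (0, z.2) = 0 := by
  rw [dRadial_eq_fderiv f hz]
  have h1 : HasDerivAt (fun t : ℝ => ((z.1, t • z.2) : Pt n × Pt n)) (0, z.2) 1 := by
    have := ((hasDerivAt_const (1 : ℝ) z.1).prodMk ((hasDerivAt_id (1 : ℝ)).smul_const z.2))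
    simpa using this
  have h2 : HasFDerivAt (f ∘ radial g) (fderiv ℝ (f ∘ radial g) z) (z.1, (1 : ℝ) • z.2) := by
    rw [one_smul]
    exact hf.hasFDerivAt
  have h3 := h2.comp_hasDerivAt (1 : ℝ) h1
  have h4 : (f ∘ radial g) ∘ (fun t : ℝ => ((z.1, t • z.2) : Pt n × Pt n))
      =ᶠ[𝓝 1] fun _ => (f ∘ radial g) z := by
    filter_upwards [lt_mem_nhds (zero_lt_one' ℝ)] with t ht
    simp [Function.comp, radial_smul _ _ ht]
  exact h3.unique ((hasDerivAt_const (1 : ℝ) _).congr_of_eventuallyEq h4)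

/-- The coefficient of the radial part of `∂_{v^k}`. -/
noncomputable def radCoeff (g : MetricField n) (k : Fin n) (z : Pt n × Pt n) : ℝ :=
  gInner g z.1 (e k) z.2 / gInner g z.1 z.2 z.2

/-- The part of `∂_{v^k}` tangent to the spheres. -/
noncomputable def vproj (g : MetricField n) (k : Fin n) (z : Pt n × Pt n) : Pt n × Pt n :=
  (0, e k - radCoeff g k z • z.2)

theorem IsC11Metric.contDiffOn_radCoeff (hg : IsC11Metric g) (k : Fin n) :
    ContDiffOn ℝ 1 (radCoeff g k) (slitTM n) :=
  (hg.contDiffOn_gInner contDiffOn_fst (fun _ hz => hz.1) contDiffOn_const contDiffOn_snd).div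
    (hg.contDiffOn_gInner contDiffOn_fst (fun _ hz => hz.1) contDiffOn_snd contDiffOn_snd)
    fun _ hz => (hg.gInner_pos hz.1 hz.2).ne'

theorem IsC11Metric.locallyLipschitzOn_vproj (hg : IsC11Metric g) (k : Fin n) :
    LocallyLipschitzOn (slitInt n) (vproj g k) :=
  locallyLipschitzOn_of_contDiffOn isOpen_slitInt ((contDiffOn_const.prodMk
    (contDiffOn_const.sub ((hg.contDiffOn_radCoeff k).smul contDiffOn_snd))).mono slitInt_subset)

theorem IsC11Metric.differentiableAt_radCoeff (hg : IsC11Metric g) (k : Fin n) {z : Pt n × Pt n}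
    (hz : z ∈ slitInt n) : DifferentiableAt ℝ (radCoeff g k) z :=
  ((hg.contDiffOn_radCoeff k).differentiableOn one_ne_zero z
    (slitInt_subset hz)).differentiableAt (slitTM_mem_nhds hz)

/-- Euler's relation in degree -1, read off by differentiating the product of the coefficient with
|v|², which is linear in v. -/
theorem IsC11Metric.fderiv_radCoeff_euler (hg : IsC11Metric g) (k : Fin n) {z : Pt n × Pt n}
    (hz : z ∈ slitInt n) : fderiv ℝ (radCoeff g k) z (0, z.2) = -radCoeff g k z := by
  have hpos := hg.gInner_pos (ball_subset_M hz.1) hz.2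
  obtain ⟨d1, h1⟩ := hg.fderiv_gInner (P := fun _ => e k) (R := Prod.snd) hz.1
    (differentiableAt_const _) differentiableAt_snd
  obtain ⟨d2, h2⟩ := hg.fderiv_gInner (P := Prod.snd) (R := Prod.snd) hz.1
    differentiableAt_snd differentiableAt_snd
  have h3 := ((hg.differentiableAt_radCoeff k hz).hasFDerivAt.fun_mul d2.hasFDerivAt).fderiv
  have h4 : (fun y => radCoeff g k y * gInner g y.1 y.2 y.2)
      =ᶠ[𝓝 z] fun y => gInner g y.1 (e k) y.2 := by
    filter_upwards [slitTM_mem_nhds hz] with y hy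
    exact div_mul_cancel₀ _ (hg.gInner_pos hy.1 hy.2).ne'
  have h1' := h1 (0, z.2)
  have h2' := h2 (0, z.2)
  simp only [fderiv_snd, fderiv_fun_const, Pi.zero_apply, zero_apply, chr_zero_left, zero_add,
    ContinuousLinearMap.coe_snd', gInner_zero_left] at h1' h2'
  have h5 := h4.self_of_nhds
  rw [h4.fderiv_eq] at h3
  rw [h3] at h1'
  simp only [smul_apply, add_apply, smul_eq_mul, h2', ← h5] at h1'
  exact mul_right_cancel₀ hpos.ne' (by linear_combination h1')

theorem IsC11Metric.fderiv_vproj (hg : IsC11Metric g) (k : Fin n) {z : Pt n × Pt n}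
    (hz : z ∈ slitInt n) (p : Pt n × Pt n) :
    fderiv ℝ (vproj g k) z p
      = (0, -(fderiv ℝ (radCoeff g k) z p • z.2 + radCoeff g k z • p.2)) := by
  have h := ((hasFDerivAt_const (0 : Pt n) z).prodMk ((hasFDerivAt_const (e k : Pt n) z).fun_sub
    ((hg.differentiableAt_radCoeff k hz).hasFDerivAt.fun_smul hasFDerivAt_snd))).fderiv
  have h2 : vproj g k = fun z => (0, e k - radCoeff g k z • z.2) := rfl
  rw [h2, h]
  simp
  abel

/-- The source of the factor n - 1: the divergence of the radial field v contributes n, and the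
coefficient, being of degree -1, takes back one. -/
theorem IsC11Metric.div_vproj (hg : IsC11Metric g) (k : Fin n) {z : Pt n × Pt n}
    (hz : z ∈ slitInt n) :
    divFrame frE frL (vproj g k) z = -(((n : ℝ) - 1) * radCoeff g k z) := by
  simp only [divFrame_eq, hg.fderiv_vproj k hz]
  have h1 := clm_snd_eq_sum (fderiv ℝ (radCoeff g k) z) z.2
  rw [hg.fderiv_radCoeff_euler k hz] at h1
  have h2 : ∀ j : Fin n, (e j : Pt n) j = 1 := fun j => by simp [e]
  simp only [WithLp.ofLp_zero, Pi.zero_apply, Finset.sum_const_zero, zero_add, WithLp.ofLp_neg,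
    Pi.neg_apply, WithLp.ofLp_add, Pi.add_apply, WithLp.ofLp_smul, Pi.smul_apply, smul_eq_mul, h2,
    Finset.sum_neg_distrib, Finset.sum_add_distrib, mul_one, Finset.sum_const, Finset.card_univ,
    Fintype.card_fin, nsmul_eq_mul] at h1 ⊢
  have h3 : ∑ j, fderiv ℝ (radCoeff g k) z (0, e j) * z.2 j = -radCoeff g k z := by
    rw [h1]
    exact Finset.sum_congr rfl fun j _ => by ring
  rw [h3]
  ring

theorem IsC11Metric.fderiv_weight_vproj (hg : IsC11Metric g) {φ : ℝ → ℝ} (hφ : ContDiff ℝ 1 φ)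
    {z : Pt n × Pt n} (hz : z ∈ slitInt n) (k : Fin n) :
    fderiv ℝ (weight g φ) z (vproj g k z) = 0 := by
  have hpos := hg.gInner_pos (ball_subset_M hz.1) hz.2
  rw [vproj, hg.fderiv_weight_snd hφ hz.1, gInner_sub_left, gInner_smul_left, radCoeff]
  field_simp
  ring

/-- By Euler's relation, ∂_{v^k} may be replaced on radial extensions by its part tangent to the
spheres. That part annihilates the weight, at the price of a divergence. This is needed when no
field orthogonal to v is at hand to remove the derivative of the weight. -/
theorem dRadial_vproj {f : Pt n × Pt n → ℝ} {z : Pt n × Pt n} (hz : z ∈ slitInt n)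
    (hf : DifferentiableAt ℝ (f ∘ radial g) z) (k : Fin n) :
    dRadial g f z (vproj g k z) = dRadial g f z (0, e k) := by
  have : vproj g k z = (0, e k) - radCoeff g k z • (0, z.2) := by
    simp [vproj]
  rw [this, map_sub, map_smul, dRadial_euler f hz hf, smul_zero, sub_zero]

/-- Besides the Christoffel term the bracket has only a multiple of the radial field, which Euler's
relation discards. -/
theorem IsC11Metric.dRadial_bracket_vproj (hg : IsC11Metric g) {f : Pt n × Pt n → ℝ}
    {z : Pt n × Pt n} (hz : z ∈ slitInt n) (hf : DifferentiableAt ℝ (f ∘ radial g) z)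
    (hc : ChrDiffAt g z.1) (j k : Fin n) :
    dRadial g f z (fderiv ℝ (vproj g k) z (hlift g (e j) z)
      - fderiv ℝ (hlift g (e j)) z (vproj g k z)) = dRadial g f z (0, chr g z.1 (e j) (e k)) := by
  rw [hg.fderiv_vproj k hz, hc.fderiv_hlift]
  have : (((0 : Pt n), -(fderiv ℝ (radCoeff g k) z (hlift g (e j) z) • z.2
        + radCoeff g k z • (hlift g (e j) z).2)) : Pt n × Pt n)
      - (0, -(dchr g z.1 (vproj g k z).1 (e j) z.2 + chr g z.1 (e j) (vproj g k z).2))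
      = (0, chr g z.1 (e j) (e k)) - fderiv ℝ (radCoeff g k) z (hlift g (e j) z) • (0, z.2) := by
    refine Prod.ext (by simp) ?_
    change -(fderiv ℝ (radCoeff g k) z (hlift g (e j) z) • z.2
        + radCoeff g k z • -chr g z.1 (e j) z.2)
      - -(dchr g z.1 0 (e j) z.2 + chr g z.1 (e j) (e k - radCoeff g k z • z.2))
      = chr g z.1 (e j) (e k) - fderiv ℝ (radCoeff g k) z (hlift g (e j) z) • z.2
    rw [dchr_zero_left, sub_eq_add_neg (e k : Pt n), chr_add_right, chr_neg_right, chr_smul_right]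
    module
  rw [this, map_sub, map_smul, dRadial_euler f hz hf, smul_zero, sub_zero]

theorem IsC11Metric.sum_inv_mul_radCoeff (hg : IsC11Metric g) {z : Pt n × Pt n}
    (hz : z ∈ slitTM n) (j : Fin n) :
    ∑ k, (g z.1)⁻¹ j k * radCoeff g k z = z.2 j / gNorm g z.1 z.2 ^ 2 := by
  have h1 : ∀ k, gInner g z.1 (e k) z.2 = ∑ l, g z.1 k l * z.2 l := by
    intro k
    rw [gInner, Finset.sum_comm]
    refine Finset.sum_congr rfl fun l _ => ?_
    rw [← sum_mul_ite_e (fun i => g z.1 i l * z.2 l) k]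
    exact Finset.sum_congr rfl fun i _ => by ring
  rw [hg.gNorm_sq hz.1]
  simp only [radCoeff, h1, ← mul_div_assoc, ← Finset.sum_div, Finset.mul_sum]
  congr 1
  rw [Finset.sum_comm]
  simp only [← mul_assoc, ← Finset.sum_mul, sum_inv_mul hg hz.1]
  simp

/-- The contracted form of ∇g⁻¹ = 0. In the commutator of the gradients these are the terms from
differentiating g^{jk}, from the divergence of the lifts and from the brackets; they cancel. -/
theorem IsC11Metric.sum_fderiv_inv_trace (hg : IsC11Metric g) {x : Pt n}
    (hx : x ∈ Metric.ball (0 : Pt n) 1) (T : Pt n →L[ℝ] ℝ) :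
    ∑ j, ∑ k, ((fderiv ℝ (fun y => (g y)⁻¹ j k) x (e j) + (g x)⁻¹ j k * trChr g j x) * T (e k)
      + (g x)⁻¹ j k * T (chr g x (e j) (e k))) = 0 := by
  have hxM := ball_subset_M hx
  have h1 : ∀ j k, T (chr g x (e j) (e k)) = ∑ l, christoffel g l j k x * T (e l) := by
    intro j k
    rw [clm_eq_sum]
    refine Finset.sum_congr rfl fun l _ => ?_
    rw [chr_e_left, smul_eq_mul, sum_mul_ite_e (fun m => christoffel g l j m x) k]
  simp only [hg.fderiv_inv hx, h1, add_mul, sub_mul, neg_mul, Finset.sum_add_distrib,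
    Finset.sum_sub_distrib, Finset.sum_neg_distrib, Finset.sum_mul, Finset.mul_sum]
  have h2 : ∑ j, ∑ k, ∑ m, christoffel g j j m x * (g x)⁻¹ m k * T (e k)
      = ∑ j, ∑ k, (g x)⁻¹ j k * trChr g j x * T (e k) := by
    simp only [trChr, Finset.mul_sum, Finset.sum_mul]
    rw [Finset.sum_comm, Finset.sum_congr rfl fun k _ => Finset.sum_comm]
    rw [Finset.sum_comm]
    refine Finset.sum_congr rfl fun j _ => Finset.sum_congr rfl fun k _ =>
      Finset.sum_congr rfl fun m _ => ?_
    rw [hg.christoffel_symm hxM m m j]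
    ring
  have h3 : ∑ j, ∑ k, ∑ m, (g x)⁻¹ j m * christoffel g k j m x * T (e k)
      = ∑ j, ∑ k, ∑ l, (g x)⁻¹ j k * (christoffel g l j k x * T (e l)) := by
    refine Finset.sum_congr rfl fun j _ => ?_
    rw [Finset.sum_comm]
    exact Finset.sum_congr rfl fun k _ => Finset.sum_congr rfl fun m _ => by ring
  rw [h2, h3]
  ring

theorem IsC11Metric.lipSM_inv (hg : IsC11Metric g) (j k : Fin n) :
    LipSM g (fun z => (g z.1)⁻¹ j k) :=
  lipSM_fst_comp (locallyLipschitzOn_M_of_contDiffOn (hg.contDiffOn_inv j k))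

/-- The commutator of the gradients in weak form. -/
theorem IsC11Metric.integral_commutator_gradients (hg : IsC11Metric g) (hn : n ≠ 0)
    {u w : Pt n × Pt n → ℝ} (hu : LipSM g u) (hw : LipSM g w) (hs : XSupp w) :
    ∫ z, (∑ j, ∑ k, (g z.1)⁻¹ j k * (delta g j w z * partialV g k u z
        - partialV g k w z * delta g j u z) + ((n : ℝ) - 1) * (w z * geoX g u z)) ∂(sigma g) = 0 := by
  have hW : ∀ j k, LipSM g (fun z => w z * (g z.1)⁻¹ j k) := fun j k => hw.mul (hg.lipSM_inv j k)
  have hWs : ∀ j k, XSupp (fun z => w z * (g z.1)⁻¹ j k) := fun j k => hs.mul_right _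
  have hC := fun j k => hg.exists_compact_testFn id_mul_phi_zero (hWs j k)
  choose K hK hKs hK0 using hC
  -- The bracket formula for the lift of e_j and the tangential part of ∂_{v^k}, contracted with
  -- g^{jk}. The weight tφ(t) again offsets the negative degree.
  have h := HasZeroIntegral.sum (μ := volume) Finset.univ fun j _ =>
    HasZeroIntegral.sum (μ := volume) Finset.univ fun k _ =>
    hasZeroIntegral_bracket volume sum_frL_smul isOpen_slitInt (hK j k) (hKs j k)
    (hg.locallyLipschitzOn_testFn contDiff_id_mul_phi (hW j k)) (hK0 j k)
    (hg.locallyLipschitzOn_hlift (A := fun _ => e j) contDiff_const)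
    (hg.locallyLipschitzOn_vproj k) hu
  refine hg.integral_eq_zero_of_hasZeroIntegral hn h 1 ?_ ?_ ?_
  · exact (Finset.aestronglyMeasurable_fun_sum _ fun j _ => Finset.aestronglyMeasurable_fun_sum _
      fun k _ => (hg.aestronglyMeasurable_of_continuousOn hn (hg.continuousOn_inv j k)).mul
        (((hg.aestronglyMeasurable_delta hn j w).mul (hg.aestronglyMeasurable_partialV hn k u)).sub
        ((hg.aestronglyMeasurable_partialV hn k w).mul (hg.aestronglyMeasurable_delta hn j u)))).add
      (((hw.aestronglyMeasurable hg hn).mul (hg.aestronglyMeasurable_geoX hn u)).const_mul _)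
  · filter_upwards [hu.ae_differentiableAt, hw.ae_differentiableAt, hg.ae_chrDiffAt]
      with z hu' hw' hc' hz
    have hzs := slitInt_subset hz
    have hpos := hg.gNorm_pos hzs.1 hzs.2
    have hud := hu' hz
    have hwd := hw' hz
    have hc := hc' hz
    have hwx : (g (radial g z).1) = g z.1 := rfl
    have hprod : ∀ j k p, dRadial g (fun z => w z * (g z.1)⁻¹ j k) z p
        = w (radial g z) * fderiv ℝ (fun y => (g y)⁻¹ j k) z.1 p.1
          + dRadial g w z p * (g z.1)⁻¹ j k := fun j k p => by
      rw [dRadial_mul (b := fun y => (g y.1)⁻¹ j k) hz hwd (hasFDerivAt_fst_comp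
        (hg.differentiableAt_inv hz.1 j k)).differentiableAt,
        dRadial_fst (c := fun y => (g y)⁻¹ j k) hz (hg.differentiableAt_inv hz.1 j k), hwx]
    have hWd : ∀ j k, DifferentiableAt ℝ ((fun z => w z * (g z.1)⁻¹ j k) ∘ radial g) z :=
      fun j k => hwd.mul (hasFDerivAt_fst_comp (c := fun y => (g y)⁻¹ j k)
        (hg.differentiableAt_inv hz.1 j k)).differentiableAt
    have hterm : ∀ j k, (testFn g (fun t => t * phi t) (fun z => w z * (g z.1)⁻¹ j k) z
            * divFrame frE frL (hlift g (e j)) z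
          + fderiv ℝ (testFn g (fun t => t * phi t) fun z => w z * (g z.1)⁻¹ j k) z
            (hlift g (e j) z)) * fderiv ℝ (u ∘ radial g) z (vproj g k z)
        - (testFn g (fun t => t * phi t) (fun z => w z * (g z.1)⁻¹ j k) z
            * divFrame frE frL (vproj g k) z
          + fderiv ℝ (testFn g (fun t => t * phi t) fun z => w z * (g z.1)⁻¹ j k) z
            (vproj g k z)) * fderiv ℝ (u ∘ radial g) z (hlift g (e j) z)
        + testFn g (fun t => t * phi t) (fun z => w z * (g z.1)⁻¹ j k) z
          * fderiv ℝ (u ∘ radial g) z (fderiv ℝ (vproj g k) z (hlift g (e j) z)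
              - fderiv ℝ (hlift g (e j)) z (vproj g k z))
        = weight g (fun t => t * phi t) z * (w (radial g z) *
            ((fderiv ℝ (fun y => (g y)⁻¹ j k) z.1 (e j) + (g z.1)⁻¹ j k * trChr g j z.1)
              * (dRadial g u z ∘L ContinuousLinearMap.inr ℝ (Pt n) (Pt n)) (e k)
              + (g z.1)⁻¹ j k * (dRadial g u z ∘L ContinuousLinearMap.inr ℝ (Pt n) (Pt n))
                (chr g z.1 (e j) (e k)))
          + (g z.1)⁻¹ j k * (dRadial g w z (hlift g (e j) z) * dRadial g u z (0, e k)
            - dRadial g w z (0, e k) * dRadial g u z (hlift g (e j) z))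
          + ((n : ℝ) - 1) * w (radial g z) * dRadial g u z (hlift g (e j) z)
            * ((g z.1)⁻¹ j k * radCoeff g k z)) := by
      intro j k
      have e1 := hg.weight_div_hlift contDiff_id_mul_phi hz.1 hc j
      have e2 := hg.dRadial_bracket_vproj hz hud hc j k
      have e3 := dRadial_vproj hz hud k
      have e4 := dRadial_vproj hz hwd k
      rw [← dRadial_eq_fderiv u hz, e2, hg.fderiv_testFn contDiff_id_mul_phi hz (hWd j k),
        hg.fderiv_testFn contDiff_id_mul_phi hz (hWd j k), hprod, hprod,
        hg.fderiv_weight_vproj contDiff_id_mul_phi hz, hg.div_vproj k hz, testFn, e3, e4, hwx]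
      have e5 : (hlift g (e j) z).1 = e j := rfl
      have e6 : (vproj g k z).1 = 0 := rfl
      rw [e5, e6, map_zero]
      simp only [ContinuousLinearMap.comp_apply, ContinuousLinearMap.inr_apply]
      linear_combination (w (radial g z) * (g z.1)⁻¹ j k * dRadial g u z (0, e k)) * e1
    rw [Finset.sum_congr rfl fun j _ => Finset.sum_congr rfl fun k _ => hterm j k]
    have e7 := hg.sum_fderiv_inv_trace hz.1
      (dRadial g u z ∘L ContinuousLinearMap.inr ℝ (Pt n) (Pt n))
    have e8 : ∑ j, dRadial g u z (hlift g (e j) z) * z.2 j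
        = gNorm g z.1 z.2 * geoX g u (radial g z) := by
      rw [← hg.geoX_eq_radial u hzs, spray_eq, ← sum_smul_hlift z.2, map_sum]
      exact Finset.sum_congr rfl fun j _ => by rw [map_smul, smul_eq_mul, mul_comm]
    simp only [← Finset.mul_sum, mul_add, Finset.sum_add_distrib] at e7 ⊢
    rw [eq_neg_of_add_eq_zero_right e7]
    simp only [hg.sum_inv_mul_radCoeff hzs]
    -- The divergences of the tangential fields, contracted with g^{jk}, give v^j/|v|², and v^j δ_j
    -- u is Xu.
    have e9 : ∑ j, ((n : ℝ) - 1) * w (radial g z) * dRadial g u z (hlift g (e j) z)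
        * (z.2 j / gNorm g z.1 z.2 ^ 2)
        = ((n : ℝ) - 1) * w (radial g z) * (gNorm g z.1 z.2)⁻¹ * geoX g u (radial g z) := by
      have : ∀ j, ((n : ℝ) - 1) * w (radial g z) * dRadial g u z (hlift g (e j) z)
          * (z.2 j / gNorm g z.1 z.2 ^ 2) = ((n : ℝ) - 1) * w (radial g z)
            / gNorm g z.1 z.2 ^ 2 * (dRadial g u z (hlift g (e j) z) * z.2 j) := fun j => by ring
      rw [Finset.sum_congr rfl fun j _ => this j, ← Finset.mul_sum, e8]
      field_simp
    rw [e9]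
    simp only [hg.partialV_eq_radial _ hzs, hg.delta_eq_radial _ hzs, hwx]
    have e10 : ∑ j, ∑ k, (g z.1)⁻¹ j k * (delta g j w (radial g z)
          * ((gNorm g z.1 z.2)⁻¹ * partialV g k u (radial g z))
          - (gNorm g z.1 z.2)⁻¹ * partialV g k w (radial g z) * delta g j u (radial g z))
        = (gNorm g z.1 z.2)⁻¹ * ∑ j, ∑ k, (g z.1)⁻¹ j k * (delta g j w (radial g z)
          * partialV g k u (radial g z) - partialV g k w (radial g z) * delta g j u (radial g z)) := by
      simp only [Finset.mul_sum]
      exact Finset.sum_congr rfl fun j _ => Finset.sum_congr rfl fun k _ => by ring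
    rw [e10, hg.weight_eq hzs.1]
    field_simp
    ring
  · intro z hz
    refine Finset.sum_eq_zero fun j _ => Finset.sum_eq_zero fun k _ => ?_
    have hzK : z ∉ K j k := fun h => hz (hKs j k h)
    rw [hK0 j k z hzK, fderiv_eq_zero_of_notMem (hK j k).isClosed (hK0 j k) hzK]
    simp

end GradientCommutator

end SimpleC11

namespace SimpleC11

/-! ### Convergence in `L^p` -/

section Convergence

variable {α : Type*} [MeasurableSpace α] {μ : Measure α} {p : ℝ≥0∞}

/-- Convergence in `L^p`. -/
structure LTo (μ : Measure α) (p : ℝ≥0∞) (fk : ℕ → α → ℝ) (f : α → ℝ) : Prop where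
  memLp_seq : ∀ k, MemLp (fk k) p μ
  memLp : MemLp f p μ
  tendsto : Tendsto (fun k => eLpNorm (fun z => fk k z - f z) p μ) atTop (𝓝 0)

theorem LTo.const {f : α → ℝ} (hf : MemLp f p μ) : LTo μ p (fun _ => f) f :=
  ⟨fun _ => hf, hf, by simp⟩

theorem LTo.add (hp : 1 ≤ p) {fk hk : ℕ → α → ℝ} {f h : α → ℝ} (hf : LTo μ p fk f)
    (hh : LTo μ p hk h) : LTo μ p (fun k z => fk k z + hk k z) (fun z => f z + h z) := by
  refine ⟨fun k => (hf.1 k).add (hh.1 k), hf.2.add hh.2, ?_⟩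
  have h0 := hf.3.add hh.3
  rw [add_zero] at h0
  refine tendsto_of_tendsto_of_tendsto_of_le_of_le tendsto_const_nhds h0 (fun _ => zero_le)
    fun k => ?_
  have h1 := eLpNorm_add_le ((hf.1 k).sub hf.2).1 ((hh.1 k).sub hh.2).1 hp
  refine le_trans (le_of_eq ?_) h1
  congr 1
  funext z
  simp only [Pi.add_apply, Pi.sub_apply]
  ring

theorem LTo.neg {fk : ℕ → α → ℝ} {f : α → ℝ} (hf : LTo μ p fk f) :
    LTo μ p (fun k z => -fk k z) (fun z => -f z) := by
  refine ⟨fun k => (hf.1 k).neg, hf.2.neg, ?_⟩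
  convert hf.3 using 2 with k
  rw [← eLpNorm_neg]
  congr 1
  funext z
  simp only [Pi.neg_apply]
  ring

theorem LTo.sub (hp : 1 ≤ p) {fk hk : ℕ → α → ℝ} {f h : α → ℝ} (hf : LTo μ p fk f)
    (hh : LTo μ p hk h) : LTo μ p (fun k z => fk k z - hk k z) (fun z => f z - h z) := by
  simpa only [sub_eq_add_neg] using hf.add hp hh.neg

theorem LTo.sum (hp : 1 ≤ p) {ι : Type*} (s : Finset ι) {fk : ι → ℕ → α → ℝ} {f : ι → α → ℝ}
    (hf : ∀ i, LTo μ p (fk i) (f i)) :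
    LTo μ p (fun k z => ∑ i ∈ s, fk i k z) (fun z => ∑ i ∈ s, f i z) := by
  classical
  induction s using Finset.induction_on with
  | empty => simpa using LTo.const (μ := μ) (p := p) (MemLp.zero' (ε := ℝ))
  | insert i s hi ih => simpa only [Finset.sum_insert hi] using (hf i).add hp ih

theorem LTo.bdd_mul {fk : ℕ → α → ℝ} {f b : α → ℝ} (hb : MemLp b ∞ μ) (hf : LTo μ p fk f) :
    LTo μ p (fun k z => b z * fk k z) (fun z => b z * f z) := by
  refine ⟨fun k => (hf.1 k).mul' hb, hf.2.mul' hb, ?_⟩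
  have h0 := ENNReal.Tendsto.const_mul (a := eLpNorm b ∞ μ) hf.3 (Or.inr hb.2.ne)
  rw [mul_zero] at h0
  refine tendsto_of_tendsto_of_tendsto_of_le_of_le tendsto_const_nhds h0 (fun _ => zero_le)
    fun k => ?_
  have h1 := eLpNorm_smul_le_mul_eLpNorm (p := ∞) (q := p) (r := p) ((hf.1 k).sub hf.2).1 hb.1
  refine le_trans (le_of_eq ?_) h1
  congr 1
  funext z
  simp only [Pi.smul_apply', Pi.sub_apply, smul_eq_mul]
  ring

theorem LTo.mul_bdd {fk : ℕ → α → ℝ} {f b : α → ℝ} (hb : MemLp b ∞ μ) (hf : LTo μ p fk f) :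
    LTo μ p (fun k z => fk k z * b z) (fun z => f z * b z) := by
  simpa only [mul_comm] using hf.bdd_mul hb

theorem LTo.mul_memLp {fk : ℕ → α → ℝ} {f h : α → ℝ} (hf : LTo μ 2 fk f) (hh : MemLp h 2 μ) :
    LTo μ 1 (fun k z => fk k z * h z) (fun z => f z * h z) := by
  refine ⟨fun k => hh.mul' (hf.1 k), hh.mul' hf.2, ?_⟩
  have h0 := ENNReal.Tendsto.mul_const (b := eLpNorm h 2 μ) hf.3 (Or.inr hh.2.ne)
  rw [zero_mul] at h0
  refine tendsto_of_tendsto_of_tendsto_of_le_of_le tendsto_const_nhds h0 (fun _ => zero_le)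
    fun k => ?_
  have h1 := eLpNorm_smul_le_mul_eLpNorm (p := 2) (q := 2) (r := 1) hh.1 ((hf.1 k).sub hf.2).1
  refine le_trans (le_of_eq ?_) h1
  congr 1
  funext z
  simp only [Pi.smul_apply', Pi.sub_apply, smul_eq_mul]
  ring

theorem LTo.mul_sub_self {fk hk : ℕ → α → ℝ} {f h : α → ℝ} (hf : LTo μ 2 fk f)
    (hh : LTo μ 2 hk h) :
    LTo μ 1 (fun k z => (fk k z - f z) * (hk k z - h z)) (fun _ => 0) := by
  refine ⟨fun k => ((hh.1 k).sub hh.2).mul' ((hf.1 k).sub hf.2), MemLp.zero' (ε := ℝ), ?_⟩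
  have h0 := ENNReal.Tendsto.mul hf.3 (Or.inr ENNReal.zero_ne_top) hh.3
    (Or.inr ENNReal.zero_ne_top)
  rw [zero_mul] at h0
  refine tendsto_of_tendsto_of_tendsto_of_le_of_le tendsto_const_nhds h0 (fun _ => zero_le)
    fun k => ?_
  have h1 := eLpNorm_smul_le_mul_eLpNorm (p := 2) (q := 2) (r := 1) ((hh.1 k).sub hh.2).1
    ((hf.1 k).sub hf.2).1
  refine le_trans (le_of_eq ?_) h1
  congr 1
  funext z
  simp only [Pi.smul_apply', Pi.sub_apply, smul_eq_mul, sub_zero]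

theorem LTo.mul {fk hk : ℕ → α → ℝ} {f h : α → ℝ} (hf : LTo μ 2 fk f) (hh : LTo μ 2 hk h) :
    LTo μ 1 (fun k z => fk k z * hk k z) (fun z => f z * h z) := by
  -- f_k h_k = (f_k - f)(h_k - h) + f_k h + (h_k f - f h).
  have h1 := ((hf.mul_sub_self hh).add le_rfl (hf.mul_memLp hh.2)).add le_rfl
    ((hh.mul_memLp hf.2).sub le_rfl (LTo.const (hh.2.mul' hf.2)))
  convert h1 using 2
  · funext z
    ring
  · ring

theorem LTo.integral {fk : ℕ → α → ℝ} {f : α → ℝ} (hf : LTo μ 1 fk f) :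
    Tendsto (fun k => ∫ z, fk k z ∂μ) atTop (𝓝 (∫ z, f z ∂μ)) :=
  tendsto_integral_of_L1' f hf.2.1 (Eventually.of_forall fun k => memLp_one_iff_integrable.1 (hf.1 k))
    hf.3

/-- The passage of an integral identity from C¹ approximants to their Sobolev limit. -/
theorem LTo.integral_eq_zero {fk : ℕ → α → ℝ} {f : α → ℝ} (hf : LTo μ 1 fk f)
    (h0 : ∀ k, ∫ z, fk k z ∂μ = 0) : ∫ z, f z ∂μ = 0 :=
  tendsto_nhds_unique hf.integral (by simp only [h0]; exact tendsto_const_nhds)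

end Convergence

end SimpleC11

namespace SimpleC11

/-! ### Functions with bounded derivatives on the sphere bundle -/

section UnifLip

variable {n : ℕ} {g : MetricField n}

/-- Bounded functions on the sphere bundle, locally Lipschitz over the interior, with bounded
derivatives. -/
structure UnifLip (g : MetricField n) (f : Pt n × Pt n → ℝ) : Prop where
  lip : LipSM g f
  bdd : ∃ C, ∀ z ∈ SM g, |f z| ≤ C
  bddD : ∃ C, ∀ᵐ z ∂(sigma g), ‖dRadial g f z‖ ≤ C

theorem IsC1.lipSM {f : Pt n × Pt n → ℝ} (hf : IsC1 g f) : LipSM g f :=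
  locallyLipschitzOn_of_contDiffOn isOpen_slitInt (ContDiffOn.mono hf slitInt_subset)

theorem IsC1.continuousOn {f : Pt n × Pt n → ℝ} (hf : IsC1 g f) : ContinuousOn f (SM g) :=
  ((ContDiffOn.continuousOn hf).mono SM_subset_slitTM).congr fun z hz => by
    rw [Function.comp, radial_of_mem_SM hz]

theorem IsC1.unifLip (hg : IsC11Metric g) (hn : n ≠ 0) {f : Pt n × Pt n → ℝ} (hf : IsC1 g f) :
    UnifLip g f := by
  obtain ⟨C, hC⟩ := hg.isCompact_SM.exists_bound_of_continuousOn hf.continuousOn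
  obtain ⟨C', hC'⟩ := hg.isCompact_SM.exists_bound_of_continuousOn
    ((ContDiffOn.continuousOn_fderivWithin hf uniqueDiffOn_slitTM le_rfl).mono SM_subset_slitTM)
  exact ⟨hf.lipSM, ⟨C, hC⟩, C', (hg.ae_mem_SM hn).mono fun z hz => hC' z hz.1⟩

/-- The radial map is C¹ with derivative bounded on the compact set SM, so u∘r has near each
interior point of SM a Lipschitz constant independent of the point. -/
theorem unifLip_of_lipschitzOnWith (hg : IsC11Metric g) (hn : n ≠ 0) {f : Pt n × Pt n → ℝ}
    {K : ℝ≥0} (hf : LipschitzOnWith K f (SM g)) : UnifLip g f := by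
  obtain ⟨C, hC⟩ := hg.isCompact_SM.exists_bound_of_continuousOn hf.continuousOn
  obtain ⟨B, hB⟩ := hg.isCompact_SM.exists_bound_of_continuousOn
    ((hg.contDiffOn_radial.continuousOn_fderivWithin uniqueDiffOn_slitTM le_rfl).mono
      SM_subset_slitTM)
  refine ⟨locallyLipschitzOn_comp (locallyLipschitzOn_of_lipschitzOnWith hf)
    (locallyLipschitzOn_of_contDiffOn isOpen_slitInt (hg.contDiffOn_radial.mono slitInt_subset))
    (fun z hz => hg.radial_mem (slitInt_subset hz)), ⟨C, hC⟩, K * (B + 1).toNNReal,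
    (hg.ae_mem_SM hn).mono fun z hz => ?_⟩
  have hi : z ∈ slitInt n := ⟨hz.2, ne_zero_of_mem_SM hz.1⟩
  have hB1 := hB z hz.1
  rw [fderivWithin_of_mem_nhds (slitTM_mem_nhds hi)] at hB1
  -- A C¹ map is locally Lipschitz with any constant strictly larger than the norm of its
  -- derivative, hence B + 1.
  obtain ⟨t, ht, hL⟩ := (hg.contDiffOn_radial.contDiffAt
    (slitTM_mem_nhds hi)).exists_lipschitzOnWith_of_nnnorm_lt (B + 1).toNNReal (by
      rw [← NNReal.coe_lt_coe, coe_nnnorm, Real.coe_toNNReal _ (by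
        linarith [norm_nonneg (fderiv ℝ (radial g) z)])]
      linarith)
  rw [dRadial_eq_fderiv f hi]
  refine norm_fderiv_le_of_lipschitzOn ℝ (inter_mem ht (slitTM_mem_nhds hi)) (C := K * (B + 1).toNNReal) ?_
  exact hf.comp (hL.mono inter_subset_left) fun y hy => hg.radial_mem hy.2

theorem isC1_fst {c : Pt n → ℝ} (hc : ContDiff ℝ 1 c) : IsC1 g (fun z => c z.1) :=
  (hc.comp contDiff_fst).contDiffOn

theorem IsC1.mul {f h : Pt n × Pt n → ℝ} (hf : IsC1 g f) (hh : IsC1 g h) :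
    IsC1 g (fun z => f z * h z) := ContDiffOn.mul hf hh

theorem IsC11Metric.isC1_snd_apply (hg : IsC11Metric g) (j : Fin n) : IsC1 g (fun z => z.2 j) :=
  contDiffOn_euclidean.1 hg.contDiffOn_radial.snd j

theorem IsC1N.apply {W : Pt n × Pt n → Pt n} (hW : IsC1N g W) (k : Fin n) :
    IsC1 g (fun z => W z k) := contDiffOn_euclidean.1 hW.contDiff k

theorem IsC1N.lipSM {W : Pt n × Pt n → Pt n} (hW : IsC1N g W) : LipSM g W :=
  locallyLipschitzOn_of_contDiffOn isOpen_slitInt (hW.contDiff.mono slitInt_subset)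

theorem IsC1N.isC1_gInner (hg : IsC11Metric g) {V W : Pt n × Pt n → Pt n} (hV : IsC1N g V)
    (hW : IsC1N g W) : IsC1 g (fun z => gInner g z.1 (V z) (W z)) :=
  hg.contDiffOn_gInner contDiffOn_fst (fun _ hz => hz.1) hV.contDiff hW.contDiff

theorem IsC1N.smul {f : Pt n × Pt n → ℝ} {W : Pt n × Pt n → Pt n} (hf : IsC1 g f)
    (hW : IsC1N g W) : IsC1N g (fun z => f z • W z) :=
  ⟨ContDiffOn.smul hf hW.contDiff, fun z hz => by rw [gInner_smul_left, hW.orth z hz, mul_zero]⟩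

theorem IsC1N.sub {V W : Pt n × Pt n → Pt n} (hV : IsC1N g V) (hW : IsC1N g W) :
    IsC1N g (fun z => V z - W z) :=
  ⟨hV.contDiff.sub hW.contDiff, fun z hz => by
    rw [gInner_sub_left, hV.orth z hz, hW.orth z hz, sub_zero]⟩

/-! ### Differentiability almost everywhere -/

theorem differentiableAt_comp_radial_radial (hg : IsC11Metric g) (f : Pt n × Pt n → ℝ) {z : Pt n × Pt n}
    (hz : z ∈ slitTM n) (hd : DifferentiableAt ℝ (f ∘ radial g) z) :
    DifferentiableAt ℝ (f ∘ radial g) (radial g z) := by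
  have hs := hg.gNorm_pos hz.1 hz.2
  set s := gNorm g z.1 z.2
  have h1 : HasFDerivAt (fun y : Pt n × Pt n => (y.1, s • y.2))
      ((ContinuousLinearMap.fst ℝ (Pt n) (Pt n)).prod (s • ContinuousLinearMap.snd ℝ (Pt n) (Pt n)))
      (radial g z) := hasFDerivAt_fst.prodMk (hasFDerivAt_snd.const_smul s)
  have h2 : (((radial g z).1, s • (radial g z).2) : Pt n × Pt n) = z := by
    refine Prod.ext rfl ?_
    simp [radial, s, smul_smul, mul_inv_cancel₀ hs.ne']
  have h3 : f ∘ radial g = (f ∘ radial g) ∘ fun y : Pt n × Pt n => (y.1, s • y.2) := by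
    funext y
    simp [Function.comp, radial_smul _ _ hs]
  rw [h3]
  exact DifferentiableAt.comp _ (by rwa [h2]) h1.differentiableAt

/-- Rademacher's theorem says nothing directly on SM, a Lebesgue null set. But differentiability of
f∘r is invariant along rays, so it passes to almost every unit vector. -/
theorem LipSM.ae_differentiableAt_sigma (hg : IsC11Metric g) (hn : n ≠ 0) {f : Pt n × Pt n → ℝ}
    (hf : LipSM g f) : ∀ᵐ z ∂(sigma g), DifferentiableAt ℝ (f ∘ radial g) z := by
  refine hg.ae_of_ae_radial (measurableSet_of_differentiableAt ℝ _) ?_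
  filter_upwards [hf.ae_differentiableAt, volume_boundary hn] with z h1 h2 hz
  have hzi : z ∈ slitInt n := by
    refine ⟨?_, hz.2⟩
    have : ‖z.1‖ ≤ 1 := by simpa [M] using hz.1
    rw [Metric.mem_ball, dist_zero_right]
    exact lt_of_le_of_ne this h2
  exact differentiableAt_comp_radial_radial hg f hz (h1 hzi)

/-- Points of the sphere bundle over the interior at which the radial extension is
differentiable. -/
structure DiffPt (g : MetricField n) (f : Pt n × Pt n → ℝ) (z : Pt n × Pt n) : Prop where
  mem : z ∈ SM g
  int : z ∈ slitInt n
  diff : DifferentiableAt ℝ (f ∘ radial g) z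

theorem LipSM.ae_diffPt (hg : IsC11Metric g) (hn : n ≠ 0) {f : Pt n × Pt n → ℝ} (hf : LipSM g f) :
    ∀ᵐ z ∂(sigma g), DiffPt g f z := by
  filter_upwards [hf.ae_differentiableAt_sigma hg hn, hg.ae_mem_SM hn] with z h1 h2
  exact ⟨h2.1, ⟨h2.2, ne_zero_of_mem_SM h2.1⟩, h1⟩

theorem UnifLip.ae_diffPt (hg : IsC11Metric g) (hn : n ≠ 0) {f : Pt n × Pt n → ℝ}
    (hf : UnifLip g f) : ∀ᵐ z ∂(sigma g), DiffPt g f z := hf.lip.ae_diffPt hg hn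

theorem DiffPt.dRadial_mul {a b : Pt n × Pt n → ℝ} {z : Pt n × Pt n} (ha : DiffPt g a z)
    (hb : DiffPt g b z) (p : Pt n × Pt n) :
    dRadial g (fun y => a y * b y) z p = a z * dRadial g b z p + dRadial g a z p * b z := by
  rw [SimpleC11.dRadial_mul ha.int ha.diff hb.diff, radial_of_mem_SM ha.mem]

theorem DiffPt.delta_mul {a b : Pt n × Pt n → ℝ} {z : Pt n × Pt n} (ha : DiffPt g a z)
    (hb : DiffPt g b z) (j : Fin n) :
    delta g j (fun y => a y * b y) z = a z * delta g j b z + delta g j a z * b z := by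
  simp only [delta_eq, ha.dRadial_mul hb]

theorem DiffPt.partialV_mul {a b : Pt n × Pt n → ℝ} {z : Pt n × Pt n} (ha : DiffPt g a z)
    (hb : DiffPt g b z) (j : Fin n) :
    partialV g j (fun y => a y * b y) z = a z * partialV g j b z + partialV g j a z * b z := by
  simp only [partialV_eq, ha.dRadial_mul hb]

theorem DiffPt.geoX_mul {a b : Pt n × Pt n → ℝ} {z : Pt n × Pt n} (ha : DiffPt g a z)
    (hb : DiffPt g b z) :
    geoX g (fun y => a y * b y) z = a z * geoX g b z + geoX g a z * b z := by
  simp only [geoX_eq, ha.dRadial_mul hb]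

theorem IsC1.differentiableAt {f : Pt n × Pt n → ℝ} (hf : IsC1 g f) {z : Pt n × Pt n}
    (hz : z ∈ slitInt n) : DifferentiableAt ℝ (f ∘ radial g) z :=
  (ContDiffOn.differentiableOn hf one_ne_zero z (slitInt_subset hz)).differentiableAt
    (slitTM_mem_nhds hz)

theorem IsC1.diffPt {f : Pt n × Pt n → ℝ} (hf : IsC1 g f) {z : Pt n × Pt n}
    (hz : z ∈ SM g ∧ z.1 ∈ Metric.ball (0 : Pt n) 1) : DiffPt g f z :=
  ⟨hz.1, ⟨hz.2, ne_zero_of_mem_SM hz.1⟩, hf.differentiableAt ⟨hz.2, ne_zero_of_mem_SM hz.1⟩⟩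

theorem UnifLip.mul (hg : IsC11Metric g) (hn : n ≠ 0) {f h : Pt n × Pt n → ℝ} (hf : UnifLip g f)
    (hh : UnifLip g h) : UnifLip g (fun z => f z * h z) := by
  obtain ⟨A, hA⟩ := hf.bdd
  obtain ⟨B, hB⟩ := hh.bdd
  obtain ⟨A', hA'⟩ := hf.bddD
  obtain ⟨B', hB'⟩ := hh.bddD
  refine ⟨hf.lip.mul hh.lip, ⟨A * B, fun z hz => ?_⟩, A * B' + A' * B, ?_⟩
  · rw [abs_mul]
    exact mul_le_mul (hA z hz) (hB z hz) (abs_nonneg _) ((abs_nonneg _).trans (hA z hz))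
  · filter_upwards [hf.ae_diffPt hg hn, hh.ae_diffPt hg hn, hA', hB'] with z h1 h2 h3 h4
    have h5 : dRadial g (fun y => f y * h y) z = f z • dRadial g h z + h z • dRadial g f z := by
      ext p
      all_goals
        simp only [ContinuousLinearMap.comp_apply, h1.dRadial_mul h2, add_apply, smul_apply,
          smul_eq_mul]
        ring
    rw [h5]
    refine (norm_add_le _ _).trans ?_
    rw [norm_smul, norm_smul, Real.norm_eq_abs, Real.norm_eq_abs]
    have h6 := hA z h1.mem
    have h7 := hB z h1.mem
    have h8 := abs_nonneg (f z)
    have h9 := abs_nonneg (h z)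
    have h10 := norm_nonneg (dRadial g f z)
    have h11 := norm_nonneg (dRadial g h z)
    nlinarith [mul_le_mul h6 h4 h11 (h8.trans h6), mul_le_mul h3 h7 h9 (h10.trans h3)]

/-! ### Functions of the base point -/

theorem DiffPt.delta_fst {f : Pt n × Pt n → ℝ} {c : Pt n → ℝ} {z : Pt n × Pt n}
    (hz : DiffPt g f z) (hc : DifferentiableAt ℝ c z.1) (j : Fin n) :
    delta g j (fun y => c y.1) z = fderiv ℝ c z.1 (e j) := by
  rw [delta_eq, dRadial_fst hz.int hc, hlift]

theorem DiffPt.partialV_fst {f : Pt n × Pt n → ℝ} {c : Pt n → ℝ} {z : Pt n × Pt n}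
    (hz : DiffPt g f z) (hc : DifferentiableAt ℝ c z.1) (j : Fin n) :
    partialV g j (fun y => c y.1) z = 0 := by
  rw [partialV_eq, dRadial_fst hz.int hc, map_zero]

theorem DiffPt.geoX_fst {f : Pt n × Pt n → ℝ} {c : Pt n → ℝ} {z : Pt n × Pt n}
    (hz : DiffPt g f z) (hc : DifferentiableAt ℝ c z.1) :
    geoX g (fun y => c y.1) z = fderiv ℝ c z.1 z.2 := by
  rw [geoX_eq, dRadial_fst hz.int hc, spray]

/-! ### Bounded functions -/

theorem IsC11Metric.memLp_top_of_continuousOn (hg : IsC11Metric g) (hn : n ≠ 0)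
    {f : Pt n × Pt n → ℝ} (hf : ContinuousOn f (SM g)) : MemLp f ∞ (sigma g) := by
  obtain ⟨C, hC⟩ := hg.isCompact_SM.exists_bound_of_continuousOn hf
  exact memLp_top_of_bound (hg.aestronglyMeasurable_of_continuousOn hn hf) C
    ((hg.ae_mem_SM hn).mono fun z hz => hC z hz.1)

theorem IsC11Metric.memLp_top_snd (hg : IsC11Metric g) (hn : n ≠ 0) (j : Fin n) :
    MemLp (fun z : Pt n × Pt n => z.2 j) ∞ (sigma g) :=
  hg.memLp_top_of_continuousOn hn
    ((PiLp.continuous_apply 2 _ j).comp continuous_snd).continuousOn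

theorem IsC11Metric.memLp_top_fst (hg : IsC11Metric g) (hn : n ≠ 0) {c : Pt n → ℝ}
    (hc : ContinuousOn c (M n)) : MemLp (fun z : Pt n × Pt n => c z.1) ∞ (sigma g) :=
  hg.memLp_top_of_continuousOn hn (hc.comp continuousOn_fst fun _ hz => hz.1)

theorem UnifLip.memLp_top (hg : IsC11Metric g) (hn : n ≠ 0) {f : Pt n × Pt n → ℝ}
    (hf : UnifLip g f) : MemLp f ∞ (sigma g) := by
  obtain ⟨C, hC⟩ := hf.bdd
  exact memLp_top_of_bound (hf.lip.aestronglyMeasurable hg hn) C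
    ((hg.ae_mem_SM hn).mono fun z hz => hC z hz.1)

theorem UnifLip.memLp_top_dRadial (hg : IsC11Metric g) (hn : n ≠ 0) {f : Pt n × Pt n → ℝ}
    (hf : UnifLip g f) (p : Pt n × Pt n) : MemLp (fun z => dRadial g f z p) ∞ (sigma g) := by
  obtain ⟨C, hC⟩ := hf.bddD
  refine memLp_top_of_bound (hg.aestronglyMeasurable_dRadial hn f p) (C * ‖p‖) (hC.mono fun z hz => ?_)
  exact (ContinuousLinearMap.le_opNorm _ _).trans (mul_le_mul_of_nonneg_right hz (norm_nonneg _))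

theorem UnifLip.memLp_top_partialV (hg : IsC11Metric g) (hn : n ≠ 0) {f : Pt n × Pt n → ℝ}
    (hf : UnifLip g f) (j : Fin n) : MemLp (partialV g j f) ∞ (sigma g) :=
  hf.memLp_top_dRadial hg hn _

theorem IsC11Metric.memLp_top_christoffel (hg : IsC11Metric g) (hn : n ≠ 0) (l j k : Fin n) :
    MemLp (fun z : Pt n × Pt n => christoffel g l j k z.1) ∞ (sigma g) :=
  hg.memLp_top_of_continuousOn hn (hg.continuousOn_christoffel l j k)

theorem UnifLip.memLp_top_delta (hg : IsC11Metric g) (hn : n ≠ 0) {f : Pt n × Pt n → ℝ}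
    (hf : UnifLip g f) (j : Fin n) : MemLp (delta g j f) ∞ (sigma g) := by
  have h : ∀ l k, MemLp (fun z => (christoffel g l j k z.1 * z.2 k) • partialV g l f z) ∞
      (sigma g) := fun l k => (hf.memLp_top_partialV hg hn l).mul'
    (MemLp.mul' (r := ∞) (hg.memLp_top_snd hn k) (hg.memLp_top_christoffel hn l j k))
  unfold delta
  exact (hf.memLp_top_dRadial hg hn _).sub (memLp_finsetSum _ fun l _ => memLp_finsetSum _
    fun k _ => h l k)

theorem UnifLip.memLp_top_geoX (hg : IsC11Metric g) (hn : n ≠ 0) {f : Pt n × Pt n → ℝ}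
    (hf : UnifLip g f) : MemLp (geoX g f) ∞ (sigma g) := by
  unfold geoX
  exact memLp_finsetSum _ fun j _ => (hf.memLp_top_delta hg hn j).mul' (hg.memLp_top_snd hn j)

theorem IsC11Metric.memLp_top_riemann (hg : IsC11Metric g) (hn : n ≠ 0) (l i j k : Fin n) :
    MemLp (fun z : Pt n × Pt n => riemann g l i j k z.1) ∞ (sigma g) := by
  have h1 : ∀ l i j k, MemLp
      (fun z : Pt n × Pt n => partialX (christoffel g l j k) i z.1) ∞ (sigma g) := by
    intro l i j k
    obtain ⟨K, hK⟩ := hg.lipschitzOnWith_christoffel l j k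
    have h2 : Measurable fun z : Pt n × Pt n => fderiv ℝ (christoffel g l j k) z.1 (e i) :=
      (measurable_fderiv_apply_const ℝ _ _).comp measurable_fst
    have h3 : (fun z : Pt n × Pt n => fderiv ℝ (christoffel g l j k) z.1 (e i)) =ᵐ[sigma g]
        fun z => partialX (christoffel g l j k) i z.1 := by
      filter_upwards [hg.ae_mem_SM hn] with z hz
      rw [partialX, fderivWithin_of_mem_nhds (M_mem_nhds hz.2)]
    refine memLp_top_of_bound (h2.aestronglyMeasurable.congr h3) (K * ‖(e i : Pt n)‖) ?_
    filter_upwards [hg.ae_mem_SM hn] with z hz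
    rw [partialX, fderivWithin_of_mem_nhds (M_mem_nhds hz.2)]
    exact (ContinuousLinearMap.le_opNorm _ _).trans (mul_le_mul_of_nonneg_right
      (norm_fderiv_le_of_lipschitzOn ℝ (M_mem_nhds hz.2) hK) (norm_nonneg _))
  have hc := fun l j k => hg.memLp_top_christoffel hn l j k
  unfold riemann
  exact ((h1 l i j k).sub (h1 l j i k)).add (memLp_finsetSum _ fun m _ =>
    ((hc l i m).mul' (hc m j k)).sub ((hc l j m).mul' (hc m i k)))

end UnifLip

end SimpleC11

namespace SimpleC11

/-! ### Pairings with the gradients -/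

section Pairings

variable {n : ℕ} {g : MetricField n}

theorem IsC11Metric.gInner_raise (hg : IsC11Metric g) {x : Pt n} (hx : x ∈ M n) (a : Fin n → ℝ)
    (Y : Pt n) : gInner g x (WithLp.toLp 2 fun j => ∑ k, (g x)⁻¹ j k * a k) Y = ∑ k, a k * Y k := by
  rw [hg.gInner_comm hx]
  simp only [gInner, Finset.mul_sum]
  have h1 : ∀ i, ∑ j, ∑ k, g x i j * Y i * ((g x)⁻¹ j k * a k) = a i * Y i := by
    intro i
    rw [Finset.sum_comm]
    have : ∀ k, ∑ j, g x i j * Y i * ((g x)⁻¹ j k * a k)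
        = (∑ j, g x i j * (g x)⁻¹ j k) * (Y i * a k) := fun k => by
      rw [Finset.sum_mul]
      exact Finset.sum_congr rfl fun j _ => by ring
    simp only [this, sum_mul_inv hg hx, ite_mul, one_mul, zero_mul, Finset.sum_ite_eq,
      Finset.mem_univ, if_true]
    ring
  exact Finset.sum_congr rfl fun i _ => h1 i

theorem IsC11Metric.gInner_gradV_left (hg : IsC11Metric g) {z : Pt n × Pt n} (hz : z.1 ∈ M n)
    (u : Pt n × Pt n → ℝ) (Y : Pt n) :
    gInner g z.1 (gradV g u z) Y = ∑ k, partialV g k u z * Y k := hg.gInner_raise hz _ Y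

theorem IsC11Metric.gInner_gradH_left (hg : IsC11Metric g) {z : Pt n × Pt n} (hz : z.1 ∈ M n)
    (u : Pt n × Pt n → ℝ) (Y : Pt n) :
    gInner g z.1 (gradH g u z) Y
      = ∑ k, delta g k u z * Y k - geoX g u z * gInner g z.1 z.2 Y := by
  have h : gradH g u z = (WithLp.toLp 2 fun j => ∑ k, (g z.1)⁻¹ j k * delta g k u z)
      - geoX g u z • z.2 := rfl
  rw [h, gInner_sub_left, gInner_smul_left, hg.gInner_raise hz]

/-- This is Euler's relation: ∇^v u is a section of N. -/
theorem DiffPt.gInner_gradV_snd (hg : IsC11Metric g) {u : Pt n × Pt n → ℝ} {z : Pt n × Pt n}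
    (hz : DiffPt g u z) : gInner g z.1 (gradV g u z) z.2 = 0 := by
  rw [hg.gInner_gradV_left hz.mem.1]
  have h1 := clm_snd_eq_sum (dRadial g u z) z.2
  rw [dRadial_euler u hz.int hz.diff] at h1
  rw [h1]
  exact Finset.sum_congr rfl fun k _ => by rw [smul_eq_mul, mul_comm]; rfl

theorem DiffPt.geoXN_apply {W : Pt n × Pt n → Pt n} {z : Pt n × Pt n}
    (hW : ∀ k, DiffPt g (fun y => W y k) z) (hz : z ∈ slitInt n) (k : Fin n) :
    geoXN g W z k = geoX g (fun y => W y k) z + chr g z.1 z.2 (W z) k := by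
  have hd : DifferentiableAt ℝ (W ∘ radial g) z := differentiableAt_euclidean.2 fun k => (hW k).diff
  rw [geoXN_eq, geoX_eq, geoX_eq, dRadial_eq_fderiv _ hz, dRadial_eq_fderiv _ hz]
  have h := ((EuclideanSpace.proj k : Pt n →L[ℝ] ℝ).hasFDerivAt.comp z hd.hasFDerivAt).fderiv
  have h2 : (fun y => W y k) ∘ radial g = (EuclideanSpace.proj k : Pt n →L[ℝ] ℝ) ∘ W ∘ radial g :=
    rfl
  rw [h2, h]
  rfl

/-- The geodesic derivative of the inner product of sections. -/
theorem IsC1N.geoX_gInner (hg : IsC11Metric g) {V W : Pt n × Pt n → Pt n} (hV : IsC1N g V)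
    (hW : IsC1N g W) {z : Pt n × Pt n} (hz : z ∈ SM g ∧ z.1 ∈ Metric.ball (0 : Pt n) 1) :
    geoX g (fun y => gInner g y.1 (V y) (W y)) z
      = gInner g z.1 (geoXN g V z) (W z) + gInner g z.1 (V z) (geoXN g W z) := by
  have hi : z ∈ slitInt n := ⟨hz.2, ne_zero_of_mem_SM hz.1⟩
  have hd : ∀ {U : Pt n × Pt n → Pt n}, IsC1N g U → DifferentiableAt ℝ (U ∘ radial g) z :=
    fun hU => (hU.contDiff.differentiableOn one_ne_zero z (slitInt_subset hi)).differentiableAt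
      (slitTM_mem_nhds hi)
  have h := (hg.fderiv_gInner hz.2 (hd hV) (hd hW)).2 (spray g z)
  rw [geoX_eq, dRadial_eq_fderiv _ hi]
  have h2 : (fun y => gInner g y.1 (V y) (W y)) ∘ radial g
      = fun y => gInner g y.1 ((V ∘ radial g) y) ((W ∘ radial g) y) := rfl
  have h3 : ∀ U : Pt n × Pt n → Pt n, geoXN g U z
      = chr g z.1 (spray g z).1 ((U ∘ radial g) z) + fderiv ℝ (U ∘ radial g) z (spray g z) := by
    intro U
    rw [geoXN_eq, geoX_eq, dRadial_eq_fderiv _ hi, Function.comp, radial_of_mem_SM hz.1, add_comm]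
    rfl
  rw [h2, h, h3 V, h3 W]
  simp only [Function.comp, radial_of_mem_SM hz.1]

/-! ### Sections with components in `L^p` -/

theorem memLp_gInner_of (hg : IsC11Metric g) (hn : n ≠ 0) {p q r : ℝ≥0∞} [ENNReal.HolderTriple p q r]
    [ENNReal.HolderTriple ∞ p p]
    {V W : Pt n × Pt n → Pt n} (hV : ∀ i, MemLp (fun z => V z i) p (sigma g))
    (hW : ∀ i, MemLp (fun z => W z i) q (sigma g)) :
    MemLp (fun z => gInner g z.1 (V z) (W z)) r (sigma g) := by
  refine memLp_finsetSum _ fun i _ => memLp_finsetSum _ fun j _ => ?_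
  have h : MemLp (fun z => g z.1 i j * V z i) p (sigma g) :=
    (hV i).mul' (hg.memLp_top_fst hn (hg.contDiffOn i j).continuousOn)
  exact (hW j).mul' h

theorem lTo_gInner (hg : IsC11Metric g) (hn : n ≠ 0) {Vk Wk : ℕ → Pt n × Pt n → Pt n}
    {V W : Pt n × Pt n → Pt n} (hV : ∀ i, LTo (sigma g) 2 (fun k z => Vk k z i) (fun z => V z i))
    (hW : ∀ i, LTo (sigma g) 2 (fun k z => Wk k z i) (fun z => W z i)) :
    LTo (sigma g) 1 (fun k z => gInner g z.1 (Vk k z) (Wk k z))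
      (fun z => gInner g z.1 (V z) (W z)) :=
  LTo.sum le_rfl _ fun i => LTo.sum le_rfl _ fun j =>
    ((hV i).bdd_mul (hg.memLp_top_fst hn (hg.contDiffOn i j).continuousOn)).mul (hW j)

theorem memLp_curv_apply (hg : IsC11Metric g) (hn : n ≠ 0) {p : ℝ≥0∞} {W : Pt n × Pt n → Pt n}
    (hW : ∀ i, MemLp (fun z => W z i) p (sigma g)) (l : Fin n) :
    MemLp (fun z => curv g W z l) p (sigma g) := by
  have : MemLp (fun z : Pt n × Pt n => ∑ i, ∑ j, ∑ k,
      riemann g l i j k z.1 * W z i * z.2 j * z.2 k) p (sigma g) := by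
    refine memLp_finsetSum _ fun i _ => memLp_finsetSum _ fun j _ => memLp_finsetSum _ fun k _ => ?_
    have h1 : MemLp (fun z => riemann g l i j k z.1 * W z i) p (sigma g) :=
      (hW i).mul' (hg.memLp_top_riemann hn l i j k)
    have h2 : MemLp (fun z => riemann g l i j k z.1 * W z i * z.2 j) p (sigma g) :=
      (hg.memLp_top_snd hn j).mul' h1
    exact (hg.memLp_top_snd hn k).mul' h2
  exact this

theorem lTo_curv_apply (hg : IsC11Metric g) (hn : n ≠ 0) {p : ℝ≥0∞} (hp : 1 ≤ p)
    {Vk : ℕ → Pt n × Pt n → Pt n} {V : Pt n × Pt n → Pt n}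
    (hV : ∀ i, LTo (sigma g) p (fun k z => Vk k z i) (fun z => V z i)) (l : Fin n) :
    LTo (sigma g) p (fun k z => curv g (Vk k) z l) (fun z => curv g V z l) := by
  have h : LTo (sigma g) p
      (fun m z => ∑ i, ∑ j, ∑ k, riemann g l i j k z.1 * Vk m z i * z.2 j * z.2 k)
      (fun z => ∑ i, ∑ j, ∑ k, riemann g l i j k z.1 * V z i * z.2 j * z.2 k) :=
    LTo.sum hp _ fun i => LTo.sum hp _ fun j => LTo.sum hp _ fun k =>
      (((hV i).bdd_mul (hg.memLp_top_riemann hn l i j k)).mul_bdd (hg.memLp_top_snd hn j)).mul_bdd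
        (hg.memLp_top_snd hn k)
  exact h

theorem memLp_chr_apply (hg : IsC11Metric g) (hn : n ≠ 0) {p : ℝ≥0∞} {W : Pt n × Pt n → Pt n}
    (hW : ∀ i, MemLp (fun z => W z i) p (sigma g)) (l : Fin n) :
    MemLp (fun z => chr g z.1 z.2 (W z) l) p (sigma g) := by
  simp only [chr_apply]
  refine memLp_finsetSum _ fun j _ => memLp_finsetSum _ fun k _ => ?_
  have h1 : MemLp (fun z : Pt n × Pt n => christoffel g l j k z.1 * z.2 j) ∞ (sigma g) :=
    (hg.memLp_top_snd hn j).mul' (hg.memLp_top_christoffel hn l j k)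
  exact (hW k).mul' h1

theorem UnifLip.memLp_top_gradV (hg : IsC11Metric g) (hn : n ≠ 0) {f : Pt n × Pt n → ℝ}
    (hf : UnifLip g f) (j : Fin n) : MemLp (fun z => gradV g f z j) ∞ (sigma g) := by
  have : MemLp (fun z => ∑ k, (g z.1)⁻¹ j k * partialV g k f z) ∞ (sigma g) :=
    memLp_finsetSum _ fun k _ => (hf.memLp_top_partialV hg hn k).mul'
      (hg.memLp_top_of_continuousOn hn (hg.continuousOn_inv j k))
  exact this

theorem UnifLip.memLp_top_gradH (hg : IsC11Metric g) (hn : n ≠ 0) {f : Pt n × Pt n → ℝ}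
    (hf : UnifLip g f) (j : Fin n) : MemLp (fun z => gradH g f z j) ∞ (sigma g) := by
  have h : MemLp (fun z => ∑ k, (g z.1)⁻¹ j k * delta g k f z) ∞ (sigma g) :=
    memLp_finsetSum _ fun k _ => (hf.memLp_top_delta hg hn k).mul'
      (hg.memLp_top_of_continuousOn hn (hg.continuousOn_inv j k))
  have h2 : MemLp (fun z => geoX g f z * z.2 j) ∞ (sigma g) :=
    (hg.memLp_top_snd hn j).mul' (hf.memLp_top_geoX hg hn)
  exact h.sub h2

theorem IsC1N.unifLip_apply (hg : IsC11Metric g) (hn : n ≠ 0) {W : Pt n × Pt n → Pt n}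
    (hW : IsC1N g W) (k : Fin n) : UnifLip g (fun z => W z k) := (hW.apply k).unifLip hg hn

theorem IsC1N.memLp_top_geoXN (hg : IsC11Metric g) (hn : n ≠ 0) {W : Pt n × Pt n → Pt n}
    (hW : IsC1N g W) (k : Fin n) : MemLp (fun z => geoXN g W z k) ∞ (sigma g) := by
  have h1 := ((hW.unifLip_apply hg hn k).memLp_top_geoX hg hn).add
    (memLp_chr_apply hg hn (fun i => (hW.unifLip_apply hg hn i).memLp_top hg hn) k)
  refine h1.ae_eq ?_
  filter_upwards [hg.ae_mem_SM hn] with z hz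
  rw [DiffPt.geoXN_apply (fun k => (hW.apply k).diffPt hz) ⟨hz.2, ne_zero_of_mem_SM hz.1⟩]
  rfl

theorem gNorm_nonneg (x a : Pt n) : 0 ≤ gNorm g x a := Real.sqrt_nonneg _

/-- Each component is controlled by the length. -/
theorem IsC11Metric.exists_abs_apply_le (hg : IsC11Metric g) :
    ∃ C, 0 ≤ C ∧ ∀ x ∈ M n, ∀ (a : Pt n) i, |a i| ≤ C * gNorm g x a := by
  obtain ⟨c, hc, h⟩ := hg.exists_lower_bound
  refine ⟨Real.sqrt c⁻¹, Real.sqrt_nonneg _, fun x hx a i => ?_⟩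
  refine (PiLp.norm_apply_le a i).trans ?_
  rw [gNorm, ← Real.sqrt_mul (inv_nonneg.2 hc.le)]
  refine Real.le_sqrt_of_sq_le ?_
  rw [inv_mul_eq_div, le_div_iff₀ hc, mul_comm]
  exact h x hx a

theorem MemL2N.memLp_apply (hg : IsC11Metric g) (hn : n ≠ 0) {V : Pt n × Pt n → Pt n}
    (hV : MemL2N g V) (i : Fin n) : MemLp (fun z => V z i) 2 (sigma g) := by
  obtain ⟨C, hC, h⟩ := hg.exists_abs_apply_le
  refine hV.memLp.of_le_mul (c := C) ((PiLp.continuous_apply 2 _ i).comp_aestronglyMeasurable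
    hV.meas) ?_
  filter_upwards [hg.ae_mem_SM hn] with z hz
  rw [Real.norm_eq_abs, Real.norm_eq_abs, abs_of_nonneg (gNorm_nonneg z.1 (V z))]
  exact h z.1 hz.1.1 (V z) i

/-- Components are uniformly controlled by the length in g, so convergence in L²(N) can be used
component by component. -/
theorem lTo_apply_of_tendstoL2N (hg : IsC11Metric g) (hn : n ≠ 0) {Vk : ℕ → Pt n × Pt n → Pt n}
    {V : Pt n × Pt n → Pt n} (hVk : ∀ k i, MemLp (fun z => Vk k z i) ∞ (sigma g))
    (hV : MemL2N g V) (h : TendstoL2N g Vk V) (i : Fin n) :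
    LTo (sigma g) 2 (fun k z => Vk k z i) (fun z => V z i) := by
  have := hg.isFiniteMeasure_sigma
  obtain ⟨C, hC, hC'⟩ := hg.exists_abs_apply_le
  refine ⟨fun k => (hVk k i).mono_exponent le_top, hV.memLp_apply hg hn i, ?_⟩
  have h0 := ENNReal.Tendsto.const_mul (a := ENNReal.ofReal C) h (Or.inr ENNReal.ofReal_ne_top)
  rw [mul_zero] at h0
  refine tendsto_of_tendsto_of_tendsto_of_le_of_le tendsto_const_nhds h0 (fun _ => zero_le)
    fun k => ?_
  refine eLpNorm_le_mul_eLpNorm_of_ae_le_mul ?_ 2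
  filter_upwards [hg.ae_mem_SM hn] with z hz
  rw [Real.norm_eq_abs, Real.norm_eq_abs,
    abs_of_nonneg (gNorm_nonneg z.1 (Vk k z - V z))]
  exact hC' z.1 hz.1.1 (Vk k z - V z) i

end Pairings

end SimpleC11

namespace SimpleC11

/-! ### Localized integral identities -/

section Localized

variable {n : ℕ} {g : MetricField n}

/-- `C^1` functions supported in a smaller ball. -/
structure Cutoff (c : Pt n → ℝ) : Prop where
  contDiff : ContDiff ℝ 1 c
  supp : ∃ r < (1 : ℝ), ∀ x, r < ‖x‖ → c x = 0

theorem Cutoff.differentiableAt {c : Pt n → ℝ} (hc : Cutoff c) (x : Pt n) :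
    DifferentiableAt ℝ c x := hc.contDiff.differentiable one_ne_zero x

theorem Cutoff.xSupp {c : Pt n → ℝ} (hc : Cutoff c) (f : Pt n × Pt n → ℝ) :
    XSupp (fun z => c z.1 * f z) := by
  obtain ⟨r, hr, h⟩ := hc.supp
  exact ⟨r, hr, fun z hz => by simp only [h z.1 hz, zero_mul]⟩

theorem Cutoff.xSupp_smul {c : Pt n → ℝ} (hc : Cutoff c) (W : Pt n × Pt n → Pt n) :
    XSupp (fun z => c z.1 • W z) := by
  obtain ⟨r, hr, h⟩ := hc.supp
  exact ⟨r, hr, fun z hz => by simp only [h z.1 hz, zero_smul]⟩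

theorem Cutoff.unifLip (hg : IsC11Metric g) (hn : n ≠ 0) {c : Pt n → ℝ} (hc : Cutoff c) :
    UnifLip g (fun z => c z.1) := (isC1_fst hc.contDiff).unifLip hg hn

theorem lipSM_of_apply {W : Pt n × Pt n → Pt n} (hW : ∀ k, UnifLip g fun z => W z k) :
    LipSM g W :=
  locallyLipschitzOn_toLp fun k => (hW k).lip

theorem DiffPt.divH_smul {f : Pt n × Pt n → ℝ} {W : Pt n × Pt n → Pt n} {z : Pt n × Pt n}
    (hf : DiffPt g f z) (hW : ∀ k, DiffPt g (fun y => W y k) z) :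
    divH g (fun y => f y • W y) z = f z * divH g W z + ∑ k, delta g k f z * W z k := by
  simp only [divH, PiLp.smul_apply, smul_eq_mul, hf.delta_mul (hW _), Finset.mul_sum,
    ← Finset.sum_add_distrib]
  refine Finset.sum_congr rfl fun k _ => ?_
  rw [mul_add, Finset.mul_sum]
  have : ∀ i, christoffel g i k i z.1 * (f z * W z k) = f z * (christoffel g i k i z.1 * W z k) :=
    fun i => by ring
  simp only [this]
  ring

theorem DiffPt.divV_smul {f : Pt n × Pt n → ℝ} {W : Pt n × Pt n → Pt n} {z : Pt n × Pt n}
    (hf : DiffPt g f z) (hW : ∀ k, DiffPt g (fun y => W y k) z) :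
    divV g (fun y => f y • W y) z = f z * divV g W z + ∑ k, partialV g k f z * W z k := by
  simp only [divV, PiLp.smul_apply, smul_eq_mul, hf.partialV_mul (hW _), Finset.mul_sum,
    ← Finset.sum_add_distrib]

theorem curv_smul (f : Pt n × Pt n → ℝ) (W : Pt n × Pt n → Pt n) (z : Pt n × Pt n) (l : Fin n) :
    curv g (fun y => f y • W y) z l = f z * curv g W z l := by
  simp only [curv, PiLp.smul_apply, smul_eq_mul, Finset.mul_sum]
  exact Finset.sum_congr rfl fun i _ => Finset.sum_congr rfl fun j _ =>
    Finset.sum_congr rfl fun k _ => by ring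

theorem UnifLip.smul_apply (hg : IsC11Metric g) (hn : n ≠ 0) {f : Pt n × Pt n → ℝ}
    (hf : UnifLip g f) {W : Pt n × Pt n → Pt n} (hW : ∀ k, UnifLip g fun z => W z k) (k : Fin n) :
    UnifLip g fun z => (f z • W z) k := hf.mul hg hn (hW k)

theorem Cutoff.integral_geoX (hg : IsC11Metric g) (hn : n ≠ 0) {c : Pt n → ℝ} (hc : Cutoff c)
    {f : Pt n × Pt n → ℝ} (hf : UnifLip g f) :
    ∫ z, (c z.1 * geoX g f z + fderiv ℝ c z.1 z.2 * f z) ∂(sigma g) = 0 := by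
  rw [← hg.integral_geoX hn ((hc.unifLip hg hn).mul hg hn hf).lip (hc.xSupp f)]
  refine integral_congr_ae ?_
  filter_upwards [(hc.unifLip hg hn).ae_diffPt hg hn, hf.ae_diffPt hg hn] with z h1 h2
  rw [h1.geoX_mul h2, h1.geoX_fst (hc.differentiableAt _)]

theorem Cutoff.integral_divH (hg : IsC11Metric g) (hn : n ≠ 0) {c : Pt n → ℝ} (hc : Cutoff c)
    {W : Pt n × Pt n → Pt n} (hW : ∀ k, UnifLip g fun z => W z k) :
    ∫ z, (c z.1 * divH g W z + ∑ k, fderiv ℝ c z.1 (e k) * W z k) ∂(sigma g) = 0 := by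
  have hcu := hc.unifLip hg hn
  rw [← hg.integral_divH hn (lipSM_of_apply (hcu.smul_apply hg hn hW)) (hc.xSupp_smul W)]
  refine integral_congr_ae ?_
  filter_upwards [hcu.ae_diffPt hg hn, ae_all_iff.2 fun k => (hW k).ae_diffPt hg hn] with z h1 h2
  rw [h1.divH_smul h2]
  simp only [h1.delta_fst (hc.differentiableAt _)]

theorem Cutoff.integral_delta_mul (hg : IsC11Metric g) (hn : n ≠ 0) {c : Pt n → ℝ} (hc : Cutoff c)
    {w : Pt n × Pt n → ℝ} (hw : UnifLip g w) {W : Pt n × Pt n → Pt n}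
    (hW : ∀ k, UnifLip g fun z => W z k) :
    ∫ z, (c z.1 * ∑ k, delta g k w z * W z k + (c z.1 * divH g W z) * w z
      + w z * ∑ k, fderiv ℝ c z.1 (e k) * W z k) ∂(sigma g) = 0 := by
  rw [← hc.integral_divH hg hn (hw.smul_apply hg hn hW)]
  refine integral_congr_ae ?_
  filter_upwards [hw.ae_diffPt hg hn, ae_all_iff.2 fun k => (hW k).ae_diffPt hg hn] with z h1 h2
  rw [h1.divH_smul h2]
  simp only [PiLp.smul_apply, smul_eq_mul, Finset.mul_sum]
  have : ∀ k, fderiv ℝ c z.1 (e k) * (w z * W z k) = w z * (fderiv ℝ c z.1 (e k) * W z k) :=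
    fun k => by ring
  simp only [this, mul_add, Finset.mul_sum]
  ring

/-- The cutoff depends on x alone, so vertical integration by parts leaves no derivative of it. -/
theorem Cutoff.integral_partialV_mul (hg : IsC11Metric g) (hn : n ≠ 0) {c : Pt n → ℝ}
    (hc : Cutoff c) {w : Pt n × Pt n → ℝ} (hw : UnifLip g w) {W : Pt n × Pt n → Pt n}
    (hW : ∀ k, UnifLip g fun z => W z k) (ho : ∀ z ∈ SM g, gInner g z.1 (W z) z.2 = 0) :
    ∫ z, (c z.1 * ∑ k, partialV g k w z * W z k + (c z.1 * divV g W z) * w z) ∂(sigma g) = 0 := by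
  have hcu := hc.unifLip hg hn
  have hwW := hw.smul_apply hg hn hW
  have ho' : ∀ z ∈ SM g, gInner g z.1 (c z.1 • (w z • W z)) z.2 = 0 := fun z hz => by
    rw [gInner_smul_left, gInner_smul_left, ho z hz, mul_zero, mul_zero]
  rw [← hg.integral_divV hn (lipSM_of_apply (hcu.smul_apply hg hn hwW))
    (hc.xSupp_smul (fun z => w z • W z)) ho']
  refine integral_congr_ae ?_
  filter_upwards [hcu.ae_diffPt hg hn, hw.ae_diffPt hg hn,
    ae_all_iff.2 fun k => (hW k).ae_diffPt hg hn,
    ae_all_iff.2 fun k => (hwW k).ae_diffPt hg hn] with z h1 h2 h3 h4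
  rw [h1.divV_smul h4, h2.divV_smul h3]
  simp only [h1.partialV_fst (hc.differentiableAt _), zero_mul, Finset.sum_const_zero]
  ring

/-- The cutoff is placed on the test function c·u, and w takes the other role. The derivative of c
then multiplies u itself, which is small at the boundary. -/
theorem Cutoff.integral_commutator_gradients (hg : IsC11Metric g) (hn : n ≠ 0) {c : Pt n → ℝ}
    (hc : Cutoff c) {u w : Pt n × Pt n → ℝ} (hu : UnifLip g u) (hw : UnifLip g w) :
    ∫ z, (c z.1 * (∑ j, ∑ k, (g z.1)⁻¹ j k * (delta g j u z * partialV g k w z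
        - partialV g k u z * delta g j w z) + ((n : ℝ) - 1) * (u z * geoX g w z))
      + u z * ∑ j, ∑ k, (g z.1)⁻¹ j k * fderiv ℝ c z.1 (e j) * partialV g k w z) ∂(sigma g) = 0 := by
  have hcu := hc.unifLip hg hn
  rw [← hg.integral_commutator_gradients hn hw.lip (hcu.mul hg hn hu).lip (hc.xSupp u)]
  refine integral_congr_ae ?_
  filter_upwards [hcu.ae_diffPt hg hn, hu.ae_diffPt hg hn] with z h1 h2
  simp only [h1.delta_mul h2, h1.partialV_mul h2, h1.partialV_fst (hc.differentiableAt _),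
    h1.delta_fst (hc.differentiableAt _), mul_add, Finset.mul_sum]
  rw [add_right_comm]
  congr 1
  · simp only [← Finset.sum_add_distrib]
    exact Finset.sum_congr rfl fun j _ => Finset.sum_congr rfl fun k _ => by ring
  · ring

/-- The weak commutator with test section cW. The derivative of c along X meets ∇^h u undamped; this
is the delicate boundary term. -/
theorem Cutoff.integral_commutator_geoX_delta (hg : IsC11Metric g) (hn : n ≠ 0) {c : Pt n → ℝ}
    (hc : Cutoff c) {u : Pt n × Pt n → ℝ} {W : Pt n × Pt n → Pt n} (hu : UnifLip g u)
    (hW : ∀ k, UnifLip g fun z => W z k) :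
    ∫ z, (c z.1 * (∑ k, delta g k u z * geoXN g W z k + ∑ l, partialV g l u z * curv g W z l)
      + fderiv ℝ c z.1 z.2 * ∑ k, delta g k u z * W z k
      - ((c z.1 * divH g W z) * geoX g u z + geoX g u z * ∑ k, fderiv ℝ c z.1 (e k) * W z k))
      ∂(sigma g) = 0 := by
  have hcu := hc.unifLip hg hn
  rw [← hg.integral_commutator_geoX_delta hn hu.lip (lipSM_of_apply (hcu.smul_apply hg hn hW))
    (hc.xSupp_smul W)]
  refine integral_congr_ae ?_
  filter_upwards [hcu.ae_diffPt hg hn, ae_all_iff.2 fun k => (hW k).ae_diffPt hg hn] with z h1 h2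
  have e1 : ∀ k, geoX g (fun y => c y.1 * W y k) z
      = c z.1 * geoX g (fun y => W y k) z + fderiv ℝ c z.1 z.2 * W z k := fun k => by
    have := h1.geoX_mul (h2 k)
    rw [h1.geoX_fst (hc.differentiableAt _)] at this
    exact this
  simp only [DiffPt.geoXN_apply h2 h1.int, e1, h1.divH_smul h2, curv_smul (fun y => c y.1) W,
    h1.delta_fst (hc.differentiableAt _), chr_smul_right, PiLp.smul_apply, smul_eq_mul, mul_add,
    Finset.mul_sum, Finset.sum_add_distrib]
  have e2 : ∀ k, delta g k u z * (c z.1 * geoX g (fun y => W y k) z)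
      = c z.1 * (delta g k u z * geoX g (fun y => W y k) z) := fun k => by ring
  have e3 : ∀ k, delta g k u z * (c z.1 * chr g z.1 z.2 (W z) k)
      = c z.1 * (delta g k u z * chr g z.1 z.2 (W z) k) := fun k => by ring
  have e4 : ∀ k, delta g k u z * (fderiv ℝ c z.1 z.2 * W z k)
      = fderiv ℝ c z.1 z.2 * (delta g k u z * W z k) := fun k => by ring
  have e5 : ∀ l, c z.1 * curv g W z l * partialV g l u z
      = c z.1 * (partialV g l u z * curv g W z l) := fun l => by ring
  simp only [e2, e3, e4, e5]
  ring

end Localized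

end SimpleC11

namespace SimpleC11

/-! ### Boundary cutoffs -/

section BoundaryCutoff

variable {n : ℕ} {g : MetricField n}

/-- The boundary defining function `1 - |x|²`. -/
noncomputable def rho (x : Pt n) : ℝ := 1 - ‖x‖ ^ 2

/-- The cutoffs exhausting the interior. -/
noncomputable def cut (m : ℕ) (x : Pt n) : ℝ := Real.smoothTransition (m * rho x - 1)

/-- The derivative of the cutoffs with respect to the boundary defining function. -/
noncomputable def dcut (m : ℕ) (x : Pt n) : ℝ := m * deriv Real.smoothTransition (m * rho x - 1)

theorem contDiff_rho : ContDiff ℝ 1 (rho : Pt n → ℝ) :=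
  contDiff_const.sub (contDiff_norm_sq ℝ)

theorem fderiv_rho (x a : Pt n) : fderiv ℝ rho x a = -2 * ∑ k, x k * a k := by
  have h := ((hasFDerivAt_id x).norm_sq.const_sub 1).fderiv
  have h2 : (rho : Pt n → ℝ) = fun x => 1 - ‖id x‖ ^ 2 := rfl
  rw [h2, h]
  simp [PiLp.inner_apply, mul_comm]

theorem rho_nonneg {x : Pt n} (hx : x ∈ M n) : 0 ≤ rho x := by
  have : ‖x‖ ≤ 1 := by simpa [M] using hx
  have := norm_nonneg x
  rw [rho]
  nlinarith

theorem rho_pos {x : Pt n} (hx : x ∈ Metric.ball (0 : Pt n) 1) : 0 < rho x := by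
  have : ‖x‖ < 1 := by simpa using hx
  have := norm_nonneg x
  rw [rho]
  nlinarith

theorem contDiff_deriv_smoothTransition : ContDiff ℝ 1 (deriv Real.smoothTransition) :=
  ContDiff.deriv' (n := 1) (Real.smoothTransition.contDiff (n := 2))

theorem deriv_smoothTransition_of_neg {t : ℝ} (ht : t < 0) : deriv Real.smoothTransition t = 0 := by
  have : Real.smoothTransition =ᶠ[𝓝 t] fun _ => 0 := by
    filter_upwards [gt_mem_nhds ht] with s hs
    exact Real.smoothTransition.zero_of_nonpos (le_of_lt hs)
  rw [this.deriv_eq, deriv_const]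

theorem deriv_smoothTransition_of_one_lt {t : ℝ} (ht : 1 < t) :
    deriv Real.smoothTransition t = 0 := by
  have : Real.smoothTransition =ᶠ[𝓝 t] fun _ => 1 := by
    filter_upwards [lt_mem_nhds ht] with s hs
    exact Real.smoothTransition.one_of_one_le (le_of_lt hs)
  rw [this.deriv_eq, deriv_const]

theorem exists_deriv_smoothTransition_le :
    ∃ D, 0 ≤ D ∧ ∀ t, deriv Real.smoothTransition t ≤ D := by
  obtain ⟨D, hD⟩ := (isCompact_Icc (a := (0 : ℝ)) (b := 1)).exists_bound_of_continuousOn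
    contDiff_deriv_smoothTransition.continuous.continuousOn
  have hD0 : 0 ≤ D := (norm_nonneg _).trans (hD 0 (by simp))
  refine ⟨D, hD0, fun t => ?_⟩
  rcases lt_or_ge t 0 with h | h
  · rwa [deriv_smoothTransition_of_neg h]
  rcases lt_or_ge 1 t with h1 | h1
  · rwa [deriv_smoothTransition_of_one_lt h1]
  exact (le_abs_self _).trans (hD t ⟨h, h1⟩)

theorem exists_radius (m : ℕ) : ∃ r < (1 : ℝ), ∀ x : Pt n, r < ‖x‖ → m * rho x - 1 < 0 := by
  have hm : (0 : ℝ) < m + 1 := by positivity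
  -- Beyond this radius ρ < 1/(m+1), so mρ < 1; the denominator m + 1 also covers m = 0.
  refine ⟨Real.sqrt (1 - 1 / (m + 1)), ?_, fun x hx => ?_⟩
  · rw [Real.sqrt_lt' one_pos]
    have : (0 : ℝ) < 1 / (m + 1) := by positivity
    linarith
  · have h1 := (Real.sqrt_lt' ((Real.sqrt_nonneg _).trans_lt hx)).1 hx
    have h2 : rho x < 1 / (m + 1) := by rw [rho]; linarith
    have h3 : (m : ℝ) * rho x ≤ m * (1 / (m + 1)) :=
      mul_le_mul_of_nonneg_left h2.le (Nat.cast_nonneg m)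
    have h4 : (m : ℝ) * (1 / (m + 1)) < 1 := by
      rw [mul_one_div, div_lt_one hm]
      linarith
    linarith

theorem cutoff_cut (m : ℕ) : Cutoff (cut m : Pt n → ℝ) := by
  refine ⟨(Real.smoothTransition.contDiff (n := 1)).comp
    ((contDiff_const.mul contDiff_rho).sub contDiff_const), ?_⟩
  obtain ⟨r, hr, h⟩ := exists_radius (n := n) m
  exact ⟨r, hr, fun x hx => Real.smoothTransition.zero_of_nonpos (h x hx).le⟩

theorem cutoff_dcut (m : ℕ) : Cutoff (dcut m : Pt n → ℝ) := by
  refine ⟨contDiff_const.mul (contDiff_deriv_smoothTransition.comp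
    ((contDiff_const.mul contDiff_rho).sub contDiff_const)), ?_⟩
  obtain ⟨r, hr, h⟩ := exists_radius (n := n) m
  exact ⟨r, hr, fun x hx => by rw [dcut, deriv_smoothTransition_of_neg (h x hx), mul_zero]⟩

theorem fderiv_cut (m : ℕ) (x a : Pt n) :
    fderiv ℝ (cut m) x a = dcut m x * fderiv ℝ rho x a := by
  have h1 : DifferentiableAt ℝ Real.smoothTransition (m * rho x - 1) :=
    (Real.smoothTransition.contDiff (n := 1)).differentiable one_ne_zero _
  have h2 : HasFDerivAt (rho : Pt n → ℝ) (fderiv ℝ rho x) x :=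
    (contDiff_rho.differentiable one_ne_zero x).hasFDerivAt
  have h3 := (h1.hasDerivAt.comp_hasFDerivAt x ((h2.const_mul (m : ℝ)).sub_const 1)).fderiv
  have h4 : (cut m : Pt n → ℝ) = Real.smoothTransition ∘ fun x => m * rho x - 1 := rfl
  rw [h4, h3, dcut]
  simp only [smul_apply, smul_eq_mul]
  ring

theorem cut_nonneg (m : ℕ) (x : Pt n) : 0 ≤ cut m x := Real.smoothTransition.nonneg _

theorem cut_le_one (m : ℕ) (x : Pt n) : cut m x ≤ 1 := Real.smoothTransition.le_one _

theorem dcut_nonneg (m : ℕ) (x : Pt n) : 0 ≤ dcut m x :=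
  mul_nonneg (Nat.cast_nonneg m) Real.smoothTransition.monotone.deriv_nonneg

/-- The derivative is of size m and lives where 1 ≤ mρ ≤ 2, so it is at most of order 1/ρ. -/
theorem exists_dcut_mul_rho_le : ∃ D, 0 ≤ D ∧ ∀ m, ∀ x ∈ M n, dcut m x * rho x ≤ D := by
  obtain ⟨D, hD0, hD⟩ := exists_deriv_smoothTransition_le
  refine ⟨2 * D, by linarith, fun m x hx => ?_⟩
  have h0 := rho_nonneg hx
  have h1 : (0 : ℝ) ≤ m * rho x := mul_nonneg (Nat.cast_nonneg m) h0
  have h2 : dcut m x * rho x = (m * rho x) * deriv Real.smoothTransition (m * rho x - 1) := by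
    rw [dcut]; ring
  rw [h2]
  rcases lt_or_ge (2 : ℝ) (m * rho x) with h | h
  · rw [deriv_smoothTransition_of_one_lt (by linarith)]
    linarith
  · exact mul_le_mul h (hD _) Real.smoothTransition.monotone.deriv_nonneg (by norm_num)

theorem eventually_cut {x : Pt n} (hx : x ∈ Metric.ball (0 : Pt n) 1) :
    ∀ᶠ m : ℕ in atTop, cut m x = 1 ∧ dcut m x = 0 := by
  have h : Tendsto (fun m : ℕ => (m : ℝ) * rho x) atTop atTop :=
    tendsto_natCast_atTop_atTop.atTop_mul_const (rho_pos hx)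
  filter_upwards [h.eventually_gt_atTop 2] with m hm
  exact ⟨Real.smoothTransition.one_of_one_le (by linarith), by
    rw [dcut, deriv_smoothTransition_of_one_lt (by linarith), mul_zero]⟩

theorem tendsto_integral_cut_mul (hg : IsC11Metric g) (hn : n ≠ 0) {F : Pt n × Pt n → ℝ}
    (hF : Integrable F (sigma g)) :
    Tendsto (fun m => ∫ z, cut m z.1 * F z ∂(sigma g)) atTop (𝓝 (∫ z, F z ∂(sigma g))) := by
  refine tendsto_integral_of_dominated_convergence (fun z => ‖F z‖) (fun m => ?_) hF.norm
    (fun m => ?_) ?_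
  · exact ((cutoff_cut m).unifLip hg hn).memLp_top hg hn |>.1.mul hF.1
  · refine Eventually.of_forall fun z => ?_
    rw [norm_mul, Real.norm_of_nonneg (cut_nonneg m z.1)]
    exact mul_le_of_le_one_left (norm_nonneg _) (cut_le_one m z.1)
  · filter_upwards [hg.ae_mem_SM hn] with z hz
    refine tendsto_const_nhds.congr' ?_
    filter_upwards [eventually_cut hz.2] with m hm
    rw [hm.1, one_mul]

/-- The function is bounded by the distance to the boundary. -/
def VanishesAtBoundary (g : MetricField n) (f : Pt n × Pt n → ℝ) : Prop :=
  ∃ C, 0 ≤ C ∧ ∀ z ∈ SM g, |f z| ≤ C * rho z.1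

/-- The factor u, of order ρ, balances the derivative of the cutoff, of order 1/ρ. At each interior
point that derivative is eventually zero, and dominated convergence applies. -/
theorem tendsto_integral_dcut_mul (hg : IsC11Metric g) (hn : n ≠ 0) {u F : Pt n × Pt n → ℝ}
    (hu : UnifLip g u) (hu0 : VanishesAtBoundary g u) (hF : Integrable F (sigma g)) :
    Tendsto (fun m => ∫ z, dcut m z.1 * (u z * F z) ∂(sigma g)) atTop (𝓝 0) := by
  obtain ⟨C, hC, hb⟩ := hu0
  obtain ⟨D, hD, hD'⟩ := exists_dcut_mul_rho_le (n := n)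
  have h0 : ∫ z : Pt n × Pt n, (0 : ℝ) ∂(sigma g) = 0 := integral_zero _ _
  rw [← h0]
  refine tendsto_integral_of_dominated_convergence (fun z => C * D * ‖F z‖) (fun m => ?_)
    (hF.norm.const_mul _) (fun m => ?_) ?_
  · exact ((cutoff_dcut m).unifLip hg hn).memLp_top hg hn |>.1.mul
      ((hu.lip.aestronglyMeasurable hg hn).mul hF.1)
  · filter_upwards [hg.ae_mem_SM hn] with z hz
    rw [norm_mul, norm_mul, Real.norm_of_nonneg (dcut_nonneg m z.1), Real.norm_eq_abs (u z),
      ← mul_assoc]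
    refine mul_le_mul_of_nonneg_right ?_ (norm_nonneg _)
    have h1 := mul_le_mul_of_nonneg_left (hb z hz.1) (dcut_nonneg m z.1)
    have h2 := mul_le_mul_of_nonneg_left (hD' m z.1 hz.1.1) hC
    linarith
  · filter_upwards [hg.ae_mem_SM hn] with z hz
    refine tendsto_const_nhds.congr' ?_
    filter_upwards [eventually_cut hz.2] with m hm
    rw [hm.2, zero_mul]

theorem exists_lipschitz_gInner (hg : IsC11Metric g) :
    ∃ C, 0 ≤ C ∧ ∀ x ∈ M n, ∀ y ∈ M n, ∀ a, |gInner g x a a - gInner g y a a|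
      ≤ C * ‖x - y‖ * ‖a‖ ^ 2 := by
  have h : ∀ i j, ∃ K, LipschitzOnWith K (fun x => g x i j) (M n) := fun i j =>
    (locallyLipschitzOn_M_of_contDiffOn (hg.contDiffOn i j)).exists_lipschitzOnWith_of_compact
      isCompact_M
  choose K hK using h
  refine ⟨∑ i, ∑ j, (K i j : ℝ), Finset.sum_nonneg fun i _ => Finset.sum_nonneg fun j _ =>
    (K i j).coe_nonneg, fun x hx y hy a => ?_⟩
  simp only [gInner, ← Finset.sum_sub_distrib, Finset.sum_mul]
  refine (Finset.abs_sum_le_sum_abs _ _).trans (Finset.sum_le_sum fun i _ =>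
    (Finset.abs_sum_le_sum_abs _ _).trans (Finset.sum_le_sum fun j _ => ?_))
  have h1 : |g x i j - g y i j| ≤ K i j * ‖x - y‖ := by
    have := (hK i j).dist_le_mul x hx y hy
    rwa [Real.dist_eq, dist_eq_norm] at this
  have h2 : g x i j * a i * a j - g y i j * a i * a j = (g x i j - g y i j) * (a i * a j) := by ring
  rw [h2, abs_mul, abs_mul, pow_two]
  exact mul_le_mul h1 (mul_le_mul (PiLp.norm_apply_le a i) (PiLp.norm_apply_le a j) (abs_nonneg _)
    (norm_nonneg _)) (by positivity) (by positivity)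

theorem exists_norm_one_dist (hn : n ≠ 0) (x : Pt n) (hx : ‖x‖ ≤ 1) :
    ∃ y : Pt n, ‖y‖ = 1 ∧ ‖x - y‖ = 1 - ‖x‖ := by
  have := nontrivial_Pt hn
  rcases eq_or_ne x 0 with h | h
  · obtain ⟨y, hy⟩ := exists_norm_eq (Pt n) zero_le_one
    exact ⟨y, hy, by simp [h, hy]⟩
  · have hx0 := norm_pos_iff.2 h
    refine ⟨‖x‖⁻¹ • x, by rw [norm_smul, norm_inv, norm_norm, inv_mul_cancel₀ hx0.ne'], ?_⟩
    have h1 : x - ‖x‖⁻¹ • x = (1 - ‖x‖⁻¹) • x := by module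
    have h2 : 1 ≤ ‖x‖⁻¹ := (one_le_inv₀ hx0).2 hx
    rw [h1, norm_smul, Real.norm_of_nonpos (by linarith)]
    field_simp
    ring

/-- Move the base point radially to the sphere and rescale v to unit length for the metric there. As
g is Lipschitz, the total displacement is at most a constant times 1 - |x| ≤ ρ, and u vanishes at
the point reached. -/
theorem vanishesAtBoundary_of_isLip0 (hg : IsC11Metric g) (hn : n ≠ 0) {u : Pt n × Pt n → ℝ}
    (hu : IsLip0 g u) : VanishesAtBoundary g u := by
  obtain ⟨K, hK⟩ := hu.lip
  obtain ⟨C, hC, hC'⟩ := exists_lipschitz_gInner hg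
  obtain ⟨B, hB, hB'⟩ := hg.gNorm_le
  refine ⟨K * (1 + C * B ^ 2 * B), by positivity, fun z hz => ?_⟩
  have hx1 : ‖z.1‖ ≤ 1 := by simpa [M] using hz.1
  obtain ⟨y, hy, hxy⟩ := exists_norm_one_dist hn z.1 hx1
  have hyM : y ∈ M n := by simp [M, hy]
  have hv := ne_zero_of_mem_SM hz
  set s := gNorm g y z.2 with hs
  have hspos : 0 < s := hg.gNorm_pos hyM hv
  have hmem : (y, s⁻¹ • z.2) ∈ SM g := hg.radial_mem (z := (y, z.2)) ⟨hyM, hv⟩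
  have h0 := hu.zero (y, s⁻¹ • z.2) ⟨hmem, hy⟩
  have h1 := hK.dist_le_mul z hz _ hmem
  rw [Real.dist_eq, h0, sub_zero] at h1
  refine h1.trans ?_
  rw [mul_assoc]
  refine mul_le_mul_of_nonneg_left ?_ K.coe_nonneg
  have hr : 1 - ‖z.1‖ ≤ rho z.1 := by
    rw [rho]
    nlinarith [norm_nonneg z.1]
  have hr0 := rho_nonneg hz.1
  have h2 : ‖z.2 - s⁻¹ • z.2‖ ≤ C * B ^ 2 * B * rho z.1 := by
    have e1 : z.2 = (1 : ℝ) • z.2 := (one_smul _ _).symm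
    have e2 : ‖z.2 - s⁻¹ • z.2‖ = |s - 1| * ‖s⁻¹ • z.2‖ := by
      have : z.2 - s⁻¹ • z.2 = (s - 1) • (s⁻¹ • z.2) := by
        rw [smul_smul, sub_mul, mul_inv_cancel₀ hspos.ne', sub_smul, one_smul, one_mul]
      rw [this, norm_smul, Real.norm_eq_abs]
    have e3 := hB' _ hmem
    have e4 : |s ^ 2 - 1| ≤ C * B ^ 2 * rho z.1 := by
      have := hC' y hyM z.1 hz.1 z.2
      rw [hz.2, ← hg.gNorm_sq hyM, ← hs] at this
      refine this.trans ?_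
      rw [norm_sub_rev, hxy]
      have e5 : ‖z.2‖ ^ 2 ≤ B ^ 2 := pow_le_pow_left₀ (norm_nonneg _) (hB' z hz) 2
      calc C * (1 - ‖z.1‖) * ‖z.2‖ ^ 2 ≤ C * rho z.1 * B ^ 2 := by gcongr
        _ = _ := by ring
    -- The Lipschitz bound on g controls s² - 1; the factor s + 1 is at least 1.
    have e6 : |s - 1| ≤ |s ^ 2 - 1| := by
      have : s ^ 2 - 1 = (s - 1) * (s + 1) := by ring
      rw [this, abs_mul, abs_of_pos (by linarith : 0 < s + 1)]
      exact le_mul_of_one_le_right (abs_nonneg _) (by linarith)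
    rw [e2]
    calc |s - 1| * ‖s⁻¹ • z.2‖ ≤ (C * B ^ 2 * rho z.1) * B :=
          mul_le_mul (e6.trans e4) e3 (norm_nonneg _) (by positivity)
      _ = _ := by ring
  have h3 : dist z (y, s⁻¹ • z.2) = max ‖z.1 - y‖ ‖z.2 - s⁻¹ • z.2‖ := by
    rw [Prod.dist_eq, dist_eq_norm, dist_eq_norm]
  rw [h3, hxy, add_mul, one_mul]
  have h4 : 0 ≤ C * B ^ 2 * B * rho z.1 := by positivity
  exact max_le (by linarith) (by linarith)

/-- Collars of the boundary have volume of order 1/m. The proof applies the divergence theorem to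
the position field x, along which the derivative of the cutoff is -2 times `dcut` times |x|².
Orthogonality to v is not needed for div^h. -/
theorem exists_integral_dcut_le (hg : IsC11Metric g) (hn : n ≠ 0) :
    ∃ B, ∀ m, ∫ z, dcut m z.1 ∂(sigma g) ≤ B := by
  have := hg.isFiniteMeasure_sigma
  obtain ⟨D, hD, hD'⟩ := exists_dcut_mul_rho_le (n := n)
  have hW : ∀ k, UnifLip g fun z => z.1 k := fun k =>
    (isC1_fst (c := fun x : Pt n => x k) (contDiff_euclidean.1 contDiff_id k)).unifLip hg hn
  have hdiv : Integrable (divH g fun z => z.1) (sigma g) := by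
    have : MemLp (divH g fun z => z.1) ∞ (sigma g) := memLp_finsetSum _ fun j _ =>
      ((hW j).memLp_top_delta hg hn j).add (memLp_finsetSum _ fun i _ =>
        ((hW j).memLp_top hg hn).mul' (hg.memLp_top_christoffel hn i j i))
    exact this.integrable le_top
  refine ⟨1 / 2 * ∫ z, |divH g (fun z => z.1) z| ∂(sigma g) + ∫ z, D ∂(sigma g), fun m => ?_⟩
  have h1 := (cutoff_cut m).integral_divH hg hn hW
  have h2 : ∀ z : Pt n × Pt n, ∑ k, fderiv ℝ (cut m) z.1 (e k) * z.1 k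
      = -2 * (dcut m z.1 * ‖z.1‖ ^ 2) := by
    intro z
    have e1 := clm_eq_sum (fderiv ℝ (cut m) z.1) z.1
    simp only [smul_eq_mul] at e1
    rw [fderiv_cut, fderiv_rho] at e1
    have e2 : ∑ k, z.1 k * z.1 k = ‖z.1‖ ^ 2 := by
      rw [EuclideanSpace.real_norm_sq_eq]
      exact Finset.sum_congr rfl fun k _ => (pow_two _).symm
    rw [e2] at e1
    simp only [mul_comm _ (z.1 _)]
    rw [← e1]
    ring
  simp only [h2] at h1
  have hcm := ((cutoff_cut m).unifLip hg hn).memLp_top hg hn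
  have hdm := ((cutoff_dcut m).unifLip hg hn).memLp_top hg hn
  have hi1 : Integrable (fun z => cut m z.1 * divH g (fun z => z.1) z) (sigma g) :=
    memLp_one_iff_integrable.1 ((memLp_one_iff_integrable.2 hdiv).mul' hcm)
  have hi2 : Integrable (fun z : Pt n × Pt n => dcut m z.1 * ‖z.1‖ ^ 2) (sigma g) := by
    have : MemLp (fun z : Pt n × Pt n => dcut m z.1 * ‖z.1‖ ^ 2) ∞ (sigma g) :=
      (hg.memLp_top_fst hn (c := fun x => ‖x‖ ^ 2) (by fun_prop)).mul' hdm
    exact this.integrable le_top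
  rw [integral_add hi1 (hi2.const_mul _), integral_const_mul] at h1
  have h3 : ∫ z, cut m z.1 * divH g (fun z => z.1) z ∂(sigma g)
      ≤ ∫ z, |divH g (fun z => z.1) z| ∂(sigma g) := by
    refine integral_mono_ae hi1 hdiv.abs (Eventually.of_forall fun z => ?_)
    refine (le_abs_self _).trans ?_
    simp only [abs_mul, abs_of_nonneg (cut_nonneg m z.1)]
    exact mul_le_of_le_one_left (abs_nonneg _) (cut_le_one m z.1)
  -- Since |x|² = 1 - ρ, the missing part is `dcut` times ρ, which is at most D.
  have h4 : ∫ z, dcut m z.1 ∂(sigma g)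
      ≤ ∫ z : Pt n × Pt n, (dcut m z.1 * ‖z.1‖ ^ 2 + D) ∂(sigma g) := by
    refine integral_mono_ae (hdm.integrable le_top) (hi2.add (integrable_const D)) ?_
    filter_upwards [hg.ae_mem_SM hn] with z hz
    have := hD' m z.1 hz.1.1
    rw [rho] at this
    linarith
  rw [integral_add hi2 (integrable_const D)] at h4
  linarith

end BoundaryCutoff

end SimpleC11

namespace SimpleC11

/-! ### The boundary trace of sections in `H¹(N, X)` -/

section Trace

variable {n : ℕ} {g : MetricField n}

theorem exists_ae_abs_le_of_memLp_top {α : Type*} [MeasurableSpace α] {μ : Measure α} {f : α → ℝ}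
    (hf : MemLp f ∞ μ) : ∃ C, 0 ≤ C ∧ ∀ᵐ z ∂μ, |f z| ≤ C := by
  refine ⟨(eLpNorm f ∞ μ).toReal, ENNReal.toReal_nonneg, ?_⟩
  rw [eLpNorm_exponent_top]
  filter_upwards [ae_le_eLpNormEssSup (f := f) (μ := μ)] with z hz
  have h2 : eLpNormEssSup f μ ≠ ∞ := by
    rw [← eLpNorm_exponent_top]
    exact hf.2.ne
  have := ENNReal.toReal_mono h2 hz
  simpa using this

/-- The geodesic derivative of the boundary defining function. -/
noncomputable def drho (z : Pt n × Pt n) : ℝ := fderiv ℝ rho z.1 z.2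

theorem IsC11Metric.isC1_drho (hg : IsC11Metric g) : IsC1 g drho := by
  have h : (drho : Pt n × Pt n → ℝ) = fun z => -2 * ∑ k, z.1 k * z.2 k := by
    funext z
    rw [drho, fderiv_rho]
  rw [h]
  have h1 : ∀ k, IsC1 g fun z => z.1 k * z.2 k := fun k =>
    (isC1_fst (c := fun x : Pt n => x k) (contDiff_euclidean.1 contDiff_id k)).mul
      (hg.isC1_snd_apply k)
  exact contDiffOn_const.mul (ContDiffOn.sum fun k _ => h1 k)

theorem IsC1N.geoXN_sub {V W : Pt n × Pt n → Pt n} (hV : IsC1N g V) (hW : IsC1N g W)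
    {z : Pt n × Pt n} (hz : z ∈ SM g ∧ z.1 ∈ Metric.ball (0 : Pt n) 1) :
    geoXN g (fun y => V y - W y) z = geoXN g V z - geoXN g W z := by
  have hi : z ∈ slitInt n := ⟨hz.2, ne_zero_of_mem_SM hz.1⟩
  have hd : ∀ {U : Pt n × Pt n → Pt n}, IsC1N g U → DifferentiableAt ℝ (U ∘ radial g) z :=
    fun hU => (hU.contDiff.differentiableOn one_ne_zero z (slitInt_subset hi)).differentiableAt
      (slitTM_mem_nhds hi)
  have h := ((hd hV).hasFDerivAt.fun_sub (hd hW).hasFDerivAt).fderiv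
  have h2 : (fun y => V y - W y) ∘ radial g = fun y => (V ∘ radial g) y - (W ∘ radial g) y := rfl
  simp only [geoXN_eq, geoX_eq, dRadial_eq_fderiv _ hi]
  rw [h2, h, sub_eq_add_neg (V z), chr_add_right, chr_neg_right, sub_apply]
  abel

theorem IsC11Metric.two_mul_abs_gInner_le (hg : IsC11Metric g) {x : Pt n} (hx : x ∈ M n)
    (a b : Pt n) : 2 * |gInner g x a b| ≤ gInner g x a a + gInner g x b b := by
  have h1 := hg.gInner_nonneg hx (a + b)
  have h2 := hg.gInner_nonneg hx (a - b)
  simp only [gInner_add_left, gInner_add_right, gInner_sub_left, gInner_sub_right,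
    hg.gInner_comm hx b a] at h1 h2
  have h3 : |gInner g x a b| ≤ (gInner g x a a + gInner g x b b) / 2 :=
    abs_le.2 ⟨by linarith, by linarith⟩
  linarith

theorem IsC1N.memLp_two_apply (hg : IsC11Metric g) (hn : n ≠ 0) {W : Pt n × Pt n → Pt n}
    (hW : IsC1N g W) (k : Fin n) : MemLp (fun z => W z k) 2 (sigma g) := by
  have := hg.isFiniteMeasure_sigma
  exact ((hW.unifLip_apply hg hn k).memLp_top hg hn).mono_exponent le_top

theorem IsC1N.memLp_two_geoXN (hg : IsC11Metric g) (hn : n ≠ 0) {W : Pt n × Pt n → Pt n}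
    (hW : IsC1N g W) (k : Fin n) : MemLp (fun z => geoXN g W z k) 2 (sigma g) := by
  have := hg.isFiniteMeasure_sigma
  exact (hW.memLp_top_geoXN hg hn k).mono_exponent le_top

theorem integrable_gInner (hg : IsC11Metric g) (hn : n ≠ 0) {V W : Pt n × Pt n → Pt n}
    (hV : ∀ i, MemLp (fun z => V z i) 2 (sigma g)) (hW : ∀ i, MemLp (fun z => W z i) 2 (sigma g)) :
    Integrable (fun z => gInner g z.1 (V z) (W z)) (sigma g) :=
  memLp_one_iff_integrable.1 (memLp_gInner_of hg hn hV hW)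

theorem integrable_bdd_mul {α : Type*} [MeasurableSpace α] {μ : Measure α} {b f : α → ℝ}
    (hb : MemLp b ∞ μ) (hf : Integrable f μ) : Integrable (fun z => b z * f z) μ :=
  memLp_one_iff_integrable.1 ((memLp_one_iff_integrable.2 hf).mul' hb)

theorem memLp_top_dcut_mul_drho_sq (hg : IsC11Metric g) (hn : n ≠ 0) (m : ℕ) :
    MemLp (fun z : Pt n × Pt n => dcut m z.1 * (drho z * drho z)) ∞ (sigma g) :=
  MemLp.mul' (r := ∞) (((hg.isC1_drho.mul hg.isC1_drho).unifLip hg hn).memLp_top hg hn)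
    (((cutoff_dcut m).unifLip hg hn).memLp_top hg hn)

/-- The trace estimate for `C^1` sections. -/
theorem IsC11Metric.exists_trace_le (hg : IsC11Metric g) (hn : n ≠ 0) :
    ∃ C, 0 ≤ C ∧ ∀ (m : ℕ) (W : Pt n × Pt n → Pt n), IsC1N g W →
      ∫ z, (dcut m z.1 * (drho z * drho z)) * gInner g z.1 (W z) (W z) ∂(sigma g)
        ≤ C * ∫ z, (gInner g z.1 (W z) (W z) + gInner g z.1 (geoXN g W z) (geoXN g W z))
          ∂(sigma g) := by
  have hdr := hg.isC1_drho.unifLip hg hn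
  obtain ⟨A, hA, hA'⟩ := exists_ae_abs_le_of_memLp_top (hdr.memLp_top hg hn)
  obtain ⟨B, hB, hB'⟩ := exists_ae_abs_le_of_memLp_top (hdr.memLp_top_geoX hg hn)
  refine ⟨A + B, add_nonneg hA hB, fun m W hW => ?_⟩
  have hWW := (hW.isC1_gInner hg hW)
  have hf := hg.isC1_drho.mul hWW
  -- Integrating the X-derivative of c_m · Xρ · |W|²: the derivative of the cutoff contributes a
  -- second factor Xρ, so the boundary term is nonnegative, and the other terms are bounded by ‖W‖²
  -- + ‖XW‖².
  have h1 := (cutoff_cut m).integral_geoX hg hn (hf.unifLip hg hn)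
  have hW2 := hW.memLp_two_apply hg hn
  have hX2 := hW.memLp_two_geoXN hg hn
  have hi1 := integrable_gInner hg hn hW2 hW2
  have hi2 := integrable_gInner hg hn hX2 hX2
  have := hg.isFiniteMeasure_sigma
  have hi3 : Integrable (fun z : Pt n × Pt n => cut m z.1 *
      geoX g (fun y => drho y * gInner g y.1 (W y) (W y)) z) (sigma g) :=
    integrable_bdd_mul (((cutoff_cut m).unifLip hg hn).memLp_top hg hn)
      (((hf.unifLip hg hn).memLp_top_geoX hg hn).integrable le_top)
  have hi4 := integrable_bdd_mul (memLp_top_dcut_mul_drho_sq hg hn m) hi1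
  have e1 : ∀ z : Pt n × Pt n, fderiv ℝ (cut m) z.1 z.2 * (drho z * gInner g z.1 (W z) (W z))
      = (dcut m z.1 * (drho z * drho z)) * gInner g z.1 (W z) (W z) := fun z => by
    rw [fderiv_cut, ← drho]
    ring
  simp only [e1] at h1
  rw [integral_add hi3 hi4] at h1
  rw [← integral_const_mul]
  have h2 : ∫ z : Pt n × Pt n, -(cut m z.1 *
      geoX g (fun y => drho y * gInner g y.1 (W y) (W y)) z) ∂(sigma g)
      ≤ ∫ z, (A + B) * (gInner g z.1 (W z) (W z) + gInner g z.1 (geoXN g W z) (geoXN g W z))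
          ∂(sigma g) := by
    refine integral_mono_ae hi3.neg ((hi1.add hi2).const_mul _) ?_
    filter_upwards [hA', hB', hg.ae_mem_SM hn] with z h3 h4 hz
    rw [(hg.isC1_drho.diffPt hz).geoX_mul (hWW.diffPt hz), hW.geoX_gInner hg hW hz,
      hg.gInner_comm hz.1.1 (geoXN g W z) (W z)]
    have h5 := hg.two_mul_abs_gInner_le hz.1.1 (W z) (geoXN g W z)
    have h6 := hg.gInner_nonneg hz.1.1 (W z)
    have h7 := hg.gInner_nonneg hz.1.1 (geoXN g W z)
    have h8 := cut_nonneg m z.1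
    have h9 := cut_le_one m z.1
    set p := gInner g z.1 (W z) (W z)
    set q := gInner g z.1 (geoXN g W z) (geoXN g W z)
    set r := gInner g z.1 (W z) (geoXN g W z)
    have h10 : |drho z * (r + r) + geoX g drho z * p| ≤ A * (p + q) + B * p := by
      refine (abs_add_le _ _).trans (add_le_add ?_ ?_)
      · rw [abs_mul, ← two_mul, abs_mul, abs_two]
        exact mul_le_mul h3 h5 (by positivity) hA
      · rw [abs_mul, abs_of_nonneg h6]
        exact mul_le_mul_of_nonneg_right h4 h6
    have h11 : B * p ≤ B * (p + q) := mul_le_mul_of_nonneg_left (by linarith) hB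
    calc -(cut m z.1 * (drho z * (r + r) + geoX g drho z * p))
        ≤ |cut m z.1 * (drho z * (r + r) + geoX g drho z * p)| := neg_le_abs _
      _ ≤ |drho z * (r + r) + geoX g drho z * p| := by
        rw [abs_mul, abs_of_nonneg h8]
        exact mul_le_of_le_one_left (abs_nonneg _) h9
      _ ≤ _ := by linarith
  rw [integral_neg] at h2
  linarith

/-- The trace of the vertical gradient of a function that vanishes at the boundary is zero. -/
theorem tendsto_integral_trace (hg : IsC11Metric g) (hn : n ≠ 0) {u : Pt n × Pt n → ℝ}
    (hu : UnifLip g u) (hu0 : VanishesAtBoundary g u) {Xvu : Pt n × Pt n → Pt n}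
    (hv : IsH1NX g (gradV g u) Xvu) :
    Tendsto (fun m => ∫ z, (dcut m z.1 * (drho z * drho z))
      * gInner g z.1 (gradV g u z) (gradV g u z) ∂(sigma g)) atTop (𝓝 0) := by
  have := hg.isFiniteMeasure_sigma
  obtain ⟨Vk, hVk, hVl, hXl⟩ := hv.approx
  obtain ⟨C, hC, htr⟩ := hg.exists_trace_le hn
  set V := gradV g u with hVdef
  have hV2 := hv.memL2.memLp_apply hg hn
  have hX2 := hv.memL2_X.memLp_apply hg hn
  have hV := lTo_apply_of_tendstoL2N hg hn
    (fun k i => ((hVk k).unifLip_apply hg hn i).memLp_top hg hn) hv.memL2 hVl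
  have hX := lTo_apply_of_tendstoL2N hg hn
    (fun k i => (hVk k).memLp_top_geoXN hg hn i) hv.memL2_X hXl
  set E : ℕ → ℝ := fun k => ∫ z, (gInner g z.1 (V z - Vk k z) (V z - Vk k z)
    + gInner g z.1 (Xvu z - geoXN g (Vk k) z) (Xvu z - geoXN g (Vk k) z)) ∂(sigma g) with hE
  have hE0 : Tendsto E atTop (𝓝 0) := by
    have h1 : ∀ {U : Pt n × Pt n → Pt n} {Uk : ℕ → Pt n × Pt n → Pt n},
        (∀ i, LTo (sigma g) 2 (fun k z => Uk k z i) (fun z => U z i)) → ∀ i,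
        LTo (sigma g) 2 (fun k z => (U z - Uk k z) i) (fun z => (U z - U z) i) := fun h i =>
      (LTo.const (h i).2).sub one_le_two (h i)
    have h2 := ((lTo_gInner hg hn (h1 hV) (h1 hV)).add le_rfl
      (lTo_gInner hg hn (h1 hX) (h1 hX))).integral
    simpa [gInner_zero_left] using h2
  have hdm := memLp_top_dcut_mul_drho_sq hg hn (n := n)
  -- The trace estimate for V_l - V_k, in the limit l → ∞ with m fixed; its constant does not depend
  -- on m.
  have hdiff : ∀ m k, ∫ z, (dcut m z.1 * (drho z * drho z))
      * gInner g z.1 (V z - Vk k z) (V z - Vk k z) ∂(sigma g) ≤ C * E k := by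
    intro m k
    have h1 : ∀ {U : Pt n × Pt n → Pt n} {Uk : ℕ → Pt n × Pt n → Pt n},
        (∀ i, LTo (sigma g) 2 (fun k z => Uk k z i) (fun z => U z i)) → ∀ i,
        LTo (sigma g) 2 (fun l z => (Uk l z - Uk k z) i) (fun z => (U z - Uk k z) i) := fun h i =>
      (h i).sub one_le_two (LTo.const ((h i).1 k))
    have hVV := lTo_gInner hg hn (h1 hV) (h1 hV)
    have h2 := (hVV.bdd_mul (hdm m)).integral
    have h3 := ((hVV.add le_rfl (lTo_gInner hg hn (h1 hX) (h1 hX))).integral).const_mul C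
    refine le_of_tendsto_of_tendsto' h2 h3 fun l => ?_
    refine (htr m (fun z => Vk l z - Vk k z) ((hVk l).sub (hVk k))).trans (le_of_eq ?_)
    congr 1
    refine integral_congr_ae ?_
    filter_upwards [hg.ae_mem_SM hn] with z hz
    rw [(hVk l).geoXN_sub (hVk k) hz]
  -- Against a C¹ section the vertical derivative is moved off u. What remains is u times the
  -- derivative of the cutoff times a bounded function.
  have hmix : ∀ k, Tendsto (fun m => ∫ z, (dcut m z.1 * (drho z * drho z))
      * gInner g z.1 (V z) (Vk k z) ∂(sigma g)) atTop (𝓝 0) := by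
    intro k
    have hW := (hVk k).smul (hg.isC1_drho.mul hg.isC1_drho)
    have hWu := hW.unifLip_apply hg hn
    have hdivW : MemLp (divV g fun z => (drho z * drho z) • Vk k z) ∞ (sigma g) :=
      memLp_finsetSum _ fun j _ => (hWu j).memLp_top_partialV hg hn j
    have h1 := (tendsto_integral_dcut_mul hg hn hu hu0 (hdivW.integrable le_top)).neg
    rw [neg_zero] at h1
    refine h1.congr fun m => ?_
    have h2 := (cutoff_dcut m).integral_partialV_mul hg hn hu hWu hW.orth
    have hcm := ((cutoff_dcut m).unifLip hg hn).memLp_top hg hn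
    have hi1 : Integrable (fun z => dcut m z.1 * ∑ j, partialV g j u z
        * ((drho z * drho z) • Vk k z) j) (sigma g) := by
      refine integrable_bdd_mul hcm (integrable_finsetSum _ fun j _ => ?_)
      have : MemLp (fun z => partialV g j u z * ((drho z * drho z) • Vk k z) j) ∞ (sigma g) :=
        ((hWu j).memLp_top hg hn).mul' (hu.memLp_top_partialV hg hn j)
      exact this.integrable le_top
    have hi2 : Integrable (fun z => dcut m z.1 * divV g (fun z => (drho z * drho z) • Vk k z) z
        * u z) (sigma g) := by
      have e1 : MemLp (fun z => dcut m z.1 * divV g (fun z => (drho z * drho z) • Vk k z) z) ∞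
        (sigma g) := hdivW.mul' hcm
      exact integrable_bdd_mul e1 ((hu.memLp_top hg hn).integrable le_top)
    rw [integral_add hi1 hi2] at h2
    have h3 : ∫ z, dcut m z.1 * ∑ j, partialV g j u z * ((drho z * drho z) • Vk k z) j ∂(sigma g)
        = ∫ z, (dcut m z.1 * (drho z * drho z)) * gInner g z.1 (V z) (Vk k z) ∂(sigma g) := by
      refine integral_congr_ae ?_
      filter_upwards [hg.ae_mem_SM hn] with z hz
      rw [hVdef, hg.gInner_gradV_left hz.1.1]
      simp only [PiLp.smul_apply, smul_eq_mul, Finset.mul_sum]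
      exact Finset.sum_congr rfl fun j _ => by ring
    rw [h3] at h2
    rw [eq_neg_of_add_eq_zero_left h2]
    congr 1
    exact integral_congr_ae (Eventually.of_forall fun z => by ring)
  have hpos : ∀ m, 0 ≤ ∫ z, (dcut m z.1 * (drho z * drho z))
      * gInner g z.1 (V z) (V z) ∂(sigma g) := fun m => by
    refine integral_nonneg_of_ae ?_
    filter_upwards [hg.ae_mem_SM hn] with z hz
    exact mul_nonneg (mul_nonneg (dcut_nonneg m z.1) (mul_self_nonneg _))
      (hg.gInner_nonneg hz.1.1 _)
  -- |V|² ≤ |V - V_k|² + 2⟨V, V_k⟩, the difference being |V_k|².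
  have hle : ∀ m k, ∫ z, (dcut m z.1 * (drho z * drho z)) * gInner g z.1 (V z) (V z) ∂(sigma g)
      ≤ C * E k + 2 * ∫ z, (dcut m z.1 * (drho z * drho z))
        * gInner g z.1 (V z) (Vk k z) ∂(sigma g) := by
    intro m k
    have hVk2 := (hVk k).memLp_two_apply hg hn
    have hs2 : ∀ i, MemLp (fun z => (V z - Vk k z) i) 2 (sigma g) := fun i => (hV2 i).sub (hVk2 i)
    have i1 := integrable_bdd_mul (hdm m) (integrable_gInner hg hn hV2 hV2)
    have i2 := integrable_bdd_mul (hdm m) (integrable_gInner hg hn hs2 hs2)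
    have i3 := integrable_bdd_mul (hdm m) (integrable_gInner hg hn hV2 hVk2)
    refine le_trans ?_ (add_le_add_left (hdiff m k) _)
    rw [← integral_const_mul, ← integral_add i2 (i3.const_mul 2)]
    refine integral_mono_ae i1 (i2.add (i3.const_mul 2)) ?_
    filter_upwards [hg.ae_mem_SM hn] with z hz
    have h1 : 0 ≤ dcut m z.1 * (drho z * drho z) :=
      mul_nonneg (dcut_nonneg m z.1) (mul_self_nonneg _)
    have h2 := hg.gInner_nonneg hz.1.1 (Vk k z)
    simp only [gInner_sub_left, gInner_sub_right, hg.gInner_comm hz.1.1 (Vk k z) (V z)]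
    nlinarith [mul_nonneg h1 h2]
  rw [Metric.tendsto_atTop]
  intro ε hε
  have hE1 : ∀ᶠ k in atTop, C * E k < ε / 2 := by
    have := hE0.const_mul C
    rw [mul_zero] at this
    exact this.eventually (gt_mem_nhds (half_pos hε))
  -- The approximant k is fixed first, by the bound uniform in m; only then does m grow.
  obtain ⟨k, hk⟩ := hE1.exists
  have h1 := (hmix k).const_mul 2
  rw [mul_zero] at h1
  obtain ⟨m0, hm0⟩ := eventually_atTop.1 (h1.eventually (gt_mem_nhds (half_pos hε)))
  refine ⟨m0, fun m hm => ?_⟩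
  rw [Real.dist_eq, sub_zero, abs_of_nonneg (hpos m)]
  have := hle m k
  have := hm0 m hm
  linarith

/-- The derivative of the cutoff along X is `dcut` times Xρ, and ∇^h u is merely bounded. A weighted
Cauchy–Schwarz inequality, with `dcut` as weight, separates the bounded integral of `dcut` from the
trace integral of (Xρ)²|∇^v u|², which tends to zero. -/
theorem tendsto_integral_boundary (hg : IsC11Metric g) (hn : n ≠ 0) {u : Pt n × Pt n → ℝ}
    (hu : UnifLip g u) (hu0 : VanishesAtBoundary g u) {Xvu : Pt n × Pt n → Pt n}
    (hv : IsH1NX g (gradV g u) Xvu) :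
    Tendsto (fun m => ∫ z, fderiv ℝ (cut m) z.1 z.2 * ∑ k, delta g k u z * gradV g u z k ∂(sigma g))
      atTop (𝓝 0) := by
  have := hg.isFiniteMeasure_sigma
  obtain ⟨B, hB⟩ := exists_integral_dcut_le hg hn
  obtain ⟨c, hc, hlow⟩ := hg.exists_lower_bound
  have hT := tendsto_integral_trace hg hn hu hu0 hv
  have hδ := fun k => exists_ae_abs_le_of_memLp_top (hu.memLp_top_delta hg hn k)
  choose A hA hA' using hδ
  set A2 := ∑ k, A k ^ 2 with hA2
  have hA20 : 0 ≤ A2 := Finset.sum_nonneg fun k _ => sq_nonneg _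
  have hV := hv.memL2.memLp_apply hg hn
  have hdm := fun m => ((cutoff_dcut (n := n) m).unifLip hg hn).memLp_top hg hn
  have hint : ∀ m, Integrable (fun z => fderiv ℝ (cut m) z.1 z.2 *
      ∑ k, delta g k u z * gradV g u z k) (sigma g) := by
    intro m
    have e1 : MemLp (fun z : Pt n × Pt n => fderiv ℝ (cut m) z.1 z.2) ∞ (sigma g) := by
      simp only [fderiv_cut]
      exact MemLp.mul' (r := ∞) ((hg.isC1_drho.unifLip hg hn).memLp_top hg hn) (hdm m)
    refine integrable_bdd_mul e1 (integrable_finsetSum _ fun k _ => ?_)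
    exact integrable_bdd_mul (hu.memLp_top_delta hg hn k) ((hV k).integrable one_le_two)
  -- The parameter s shifts weight between the bounded term and the vanishing one; c⁻¹ comes from
  -- comparing Euclidean length with that of g.
  have key : ∀ s > 0, ∀ m, |∫ z, fderiv ℝ (cut m) z.1 z.2 *
      ∑ k, delta g k u z * gradV g u z k ∂(sigma g)| ≤ s * A2 * B + s⁻¹ * c⁻¹ *
      ∫ z, (dcut m z.1 * (drho z * drho z)) * gInner g z.1 (gradV g u z) (gradV g u z)
        ∂(sigma g) := by
    intro s hs m
    have i1 := (hdm m).integrable le_top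
    have i2 := integrable_bdd_mul (memLp_top_dcut_mul_drho_sq hg hn m)
      (integrable_gInner hg hn hV hV)
    have h1 : s * A2 * ∫ z, dcut m z.1 ∂(sigma g) ≤ s * A2 * B :=
      mul_le_mul_of_nonneg_left (hB m) (by positivity)
    refine (abs_integral_le_integral_abs).trans (le_trans ?_ (add_le_add_left h1 _))
    rw [← integral_const_mul, ← integral_const_mul, ← integral_add (i1.const_mul _)
      (i2.const_mul _)]
    refine integral_mono_ae (hint m).abs ((i1.const_mul _).add (i2.const_mul _)) ?_
    filter_upwards [hg.ae_mem_SM hn, ae_all_iff.2 hA'] with z hz hz2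
    set V := gradV g u z
    have hd := dcut_nonneg m z.1
    have e1 : |drho z * ∑ k, delta g k u z * V k|
        ≤ s * A2 + s⁻¹ * c⁻¹ * ((drho z * drho z) * gInner g z.1 V V) := by
      have e2 : ∀ k, |drho z * (delta g k u z * V k)|
          ≤ s * A k ^ 2 + s⁻¹ * ((drho z * drho z) * V k ^ 2) := by
        intro k
        have f1 : delta g k u z ^ 2 ≤ A k ^ 2 := sq_le_sq' (abs_le.1 (hz2 k)).1 (abs_le.1 (hz2 k)).2
        have f2 : |drho z * (delta g k u z * V k)|
            ≤ s * delta g k u z ^ 2 + s⁻¹ * ((drho z * drho z) * V k ^ 2) := by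
          have f3 : drho z * (delta g k u z * V k) = delta g k u z * (drho z * V k) := by ring
          have f4 : drho z * drho z * V k ^ 2 = (drho z * V k) ^ 2 := by ring
          rw [f3, f4]
          set a := delta g k u z
          set b := drho z * V k
          have f5 : s * a ^ 2 + s⁻¹ * b ^ 2 - a * b = s⁻¹ * ((s * a - b / 2) ^ 2 + 3 / 4 * b ^ 2) := by
            field_simp
            ring
          have f6 : s * a ^ 2 + s⁻¹ * b ^ 2 + a * b = s⁻¹ * ((s * a + b / 2) ^ 2 + 3 / 4 * b ^ 2) := by
            field_simp
            ring
          have f7 : 0 ≤ s⁻¹ * ((s * a - b / 2) ^ 2 + 3 / 4 * b ^ 2) := by positivity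
          have f8 : 0 ≤ s⁻¹ * ((s * a + b / 2) ^ 2 + 3 / 4 * b ^ 2) := by positivity
          exact abs_le.2 ⟨by linarith, by linarith⟩
        have f9 := mul_le_mul_of_nonneg_left f1 hs.le
        linarith
      have e3 : ∑ k, V k ^ 2 ≤ c⁻¹ * gInner g z.1 V V := by
        rw [← EuclideanSpace.real_norm_sq_eq, inv_mul_eq_div, le_div_iff₀ hc, mul_comm]
        exact hlow z.1 hz.1.1 V
      rw [Finset.mul_sum]
      refine (Finset.abs_sum_le_sum_abs _ _).trans ((Finset.sum_le_sum fun k _ => e2 k).trans ?_)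
      rw [Finset.sum_add_distrib, ← Finset.mul_sum, ← Finset.mul_sum, ← Finset.mul_sum]
      have e4 := mul_le_mul_of_nonneg_left e3
        (mul_nonneg (inv_nonneg.2 hs.le) (mul_self_nonneg (drho z)))
      calc s * A2 + s⁻¹ * (drho z * drho z * ∑ k, V k ^ 2)
          = s * A2 + s⁻¹ * (drho z * drho z) * ∑ k, V k ^ 2 := by ring
        _ ≤ s * A2 + s⁻¹ * (drho z * drho z) * (c⁻¹ * gInner g z.1 V V) := by linarith
        _ = _ := by ring
    rw [fderiv_cut, ← drho, mul_assoc, abs_mul, abs_of_nonneg hd]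
    calc dcut m z.1 * |drho z * ∑ k, delta g k u z * V k|
        ≤ dcut m z.1 * (s * A2 + s⁻¹ * c⁻¹ * ((drho z * drho z) * gInner g z.1 V V)) :=
          mul_le_mul_of_nonneg_left e1 hd
      _ = _ := by ring
  have hB0 : 0 ≤ B := (integral_nonneg fun z => dcut_nonneg 0 z.1).trans (hB 0)
  rw [Metric.tendsto_atTop]
  intro ε hε
  -- This makes s · A2 · B at most ε/2; the summand 1 keeps the denominator positive.
  set s := ε / (2 * (A2 * B + 1)) with hs
  have hs0 : 0 < s := by positivity
  have hs1 : s * A2 * B ≤ ε / 2 := by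
    have h1 : s * (A2 * B + 1) = ε / 2 := by
      rw [hs]
      field_simp
    nlinarith
  have h1 := hT.const_mul (s⁻¹ * c⁻¹)
  rw [mul_zero] at h1
  obtain ⟨m0, hm0⟩ := eventually_atTop.1 (h1.eventually (gt_mem_nhds (half_pos hε)))
  refine ⟨m0, fun m hm => ?_⟩
  rw [Real.dist_eq, sub_zero]
  have h2 := key s hs0 m
  have h3 := hm0 m hm
  linarith

end Trace

end SimpleC11

namespace SimpleC11

/-! ### The Pestov identity -/

section Pestov

variable {n : ℕ} {g : MetricField n} {u XXu : Pt n × Pt n → ℝ} {vXu hXu Xvu : Pt n × Pt n → Pt n}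

theorem integrable_sum_mul (hg : IsC11Metric g) {a : Fin n → Pt n × Pt n → ℝ}
    {Y : Pt n × Pt n → Pt n} (ha : ∀ k, MemLp (a k) ∞ (sigma g))
    (hY : ∀ k, MemLp (fun z => Y z k) 2 (sigma g)) :
    Integrable (fun z => ∑ k, a k z * Y z k) (sigma g) := by
  have := hg.isFiniteMeasure_sigma
  exact integrable_finsetSum _ fun k _ =>
    integrable_bdd_mul (ha k) ((hY k).integrable one_le_two)

theorem lTo_sum_mul (hg : IsC11Metric g) {a : Fin n → Pt n × Pt n → ℝ}
    {Yk : ℕ → Pt n × Pt n → Pt n} {Y : Pt n × Pt n → Pt n} (ha : ∀ k, MemLp (a k) ∞ (sigma g))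
    (hY : ∀ i, LTo (sigma g) 2 (fun k z => Yk k z i) (fun z => Y z i)) :
    LTo (sigma g) 1 (fun k z => ∑ i, a i z * Yk k z i) (fun z => ∑ i, a i z * Y z i) := by
  have := hg.isFiniteMeasure_sigma
  refine LTo.sum le_rfl _ fun i => ?_
  have h := (hY i).mul_memLp ((ha i).mono_exponent le_top)
  simpa only [mul_comm] using h

/-- The correction (Xu)v in ∇^h drops out against vectors orthogonal to v. -/
theorem sum_delta_mul_eq (hg : IsC11Metric g) {w : Pt n × Pt n → ℝ} {z : Pt n × Pt n}
    (hz : z.1 ∈ M n) {Y : Pt n} (hY : gInner g z.1 Y z.2 = 0) :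
    ∑ k, delta g k w z * Y k = gInner g z.1 (gradH g w z) Y := by
  rw [hg.gInner_gradH_left hz, hg.gInner_comm hz z.2 Y, hY, mul_zero, sub_zero]

/-- No cutoff is left: its derivative multiplied u, which vanishes at the boundary, while w may be
arbitrary there. -/
theorem UnifLip.integral_commutator_gradients (hg : IsC11Metric g) (hn : n ≠ 0)
    (hu : UnifLip g u) (hu0 : VanishesAtBoundary g u) {w : Pt n × Pt n → ℝ} (hw : UnifLip g w) :
    ∫ z, (∑ j, delta g j u z * gradV g w z j - gInner g z.1 (gradH g w z) (gradV g u z)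
      + ((n : ℝ) - 1) * (u z * geoX g w z)) ∂(sigma g) = 0 := by
  have := hg.isFiniteMeasure_sigma
  set F : Pt n × Pt n → ℝ := fun z => ∑ j, ∑ k, (g z.1)⁻¹ j k * (delta g j u z * partialV g k w z
        - partialV g k u z * delta g j w z) + ((n : ℝ) - 1) * (u z * geoX g w z) with hF
  set G : Pt n × Pt n → ℝ := fun z => ∑ j, ∑ k,
    (g z.1)⁻¹ j k * fderiv ℝ rho z.1 (e j) * partialV g k w z with hG
  have hinv := fun j k => hg.memLp_top_of_continuousOn hn (hg.continuousOn_inv j k)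
  have hFi : MemLp F ∞ (sigma g) := by
    refine MemLp.add (memLp_finsetSum _ fun j _ => memLp_finsetSum _ fun k _ => ?_)
      (MemLp.const_mul (MemLp.mul' (r := ∞) (hw.memLp_top_geoX hg hn) (hu.memLp_top hg hn)) _)
    exact MemLp.mul' (r := ∞) ((MemLp.mul' (r := ∞) (hw.memLp_top_partialV hg hn k)
      (hu.memLp_top_delta hg hn j)).sub (MemLp.mul' (r := ∞) (hw.memLp_top_delta hg hn j)
      (hu.memLp_top_partialV hg hn k))) (hinv j k)
  have hGi : MemLp G ∞ (sigma g) := by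
    refine memLp_finsetSum _ fun j _ => memLp_finsetSum _ fun k _ => ?_
    have h1 : MemLp (fun z : Pt n × Pt n => fderiv ℝ rho z.1 (e j)) ∞ (sigma g) :=
      hg.memLp_top_fst hn (c := fun x => fderiv ℝ rho x (e j))
        (contDiff_rho.continuous_fderiv_apply one_ne_zero |>.comp
          (continuous_id.prodMk continuous_const)).continuousOn
    exact MemLp.mul' (r := ∞) (hw.memLp_top_partialV hg hn k)
      (MemLp.mul' (r := ∞) h1 (hinv j k))
  have h1 := tendsto_integral_cut_mul hg hn (hFi.integrable le_top)
  have h2 := tendsto_integral_dcut_mul hg hn hu hu0 (hGi.integrable le_top)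
  have h3 : ∀ m, ∫ z, cut m z.1 * F z ∂(sigma g) + ∫ z, dcut m z.1 * (u z * G z) ∂(sigma g) = 0 := by
    intro m
    rw [← (cutoff_cut m).integral_commutator_gradients hg hn hu hw, ← integral_add]
    · refine integral_congr_ae (Eventually.of_forall fun z => ?_)
      have e1 : u z * ∑ j, ∑ k, (g z.1)⁻¹ j k * fderiv ℝ (cut m) z.1 (e j) * partialV g k w z
          = dcut m z.1 * (u z * G z) := by
        simp only [hG, Finset.mul_sum, fderiv_cut]
        exact Finset.sum_congr rfl fun j _ => Finset.sum_congr rfl fun k _ => by ring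
      simp only [e1, hF]
    · exact integrable_bdd_mul (((cutoff_cut m).unifLip hg hn).memLp_top hg hn)
        (hFi.integrable le_top)
    · exact integrable_bdd_mul (((cutoff_dcut m).unifLip hg hn).memLp_top hg hn)
        (integrable_bdd_mul (hu.memLp_top hg hn) (hGi.integrable le_top))
  have h4 := h1.add h2
  simp only [h3, add_zero] at h4
  have h5 : ∫ z, F z ∂(sigma g) = 0 := tendsto_nhds_unique h4 tendsto_const_nhds
  rw [← h5]
  refine integral_congr_ae ?_
  filter_upwards [hu.ae_diffPt hg hn] with z hz
  have e1 := hz.gInner_gradV_snd hg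
  rw [← sum_delta_mul_eq hg hz.mem.1 e1, hF]
  simp only [mul_sub, Finset.sum_sub_distrib]
  congr 2
  · refine Finset.sum_congr rfl fun j _ => ?_
    simp only [gradV, Finset.mul_sum]
    exact Finset.sum_congr rfl fun k _ => by ring
  · refine Finset.sum_congr rfl fun j _ => ?_
    simp only [gradV, Finset.mul_sum]
    exact Finset.sum_congr rfl fun k _ => by ring

/-- Skew-adjointness of X; one factor vanishing at the boundary is enough. -/
theorem UnifLip.integral_geoX_mul (hg : IsC11Metric g) (hn : n ≠ 0)
    (hu : UnifLip g u) (hu0 : VanishesAtBoundary g u) {w : Pt n × Pt n → ℝ} (hw : UnifLip g w) :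
    ∫ z, (u z * geoX g w z + geoX g u z * w z) ∂(sigma g) = 0 := by
  have := hg.isFiniteMeasure_sigma
  have hi : MemLp (fun z => u z * geoX g w z + geoX g u z * w z) ∞ (sigma g) :=
    (MemLp.mul' (r := ∞) (hw.memLp_top_geoX hg hn) (hu.memLp_top hg hn)).add
      (MemLp.mul' (r := ∞) (hw.memLp_top hg hn) (hu.memLp_top_geoX hg hn))
  have hG : MemLp (fun z => drho z * w z) ∞ (sigma g) :=
    MemLp.mul' (r := ∞) (hw.memLp_top hg hn) ((hg.isC1_drho.unifLip hg hn).memLp_top hg hn)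
  have h1 := tendsto_integral_cut_mul hg hn (hi.integrable le_top)
  have h2 := tendsto_integral_dcut_mul hg hn hu hu0 (hG.integrable le_top)
  have h3 : ∀ m, ∫ z, cut m z.1 * (u z * geoX g w z + geoX g u z * w z) ∂(sigma g)
      + ∫ z, dcut m z.1 * (u z * (drho z * w z)) ∂(sigma g) = 0 := by
    intro m
    rw [← (cutoff_cut m).integral_geoX hg hn (hu.mul hg hn hw), ← integral_add]
    · refine integral_congr_ae ?_
      filter_upwards [hu.ae_diffPt hg hn, hw.ae_diffPt hg hn] with z h3 h4
      rw [h3.geoX_mul h4, fderiv_cut, ← drho]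
      ring
    · exact integrable_bdd_mul (((cutoff_cut m).unifLip hg hn).memLp_top hg hn)
        (hi.integrable le_top)
    · exact integrable_bdd_mul (((cutoff_dcut m).unifLip hg hn).memLp_top hg hn)
        (integrable_bdd_mul (hu.memLp_top hg hn) (hG.integrable le_top))
  have h4 := h1.add h2
  simp only [h3, add_zero] at h4
  exact tendsto_nhds_unique h4 tendsto_const_nhds

theorem memLp_two_gradV (hg : IsC11Metric g) (hn : n ≠ 0) {f : Pt n × Pt n → ℝ}
    (hf : UnifLip g f) (j : Fin n) : MemLp (fun z => gradV g f z j) 2 (sigma g) := by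
  have := hg.isFiniteMeasure_sigma
  exact (hf.memLp_top_gradV hg hn j).mono_exponent le_top

/-- The first half of the Pestov identity. -/
theorem integral_sum_delta_mul_vXu (hg : IsC11Metric g) (hn : n ≠ 0)
    (hu : UnifLip g u) (hu0 : VanishesAtBoundary g u) (hX : IsH1 g (geoX g u) XXu vXu hXu) :
    ∫ z, ∑ k, delta g k u z * vXu z k ∂(sigma g)
      = ∫ z, gInner g z.1 (hXu z) (gradV g u z) ∂(sigma g)
        + ((n : ℝ) - 1) * ∫ z, geoX g u z * geoX g u z ∂(sigma g) := by
  have := hg.isFiniteMeasure_sigma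
  obtain ⟨wk, hwk, h1, h2, h3, h4⟩ := hX.approx
  have hw := fun k => (hwk k).unifLip hg hn
  have l1 : LTo (sigma g) 2 wk (geoX g u) :=
    ⟨fun k => ((hw k).memLp_top hg hn).mono_exponent le_top, hX.memL2, h1⟩
  have l2 : LTo (sigma g) 2 (fun k => geoX g (wk k)) XXu :=
    ⟨fun k => ((hw k).memLp_top_geoX hg hn).mono_exponent le_top, hX.memL2_X, h2⟩
  have l3 := lTo_apply_of_tendstoL2N hg hn (fun k i => (hw k).memLp_top_gradV hg hn i) hX.memL2_v h3
  have l4 := lTo_apply_of_tendstoL2N hg hn (fun k i => (hw k).memLp_top_gradH hg hn i) hX.memL2_h h4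
  have hV := memLp_two_gradV hg hn hu
  have hub := hu.memLp_top hg hn
  have hXb := hu.memLp_top_geoX hg hn
  have m1 := lTo_sum_mul hg (fun k => hu.memLp_top_delta hg hn k) l3
  have m2 := lTo_gInner hg hn l4 (fun i => LTo.const (hV i))
  have m3 : LTo (sigma g) 1 (fun k z => u z * geoX g (wk k) z) (fun z => u z * XXu z) := by
    simpa only [mul_comm] using l2.mul_memLp (hub.mono_exponent le_top)
  have m4 : LTo (sigma g) 1 (fun k z => geoX g u z * wk k z) (fun z => geoX g u z * geoX g u z) := by
    simpa only [mul_comm] using l1.mul_memLp (hXb.mono_exponent le_top)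
  have c3 : LTo (sigma g) 1 (fun k z => ((n : ℝ) - 1) * (u z * geoX g (wk k) z))
      (fun z => ((n : ℝ) - 1) * (u z * XXu z)) := m3.bdd_mul (memLp_top_const _)
  -- The commutator of the gradients for C¹ functions w_k → Xu: (∇^h u, ∇^v w) - (∇^h w, ∇^v u) +
  -- (n-1)(u, Xw) = 0 passes to the limit.
  have e1 := ((m1.sub le_rfl m2).add le_rfl c3).integral_eq_zero fun k =>
    hu.integral_commutator_gradients hg hn hu0 (hw k)
  -- Skew-adjointness turns -(u, XXu) into ‖Xu‖².
  have e2 := (m3.add le_rfl m4).integral_eq_zero fun k => hu.integral_geoX_mul hg hn hu0 (hw k)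
  have i1 := memLp_one_iff_integrable.1 m1.2
  have i2 := memLp_one_iff_integrable.1 m2.2
  have i3 := memLp_one_iff_integrable.1 m3.2
  have i4 := memLp_one_iff_integrable.1 m4.2
  rw [integral_add (memLp_one_iff_integrable.1 (m1.sub le_rfl m2).2) (i3.const_mul _),
    integral_sub i1 i2, integral_const_mul] at e1
  rw [integral_add i3 i4] at e2
  linear_combination e1 - ((n : ℝ) - 1) * e2

/-- In the weak commutator, Xu is paired with div^h(cW). Since Xu is in H¹(SM), this equals minus
the pairing of ∇^h Xu with cW, so no derivative of W remains except along X, and the identity can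
pass to W = ∇^v u in H¹(N, X). -/
theorem integral_cut_commutator (hg : IsC11Metric g) (hn : n ≠ 0) {c : Pt n → ℝ} (hc : Cutoff c)
    (hu : UnifLip g u) (hX : IsH1 g (geoX g u) XXu vXu hXu) {W : Pt n × Pt n → Pt n}
    (hW : IsC1N g W) :
    ∫ z, (c z.1 * (∑ k, delta g k u z * geoXN g W z k + ∑ l, partialV g l u z * curv g W z l
      + gInner g z.1 (hXu z) (W z)) + fderiv ℝ c z.1 z.2 * ∑ k, delta g k u z * W z k)
      ∂(sigma g) = 0 := by
  have := hg.isFiniteMeasure_sigma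
  obtain ⟨wk, hwk, h1, -, -, h4⟩ := hX.approx
  have hw := fun k => (hwk k).unifLip hg hn
  have l1 : LTo (sigma g) 2 wk (geoX g u) :=
    ⟨fun k => ((hw k).memLp_top hg hn).mono_exponent le_top, hX.memL2, h1⟩
  have l4 := lTo_apply_of_tendstoL2N hg hn (fun k i => (hw k).memLp_top_gradH hg hn i) hX.memL2_h h4
  have hWu := hW.unifLip_apply hg hn
  have hWt := fun k => (hWu k).memLp_top hg hn
  have hW2 := hW.memLp_two_apply hg hn
  have hct := (hc.unifLip hg hn).memLp_top hg hn
  have hdc : ∀ k, MemLp (fun z : Pt n × Pt n => fderiv ℝ c z.1 (e k)) ∞ (sigma g) := fun k =>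
    hg.memLp_top_fst hn (c := fun x => fderiv ℝ c x (e k))
      (hc.contDiff.continuous_fderiv_apply one_ne_zero |>.comp
        (continuous_id.prodMk continuous_const)).continuousOn
  have hdcv : MemLp (fun z : Pt n × Pt n => fderiv ℝ c z.1 z.2) ∞ (sigma g) :=
    hg.memLp_top_of_continuousOn hn (hc.contDiff.continuous_fderiv_apply one_ne_zero).continuousOn
  have hdiv : MemLp (fun z => c z.1 * divH g W z) ∞ (sigma g) := by
    have : MemLp (divH g W) ∞ (sigma g) := memLp_finsetSum _ fun j _ =>
      ((hWu j).memLp_top_delta hg hn j).add (memLp_finsetSum _ fun i _ =>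
        (hWt j).mul' (hg.memLp_top_christoffel hn i j i))
    exact MemLp.mul' (r := ∞) this hct
  have hsum : MemLp (fun z => ∑ k, fderiv ℝ c z.1 (e k) * W z k) ∞ (sigma g) :=
    memLp_finsetSum _ fun k _ => (hWt k).mul' (hdc k)
  have m1 := (lTo_gInner hg hn l4 (fun i => LTo.const (hW2 i))).bdd_mul hct
  have m2 := (l1.mul_memLp (hdiv.mono_exponent le_top))
  have m3 := (l1.mul_memLp (hsum.mono_exponent le_top))
  -- Horizontal integration by parts for the C¹ approximants of Xu, then the limit.
  have e1 := ((m1.add le_rfl m2).add le_rfl m3).integral_eq_zero fun k => by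
    rw [← hc.integral_delta_mul hg hn (hw k) hWu]
    refine integral_congr_ae ?_
    filter_upwards [hg.ae_mem_SM hn] with z hz
    rw [sum_delta_mul_eq hg hz.1.1 (hW.orth z hz.1)]
    ring
  have e2 := hc.integral_commutator_geoX_delta hg hn hu hWu
  have i1 := memLp_one_iff_integrable.1 m1.2
  have i2 := memLp_one_iff_integrable.1 m2.2
  have i3 := memLp_one_iff_integrable.1 m3.2
  have i4 : Integrable (fun z => c z.1 * (∑ k, delta g k u z * geoXN g W z k
      + ∑ l, partialV g l u z * curv g W z l)) (sigma g) :=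
    integrable_bdd_mul hct ((integrable_sum_mul hg (fun k => hu.memLp_top_delta hg hn k)
      (hW.memLp_two_geoXN hg hn)).add (integrable_sum_mul hg
        (fun k => hu.memLp_top_partialV hg hn k) (memLp_curv_apply hg hn hW2)))
  have i5 : Integrable (fun z => fderiv ℝ c z.1 z.2 * ∑ k, delta g k u z * W z k) (sigma g) :=
    integrable_bdd_mul hdcv (integrable_sum_mul hg (fun k => hu.memLp_top_delta hg hn k) hW2)
  have i6 : Integrable (fun z => (c z.1 * divH g W z) * geoX g u z
      + geoX g u z * ∑ k, fderiv ℝ c z.1 (e k) * W z k) (sigma g) := by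
    have := i2.add i3
    refine this.congr (Eventually.of_forall fun z => ?_)
    simp only [Pi.add_apply]
    ring
  have e3 : ∫ z, ((c z.1 * gInner g z.1 (hXu z) (W z) + geoX g u z * (c z.1 * divH g W z)
      + geoX g u z * ∑ k, fderiv ℝ c z.1 (e k) * W z k) + (c z.1 * (∑ k, delta g k u z
        * geoXN g W z k + ∑ l, partialV g l u z * curv g W z l)
      + fderiv ℝ c z.1 z.2 * ∑ k, delta g k u z * W z k
      - ((c z.1 * divH g W z) * geoX g u z + geoX g u z * ∑ k, fderiv ℝ c z.1 (e k) * W z k)))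
      ∂(sigma g) = 0 := by
    have i7 : Integrable (fun z => c z.1 * (∑ k, delta g k u z
        * geoXN g W z k + ∑ l, partialV g l u z * curv g W z l)
      + fderiv ℝ c z.1 z.2 * ∑ k, delta g k u z * W z k
      - ((c z.1 * divH g W z) * geoX g u z + geoX g u z * ∑ k, fderiv ℝ c z.1 (e k) * W z k))
      (sigma g) := (i4.add i5).sub i6
    rw [integral_add (memLp_one_iff_integrable.1 ((m1.add le_rfl m2).add le_rfl m3).2) i7,
      e1, zero_add]
    exact e2
  rw [← e3]
  refine integral_congr_ae (Eventually.of_forall fun z => ?_)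
  simp only
  ring

/-- The second half of the Pestov identity. -/
theorem integral_sum_delta_mul_Xvu (hg : IsC11Metric g) (hn : n ≠ 0)
    (hu : UnifLip g u) (hu0 : VanishesAtBoundary g u) (hX : IsH1 g (geoX g u) XXu vXu hXu)
    (hv : IsH1NX g (gradV g u) Xvu) :
    ∫ z, ∑ k, delta g k u z * Xvu z k ∂(sigma g)
      = -∫ z, gInner g z.1 (hXu z) (gradV g u z) ∂(sigma g)
        - ∫ z, gInner g z.1 (curv g (gradV g u) z) (gradV g u z) ∂(sigma g) := by
  have := hg.isFiniteMeasure_sigma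
  obtain ⟨Vk, hVk, hVl, hXl⟩ := hv.approx
  have hV := lTo_apply_of_tendstoL2N hg hn
    (fun k i => ((hVk k).unifLip_apply hg hn i).memLp_top hg hn) hv.memL2 hVl
  have hXV := lTo_apply_of_tendstoL2N hg hn
    (fun k i => (hVk k).memLp_top_geoXN hg hn i) hv.memL2_X hXl
  have hh := hX.memL2_h.memLp_apply hg hn
  have m1 := lTo_sum_mul hg (fun k => hu.memLp_top_delta hg hn k) hXV
  have m2 := lTo_sum_mul hg (fun k => hu.memLp_top_partialV hg hn k)
    (lTo_curv_apply hg hn one_le_two hV)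
  have m3 := lTo_gInner hg hn (fun i => LTo.const (hh i)) hV
  have m4 := lTo_sum_mul hg (fun k => hu.memLp_top_delta hg hn k) hV
  have m5 := (m1.add le_rfl m2).add le_rfl m3
  have i5 := memLp_one_iff_integrable.1 m5.2
  have hct := fun m => ((cutoff_cut (n := n) m).unifLip hg hn).memLp_top hg hn
  have hdcv : ∀ m, MemLp (fun z : Pt n × Pt n => fderiv ℝ (cut m) z.1 z.2) ∞ (sigma g) := fun m =>
    hg.memLp_top_of_continuousOn hn
      ((cutoff_cut m).contDiff.continuous_fderiv_apply one_ne_zero).continuousOn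
  -- With the cutoff fixed, the C¹ approximants of ∇^v u converge; they need not vanish at the
  -- boundary, so the cutoff is removed only afterwards.
  have e1 : ∀ m, ∫ z, cut m z.1 * (∑ k, delta g k u z * Xvu z k
      + ∑ l, partialV g l u z * curv g (gradV g u) z l
      + gInner g z.1 (hXu z) (gradV g u z)) ∂(sigma g)
      + ∫ z, fderiv ℝ (cut m) z.1 z.2 * ∑ k, delta g k u z * gradV g u z k ∂(sigma g) = 0 := by
    intro m
    rw [← integral_add (integrable_bdd_mul (hct m) i5) (integrable_bdd_mul (hdcv m)
      (memLp_one_iff_integrable.1 m4.2))]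
    exact ((m5.bdd_mul (hct m)).add le_rfl (m4.bdd_mul (hdcv m))).integral_eq_zero fun k =>
      integral_cut_commutator hg hn (cutoff_cut m) hu hX (hVk k)
  have h1 := (tendsto_integral_cut_mul hg hn i5).add (tendsto_integral_boundary hg hn hu hu0 hv)
  simp only [e1, add_zero] at h1
  have h2 := tendsto_nhds_unique h1 tendsto_const_nhds
  have i1 := memLp_one_iff_integrable.1 m1.2
  have i2 := memLp_one_iff_integrable.1 m2.2
  have i3 := memLp_one_iff_integrable.1 m3.2
  rw [integral_add (memLp_one_iff_integrable.1 (m1.add le_rfl m2).2) i3, integral_add i1 i2] at h2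
  have h3 : ∫ z, ∑ l, partialV g l u z * curv g (gradV g u) z l ∂(sigma g)
      = ∫ z, gInner g z.1 (curv g (gradV g u) z) (gradV g u z) ∂(sigma g) := by
    refine integral_congr_ae ?_
    filter_upwards [hg.ae_mem_SM hn] with z hz
    rw [hg.gInner_comm hz.1.1, hg.gInner_gradV_left hz.1.1]
  linear_combination h2 - h3

end Pestov

end SimpleC11

namespace SimpleC11

/-! ### The commutator of the vertical gradient and the geodesic derivative -/

section Commutator

variable {n : ℕ} {g : MetricField n} {u XXu : Pt n × Pt n → ℝ} {vXu hXu Xvu : Pt n × Pt n → Pt n}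

/-- The component of the `j`-th coordinate vector orthogonal to `v`. -/
noncomputable def frameN (g : MetricField n) (j : Fin n) (z : Pt n × Pt n) : Pt n :=
  e j - gInner g z.1 (e j) z.2 • z.2

theorem IsC11Metric.isC1N_frameN (hg : IsC11Metric g) (j : Fin n) : IsC1N g (frameN g j) := by
  refine ⟨?_, fun z hz => ?_⟩
  · have h2 : ContDiffOn ℝ 1 (fun z => (radial g z).2) (slitTM n) :=
      contDiff_snd.comp_contDiffOn hg.contDiffOn_radial
    have h1 : ContDiffOn ℝ 1 (fun z : Pt n × Pt n => gInner g z.1 (e j) (radial g z).2)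
        (slitTM n) :=
      hg.contDiffOn_gInner contDiffOn_fst (fun _ hz => hz.1) contDiffOn_const h2
    exact contDiffOn_const.sub (h1.smul h2)
  · rw [frameN, gInner_sub_left, gInner_smul_left, hz.2, mul_one, sub_self]

/-- The vectors are the orthogonal projections of the coordinate vectors to the complement of v, so
they reproduce every vector orthogonal to v with its own coordinates. -/
theorem sum_smul_frameN {z : Pt n × Pt n} {Y : Pt n} (hY : gInner g z.1 Y z.2 = 0) :
    ∑ j, Y j • frameN g j z = Y := by
  have h : ∀ s : Finset (Fin n), ∑ j ∈ s, Y j * gInner g z.1 (e j) z.2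
      = gInner g z.1 (∑ j ∈ s, Y j • e j) z.2 := by
    intro s
    classical
    induction s using Finset.induction_on with
    | empty => simp [gInner_zero_left]
    | insert a s ha ih => rw [Finset.sum_insert ha, Finset.sum_insert ha, gInner_add_left,
        gInner_smul_left, ih]
  simp only [frameN, smul_sub, Finset.sum_sub_distrib, smul_smul, ← Finset.sum_smul, h, sum_smul_e,
    hY, zero_smul, sub_zero]

theorem IsC1N.memLp_top_divV (hg : IsC11Metric g) (hn : n ≠ 0) {W : Pt n × Pt n → Pt n}
    (hW : IsC1N g W) : MemLp (divV g W) ∞ (sigma g) :=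
  memLp_finsetSum _ fun j _ => (hW.unifLip_apply hg hn j).memLp_top_partialV hg hn j

/-- The Sobolev vertical gradient is also a weak one, as seen on the C¹ approximants. -/
theorem IsH1.integral_divV (hg : IsC11Metric g) (hn : n ≠ 0) {w : Pt n × Pt n → ℝ}
    (hX : IsH1 g w XXu vXu hXu) {W : Pt n × Pt n → Pt n} (hW : IsC1N g W) (hs : XSupp W) :
    ∫ z, (w z * divV g W z + gInner g z.1 (vXu z) (W z)) ∂(sigma g) = 0 := by
  have := hg.isFiniteMeasure_sigma
  obtain ⟨wk, hwk, h1, -, h3, -⟩ := hX.approx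
  have hw := fun k => (hwk k).unifLip hg hn
  have l1 : LTo (sigma g) 2 wk w :=
    ⟨fun k => ((hw k).memLp_top hg hn).mono_exponent le_top, hX.memL2, h1⟩
  have l3 := lTo_apply_of_tendstoL2N hg hn (fun k i => (hw k).memLp_top_gradV hg hn i) hX.memL2_v h3
  refine ((l1.mul_memLp ((hW.memLp_top_divV hg hn).mono_exponent le_top)).add le_rfl
    (lTo_gInner hg hn l3 fun i => LTo.const (hW.memLp_two_apply hg hn i))).integral_eq_zero
    fun k => ?_
  have hk := IsC1N.smul (hwk k) hW
  obtain ⟨r, hr, h0⟩ := hs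
  rw [← hg.integral_divV hn hk.lipSM ⟨r, hr, fun z hz => by simp [h0 z hz]⟩ hk.orth]
  refine integral_congr_ae ?_
  filter_upwards [hg.ae_mem_SM hn] with z hz
  rw [((hwk k).diffPt hz).divV_smul fun i => (hW.apply i).diffPt hz, hg.gInner_gradV_left hz.1.1]

theorem IsH1NX.integral_gInner_geoXN (hg : IsC11Metric g) (hn : n ≠ 0)
    {V XV : Pt n × Pt n → Pt n} (hV : IsH1NX g V XV) {W : Pt n × Pt n → Pt n} (hW : IsC1N g W)
    (hs : XSupp W) :
    ∫ z, (gInner g z.1 (XV z) (W z) + gInner g z.1 (V z) (geoXN g W z)) ∂(sigma g) = 0 := by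
  have := hg.isFiniteMeasure_sigma
  obtain ⟨Vk, hVk, hVl, hXl⟩ := hV.approx
  have l1 := lTo_apply_of_tendstoL2N hg hn
    (fun k i => ((hVk k).unifLip_apply hg hn i).memLp_top hg hn) hV.memL2 hVl
  have l2 := lTo_apply_of_tendstoL2N hg hn
    (fun k i => (hVk k).memLp_top_geoXN hg hn i) hV.memL2_X hXl
  refine ((lTo_gInner hg hn l2 fun i => LTo.const (hW.memLp_two_apply hg hn i)).add le_rfl
    (lTo_gInner hg hn l1 fun i => LTo.const (hW.memLp_two_geoXN hg hn i))).integral_eq_zero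
    fun k => ?_
  obtain ⟨r, hr, h0⟩ := hs
  rw [← hg.integral_geoX hn (((hVk k).isC1_gInner hg hW).lipSM)
    ⟨r, hr, fun z hz => by simp only [h0 z hz, gInner_zero_right]⟩]
  refine integral_congr_ae ?_
  filter_upwards [hg.ae_mem_SM hn] with z hz
  rw [(hVk k).geoX_gInner hg hW hz]

/-- In the weak commutator of X and ∇^v, the derivatives on the test section are returned to Xu and
∇^v u by the weak characterizations of their Sobolev derivatives. -/
theorem integral_commutator_gradV_geoX (hg : IsC11Metric g) (hn : n ≠ 0) (hu : UnifLip g u)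
    (hX : IsH1 g (geoX g u) XXu vXu hXu) (hv : IsH1NX g (gradV g u) Xvu)
    {W : Pt n × Pt n → Pt n} (hW : IsC1N g W) (hs : XSupp W) :
    ∫ z, (gInner g z.1 (vXu z) (W z) - gInner g z.1 (Xvu z) (W z) - ∑ k, delta g k u z * W z k)
      ∂(sigma g) = 0 := by
  have := hg.isFiniteMeasure_sigma
  have h1 := hg.integral_commutator_geoX_partialV hn hu.lip hW.lipSM hs hW.orth
  have h2 := hX.integral_divV hg hn hW hs
  have h3 := hv.integral_gInner_geoXN hg hn hW hs
  have hW2 := hW.memLp_two_apply hg hn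
  have i1 := integrable_gInner hg hn (hX.memL2_v.memLp_apply hg hn) hW2
  have i2 := integrable_gInner hg hn (hv.memL2_X.memLp_apply hg hn) hW2
  have i3 := integrable_sum_mul hg (fun k => hu.memLp_top_delta hg hn k) hW2
  have i4 := integrable_gInner hg hn (hv.memL2.memLp_apply hg hn) (hW.memLp_two_geoXN hg hn)
  have i5 : Integrable (fun z => geoX g u z * divV g W z) (sigma g) :=
    integrable_bdd_mul (hu.memLp_top_geoX hg hn) ((hW.memLp_top_divV hg hn).integrable le_top)
  have e1 : ∫ z, (gInner g z.1 (gradV g u z) (geoXN g W z) - geoX g u z * divV g W z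
      - ∑ k, delta g k u z * W z k) ∂(sigma g) = 0 := by
    rw [← h1]
    refine integral_congr_ae ?_
    filter_upwards [hg.ae_mem_SM hn] with z hz
    rw [hg.gInner_gradV_left hz.1.1]
    simp only [DiffPt.geoXN_apply (fun k => (hW.apply k).diffPt hz) ⟨hz.2, ne_zero_of_mem_SM hz.1⟩]
  have i45 : Integrable (fun z => gInner g z.1 (gradV g u z) (geoXN g W z)
      - geoX g u z * divV g W z) (sigma g) := i4.sub i5
  have i12 : Integrable (fun z => gInner g z.1 (vXu z) (W z) - gInner g z.1 (Xvu z) (W z))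
      (sigma g) := i1.sub i2
  rw [integral_sub i45 i3, integral_sub i4 i5] at e1
  rw [integral_add i5 i1] at h2
  rw [integral_add i2 i4] at h3
  rw [integral_sub i12 i3, integral_sub i1 i2]
  linear_combination e1 + h2 - h3

theorem IsC11Metric.isC1_of_contDiff (hg : IsC11Metric g) {φ : Pt n × Pt n → ℝ}
    (hφ : ContDiff ℝ 1 φ) : IsC1 g φ := hφ.comp_contDiffOn hg.contDiffOn_radial

theorem xSupp_of_tsupport_subset {φ : Pt n × Pt n → ℝ} (hc : HasCompactSupport φ)
    (hs : tsupport φ ⊆ Metric.ball 0 1 ×ˢ univ) : XSupp φ := by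
  rcases (tsupport φ).eq_empty_or_nonempty with h | h
  · exact ⟨0, one_pos, fun z _ => by rw [tsupport_eq_empty_iff.1 h, Pi.zero_apply]⟩
  · obtain ⟨y, hy, hmax⟩ := hc.isCompact.exists_isMaxOn h
      (f := fun z : Pt n × Pt n => ‖z.1‖) (by fun_prop)
    refine ⟨‖y.1‖, by simpa using (hs hy).1, fun z hz => ?_⟩
    by_contra h0
    exact (hmax (subset_tsupport _ h0)).not_gt hz

/-- The commutator formula `∇^v X u - X ∇^v u = ∇^h u`, paired with vectors orthogonal to `v`. -/
theorem ae_commutator_gradV_geoX (hg : IsC11Metric g) (hn : n ≠ 0) (hu : UnifLip g u)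
    (hX : IsH1 g (geoX g u) XXu vXu hXu) (hv : IsH1NX g (gradV g u) Xvu) :
    ∀ᵐ z ∂(sigma g), ∀ Y, gInner g z.1 Y z.2 = 0 →
      gInner g z.1 (vXu z) Y - gInner g z.1 (Xvu z) Y = ∑ k, delta g k u z * Y k := by
  have := hg.isFiniteMeasure_sigma
  set D : Fin n → Pt n × Pt n → ℝ := fun j z => gInner g z.1 (vXu z) (frameN g j z)
    - gInner g z.1 (Xvu z) (frameN g j z) - ∑ k, delta g k u z * frameN g j z k with hD
  have h : ∀ j, ∀ᵐ z ∂(sigma g), z ∈ Metric.ball (0 : Pt n) 1 ×ˢ (univ : Set (Pt n)) → D j z = 0 := by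
    intro j
    have hE2 := (hg.isC1N_frameN j).memLp_two_apply hg hn
    have hi : Integrable (D j) (sigma g) :=
      ((integrable_gInner hg hn (hX.memL2_v.memLp_apply hg hn) hE2).sub
        (integrable_gInner hg hn (hv.memL2_X.memLp_apply hg hn) hE2)).sub
        (integrable_sum_mul hg (fun k => hu.memLp_top_delta hg hn k) hE2)
    -- Test functions with compact support over the open ball, multiplied by the projected
    -- coordinate vectors, are admissible sections; testing with all of them gives the formula
    -- almost everywhere.
    refine IsOpen.ae_eq_zero_of_integral_contDiff_smul_eq_zero
      (Metric.isOpen_ball.prod isOpen_univ) (hi.locallyIntegrable.locallyIntegrableOn _)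
      fun φ hφ hc hs => ?_
    obtain ⟨r, hr, h0⟩ := xSupp_of_tsupport_subset hc hs
    have hφ1 : IsC1 g φ := hg.isC1_of_contDiff (hφ.of_le (by exact_mod_cast le_top))
    rw [← integral_commutator_gradV_geoX hg hn hu hX hv (IsC1N.smul hφ1 (hg.isC1N_frameN j))
      ⟨r, hr, fun z hz => by simp [h0 z hz]⟩]
    refine integral_congr_ae (Eventually.of_forall fun z => ?_)
    simp only [hD, gInner_smul_right, smul_eq_mul, PiLp.smul_apply, mul_sub, Finset.mul_sum,
      mul_left_comm]
  filter_upwards [ae_all_iff.2 h, hg.ae_mem_SM hn] with z hz hzS Y hY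
  -- The defect is linear in Y, so its vanishing on the finitely many projected coordinate vectors
  -- gives one null set for all Y orthogonal to v.
  let T : Pt n →ₗ[ℝ] ℝ :=
    { toFun := fun Y => gInner g z.1 (vXu z) Y - gInner g z.1 (Xvu z) Y - ∑ k, delta g k u z * Y k
      map_add' := fun a b => by
        simp only [gInner_add_right, PiLp.add_apply, mul_add, Finset.sum_add_distrib]
        ring
      map_smul' := fun c a => by
        simp only [gInner_smul_right, PiLp.smul_apply, smul_eq_mul, mul_left_comm _ c,
          ← Finset.mul_sum, RingHom.id_apply]
        ring }
  have hT : T Y = 0 := by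
    rw [← sum_smul_frameN hY, map_sum]
    refine Finset.sum_eq_zero fun j _ => ?_
    rw [map_smul]
    have : T (frameN g j z) = 0 := hz j ⟨hzS.2, mem_univ _⟩
    rw [this, smul_zero]
  exact sub_eq_zero.1 hT

end Commutator

/-! ### The identity -/

/-- |a|² - |b|² = ⟨a - b, a⟩ + ⟨a - b, b⟩ with a = ∇^v Xu and b = X∇^v u. Both are orthogonal to v,
so the commutator formula replaces a - b by ∇^h u, and in the sum of the two halves the pairing of
∇^h Xu with ∇^v u cancels. -/
theorem pestov_identity {n : ℕ} {g : MetricField n} (hg : IsC11Metric g) (hn : n ≠ 0)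
    {u XXu : Pt n × Pt n → ℝ} {vXu hXu Xvu : Pt n × Pt n → Pt n} (hu : UnifLip g u)
    (hu0 : VanishesAtBoundary g u) (hX : IsH1 g (geoX g u) XXu vXu hXu)
    (hv : IsH1NX g (gradV g u) Xvu) :
    sqNormN g vXu = Q g (gradV g u) Xvu + ((n : ℝ) - 1) * sqNorm g (geoX g u) := by
  have h1 := integral_sum_delta_mul_vXu hg hn hu hu0 hX
  have h2 := integral_sum_delta_mul_Xvu hg hn hu hu0 hX hv
  have hv2 := hX.memL2_v.memLp_apply hg hn
  have hx2 := hv.memL2_X.memLp_apply hg hn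
  have h3 : ∫ z, (gInner g z.1 (vXu z) (vXu z) - gInner g z.1 (Xvu z) (Xvu z)) ∂(sigma g)
      = ∫ z, (∑ k, delta g k u z * vXu z k + ∑ k, delta g k u z * Xvu z k) ∂(sigma g) := by
    refine integral_congr_ae ?_
    filter_upwards [ae_commutator_gradV_geoX hg hn hu hX hv, hg.ae_mem_SM hn, hX.memL2_v.orth,
      hv.memL2_X.orth] with z hz hzS h4 h5
    rw [← hz _ h4, ← hz _ h5, hg.gInner_comm hzS.1.1 (Xvu z) (vXu z)]
    ring
  rw [integral_sub (integrable_gInner hg hn hv2 hv2) (integrable_gInner hg hn hx2 hx2),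
    integral_add (integrable_sum_mul hg (fun k => hu.memLp_top_delta hg hn k) hv2)
      (integrable_sum_mul hg (fun k => hu.memLp_top_delta hg hn k) hx2)] at h3
  simp only [sqNormN, Q, innerN, sqNorm]
  linear_combination h3 + h1 + h2

end SimpleC11
theorem mainTheorem2 {n : ℕ} (hn : 2 ≤ n) (g : SimpleC11.MetricField n)
    (hg : SimpleC11.IsSimple g)
    (u : SimpleC11.Pt n × SimpleC11.Pt n → ℝ) (hu : SimpleC11.IsLip0 g u)
    -- `Xu ∈ H¹(SM)`, with `X(Xu)`, `∇^v(Xu)` and `∇^h(Xu)`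
    (XXu : SimpleC11.Pt n × SimpleC11.Pt n → ℝ)
    (vXu hXu : SimpleC11.Pt n × SimpleC11.Pt n → SimpleC11.Pt n)
    (hXu_mem : SimpleC11.IsH1 g (SimpleC11.geoX g u) XXu vXu hXu)
    -- `∇^v u ∈ H¹(N, X)`, with `X(∇^v u)`
    (Xvu : SimpleC11.Pt n × SimpleC11.Pt n → SimpleC11.Pt n)
    (hvu_mem : SimpleC11.IsH1NX g (SimpleC11.gradV g u) Xvu) :
    SimpleC11.sqNormN g vXu =
      SimpleC11.Q g (SimpleC11.gradV g u) Xvu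
        + ((n : ℝ) - 1) * SimpleC11.sqNorm g (SimpleC11.geoX g u) := by
  obtain ⟨K, hK⟩ := hu.lip
  have hn0 : n ≠ 0 := by omega
  exact SimpleC11.pestov_identity hg.metric hn0
    (SimpleC11.unifLip_of_lipschitzOnWith hg.metric hn0 hK)
    (SimpleC11.vanishesAtBoundary_of_isLip0 hg.metric hn0 hu) hXu_mem hvu_mem
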